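/- Let $N \ge 2$ and $1 \le k \le N$. Let $\mathcal{H}(\mathbb{R}^N)$ be the space of real-valued harmonic functions on $\mathbb{R}^N$ with the topology of local uniform convergence, given by the seminorms $\|h\|_m = \sup_{|x|=m}|h(x)|$, $m = 1,2,\dots$, and let $T = \partial/\partial x_k$ act on $\mathcal{H}(\mathbb{R}^N)$. For $h \in \mathcal{H}(\mathbb{R}^N)$ and $r>0$ put $$M_2(h,r) = \left( \int_{S(r)} |h|^2 \, d\sigma_r \right)^{1/2},$$ where $\sigma_r$ is the normalised surface measure ($\sigma_r(S(r))=1$) on the sphere $S(r)$ of radius $r$ centred at $0$. The upper density of $A \subset \mathbb{N}$ is $\overline{\mathrm{dens}}(A) = \limsup_{n\to\infty} |A \cap \{1,\dots,n\}|/n$. A function $h \in \mathcal{H}(\mathbb{R}^N)$ is called $\partial/\partial x_k$-distributionally irregular if there are $m \ge 1$ and $A, B \subset \mathbb{N}$, both of upper density $1$, such that $\|T^n h\|_m \to \infty$ as $n \to \infty$ with $n \in B$, and $T^n h \to 0$ in $\mathcal{H}(\mathbb{R}^N)$ as $n \to \infty$ with $n \in A$. (i) For every function $\varphi \colon \mathbb{R}_+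 \to \mathbb{R}_+$ with $\varphi(r) \to \infty$ as $r \to \infty$ there exists a $\partial/\partial x_k$-distributionally irregular $h \in \mathcal{H}(\mathbb{R}^N)$ such that $$M_2(h,r) \le \varphi(r)\, \frac{e^r}{r^{N/2-3/4}}$$ for all sufficiently large $r>0$. (ii) There is no $\partial/\partial x_k$-distributionally irregular $h \in \mathcal{H}(\mathbb{R}^N)$ for which there is a constant $c>0$ such that $$M_2(h,r) \le c\, \frac{e^r}{r^{N/2-3/4}}$$ for all sufficiently large $r>0$. -/

import Mathlib

open Filter Topology MeasureTheory

noncomputable section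

/-- The upper density `limsup_{n → ∞} |A ∩ {1, …, n}| / n` of a set `A` of natural numbers.
(The quotients lie in `[0, 1]`, so this limsup of reals is the genuine one.) -/
def upperDensity (A : Set ℕ) : ℝ :=
  limsup (fun n : ℕ => ((A ∩ Set.Icc 1 n).ncard : ℝ) / (n : ℝ)) atTop

/-- The `T`-orbit of `x` is distributionally near to `0`: along a set `A` of upper density `1`,
`T^n x → 0` in the topology given by the seminorms `p 0, p 1, …`. -/
def OrbitDistributionallyNearZero {X : Type*} (p : ℕ → X → ℝ) (T : X → X) (x : X) : Prop :=
  ∃ A : Set ℕ, upperDensity A = 1 ∧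
    ∀ m : ℕ, Tendsto (fun n : ℕ => p m (T^[n] x)) (atTop ⊓ 𝓟 A) (𝓝 0)

/-- The `T`-orbit of `x` is distributionally unbounded: for one of the seminorms `p m`,
`p m (T^n x) → ∞` along a set `B` of upper density `1`. -/
def OrbitDistributionallyUnbounded {X : Type*} (p : ℕ → X → ℝ) (T : X → X) (x : X) : Prop :=
  ∃ m : ℕ, ∃ B : Set ℕ, upperDensity B = 1 ∧
    Tendsto (fun n : ℕ => p m (T^[n] x)) (atTop ⊓ 𝓟 B) atTop

/-- `x` is a distributionally irregular vector for `T`, with respect to the seminorms `p`. -/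
def DistributionallyIrregular {X : Type*} (p : ℕ → X → ℝ) (T : X → X) (x : X) : Prop :=
  OrbitDistributionallyUnbounded p T x ∧ OrbitDistributionallyNearZero p T x

/-- A harmonic function on the whole of `ℝ^N` (twice continuously differentiable, with vanishing
Laplacian). -/
def IsHarmonicOnSpace {N : ℕ} (h : EuclideanSpace ℝ (Fin N) → ℝ) : Prop :=
  InnerProductSpace.HarmonicOnNhd h Set.univ

/-- The partial differentiation operator `∂/∂x_k`. It is applied below to harmonic functions only;
these are smooth, and their partial derivatives are again harmonic. -/
def partialDeriv {N : ℕ} (k : Fin N) (f : EuclideanSpace ℝ (Fin N) → ℝ) :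
    EuclideanSpace ℝ (Fin N) → ℝ :=
  fun x => fderiv ℝ f x (EuclideanSpace.single k 1)

/-- The seminorms `sup_{|x| = m + 1} |f(x)|`, `m = 0, 1, 2, …`, which define the topology of local
uniform convergence on the space of harmonic functions on `ℝ^N`, `N ≥ 2`. -/
def sphereSup {N : ℕ} (m : ℕ) (f : EuclideanSpace ℝ (Fin N) → ℝ) : ℝ :=
  ⨆ x : Metric.sphere (0 : EuclideanSpace ℝ (Fin N)) ((m : ℝ) + 1),
    |f (x : EuclideanSpace ℝ (Fin N))|

/-- `M₂(h, r)`: the average `L²`-norm of `h` on the sphere of radius `r` about `0`, taken with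
respect to normalised surface measure. That measure is the image, under `y ↦ r • y`, of the
normalised surface measure of the unit sphere, and `⨍` is the integral divided by the total mass. -/
def M₂ {N : ℕ} (h : EuclideanSpace ℝ (Fin N) → ℝ) (r : ℝ) : ℝ :=
  Real.sqrt (⨍ y : Metric.sphere (0 : EuclideanSpace ℝ (Fin N)) 1,
    |h (r • (y : EuclideanSpace ℝ (Fin N)))| ^ 2
      ∂((volume : Measure (EuclideanSpace ℝ (Fin N))).toSphere))

end

/-! Write T for the derivative along the axis `k`. Everything rests on the zonal harmonics Z_j with
that axis (`zonal`), normalised so that T Z_(j+1) = Z_j. On the unit sphere they are orthogonal, and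
pairing a harmonic h with Z_j returns T^j h(0) times the mean square q_j of Z_j and the total
surface mass (`zonalCoeff_eq`). Here q_j is comparable to 1 / (j!² (j+1)^(N-2))
(`exists_zonalNormSq_bounds`). Put G(r) = e^r / r^(N/2-3/4). As a function of r, q_n r^(2n) / G(r)²
is of order n^(-1/2) on a window of length about √n starting at r = n; this is the origin of the
exponent 3/4.

Existence. On series Σ a_j Z_j the operator T is the backward shift of coefficients. Let a_j equal i
on the i-th block of integers if i is odd, and 0 if i is even, the block lengths growing fast. Since
Z_0 = 1 and every Z_j is positive at the axis point, the n-th iterate there is at least a_n, which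
tends to infinity along the odd blocks. Well inside an even block the n-th iterate begins with a
long run of zero coefficients, and what remains is a tail of a convergent series. Orthogonality and
Σ q_j r^(2j) ≤ C G(r)² (`exists_sum_zonalNormSq_le`) give M₂(h, r)² ≤ (C i² + 1) G(r)² while only
coefficients up to i matter; starting the blocks late enough keeps this below φ(r)² G(r)².

Non-existence. Bessel's inequality for spheres centred at x gives Σ q_n ρ^(2n) (T^n h(x))² ≤ mean of
h² on the sphere of radius ρ about x. Averaging over x in a ball of radius R turns the right side,
by rotation invariance, into a weighted mean over centred spheres with radii within R of ρ
(`integral_ball_sphere_le`), hence into a multiple of G(ρ)². Dividing by G(ρ)² and summing over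
integers ρ < 2K, each n < K beyond a fixed index collects a weight bounded below from its window
(`exists_window_lower_bound`). So the integrals of (T^n h)² over the ball have bounded Cesàro means,
and these integrals dominate the squared seminorm (`sphereSup_sq_le`). By Chebyshev's inequality the
seminorms cannot tend to infinity along a set of upper density one, so the unboundedness half of
irregularity already fails. -/

/-! ### Polar coordinates and differentiation under the integral sign -/

section Polar

variable {E : Type*} [NormedAddCommGroup E] [InnerProductSpace ℝ E] [FiniteDimensional ℝ E]
  [MeasurableSpace E] [BorelSpace E]

/-- Polar coordinates for nonnegative functions. -/
theorem lintegral_polar [Nontrivial E] {f : E → ENNReal} (hf : Measurable f) :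
    ∫⁻ x, f x = ∫⁻ r in Set.Ioi (0 : ℝ), ENNReal.ofReal (r ^ (Module.finrank ℝ E - 1)) *
      ∫⁻ y : Metric.sphere (0 : E) 1, f (r • (y : E)) ∂(volume : Measure E).toSphere := by
  have hmp := (volume : Measure E).measurePreserving_homeomorphUnitSphereProd
  have hme := (homeomorphUnitSphereProd E).measurableEmbedding
  set n := Module.finrank ℝ E - 1
  have hm : Measurable fun p : Metric.sphere (0 : E) 1 × Set.Ioi (0 : ℝ) =>
      f ((p.2 : ℝ) • (p.1 : E)) := hf.comp (by fun_prop)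
  have hm2 : Measurable fun r : ℝ => ∫⁻ y : Metric.sphere (0 : E) 1, f (r • (y : E))
      ∂(volume : Measure E).toSphere := by
    refine Measurable.lintegral_prod_right' (f := fun p : ℝ × Metric.sphere (0 : E) 1 =>
      f (p.1 • (p.2 : E))) (hf.comp (by fun_prop))
  calc ∫⁻ x, f x = ∫⁻ x : ({(0)}ᶜ : Set E), f x ∂(volume.comap Subtype.val) := by
        rw [lintegral_subtype_comap (measurableSet_singleton _).compl, restrict_compl_singleton]
    _ = ∫⁻ p, f ((p.2 : ℝ) • (p.1 : E)) ∂(volume : Measure E).toSphere.prod (.volumeIoiPow n) := by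
        rw [← hmp.lintegral_comp_emb hme]
        refine lintegral_congr fun x => ?_
        have : ((homeomorphUnitSphereProd E).symm (homeomorphUnitSphereProd E x) : E) = x := by simp
        rw [homeomorphUnitSphereProd_symm_apply_coe] at this
        rw [this]
    _ = ∫⁻ r, ∫⁻ y, f ((r : ℝ) • (y : E)) ∂(volume : Measure E).toSphere
          ∂(Measure.volumeIoiPow n) := lintegral_prod_symm' _ hm
    _ = _ := by
        rw [Measure.volumeIoiPow]
        refine (lintegral_withDensity_eq_lintegral_mul _ (by fun_prop)
          (hm2.comp measurable_subtype_coe)).trans ?_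
        exact lintegral_subtype_comap measurableSet_Ioi
          (fun r : ℝ => ENNReal.ofReal (r ^ n) *
            ∫⁻ y : Metric.sphere (0 : E) 1, f (r • (y : E)) ∂(volume : Measure E).toSphere)

/-- Polar coordinates for integrable functions. -/
theorem integral_polar [Nontrivial E] {f : E → ℝ} (hf : Integrable f) :
    ∫ x, f x = ∫ r in Set.Ioi (0 : ℝ), r ^ (Module.finrank ℝ E - 1) *
      ∫ y : Metric.sphere (0 : E) 1, f (r • (y : E)) ∂(volume : Measure E).toSphere := by
  have hmp := (volume : Measure E).measurePreserving_homeomorphUnitSphereProd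
  have hme := (homeomorphUnitSphereProd E).measurableEmbedding
  set n := Module.finrank ℝ E - 1
  have key : ∀ x : ({(0)}ᶜ : Set E), f x = (fun p : Metric.sphere (0 : E) 1 × Set.Ioi (0 : ℝ) =>
      f ((p.2 : ℝ) • (p.1 : E))) (homeomorphUnitSphereProd E x) := by
    intro x
    have : ((homeomorphUnitSphereProd E).symm (homeomorphUnitSphereProd E x) : E) = x := by simp
    rw [homeomorphUnitSphereProd_symm_apply_coe] at this
    simp only [this]
  have hint : Integrable (fun p : Metric.sphere (0 : E) 1 × Set.Ioi (0 : ℝ) =>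
      f ((p.2 : ℝ) • (p.1 : E))) ((volume : Measure E).toSphere.prod (.volumeIoiPow n)) := by
    rw [← hmp.integrable_comp_emb hme]
    have : (fun p : Metric.sphere (0 : E) 1 × Set.Ioi (0 : ℝ) =>
      f ((p.2 : ℝ) • (p.1 : E))) ∘ (homeomorphUnitSphereProd E) = f ∘ (↑) := by
      ext x; exact (key x).symm
    rw [this, ← integrableOn_iff_comap_subtypeVal (measurableSet_singleton _).compl]
    exact hf.integrableOn
  calc ∫ x, f x = ∫ x : ({(0)}ᶜ : Set E), f x ∂(volume.comap Subtype.val) := by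
        rw [integral_subtype_comap (measurableSet_singleton _).compl, restrict_compl_singleton]
    _ = ∫ p, f ((p.2 : ℝ) • (p.1 : E)) ∂(volume : Measure E).toSphere.prod (.volumeIoiPow n) := by
        rw [← hmp.integral_comp hme]
        exact integral_congr_ae (.of_forall key)
    _ = ∫ r, ∫ y, f ((r : ℝ) • (y : E)) ∂(volume : Measure E).toSphere
          ∂(Measure.volumeIoiPow n) := integral_prod_symm _ hint
    _ = _ := by
        simp only [Measure.volumeIoiPow, ENNReal.ofReal]
        rw [integral_withDensity_eq_integral_smul (by fun_prop)]
        rw [integral_subtype_comap measurableSet_Ioi (fun r : ℝ => Real.toNNReal (r ^ n) •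
            ∫ y : Metric.sphere (0 : E) 1, f (r • (y : E)) ∂(volume : Measure E).toSphere)]
        refine setIntegral_congr_fun measurableSet_Ioi fun r hr => ?_
        simp only [NNReal.smul_def, Real.coe_toNNReal _ (pow_nonneg (le_of_lt hr) _), smul_eq_mul]

/-- Differentiation under the integral sign over a compact space. -/
theorem hasDerivAt_integral_of_compactSpace {X : Type*} [TopologicalSpace X] [CompactSpace X]
    [MeasurableSpace X] [BorelSpace X] {μ : Measure X} [IsFiniteMeasure μ] {F F' : ℝ → X → ℝ}
    (hF : ∀ r, Continuous (F r)) (hF' : Continuous (Function.uncurry F'))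
    (hd : ∀ r x, HasDerivAt (fun s => F s x) (F' r x) r) (r : ℝ) :
    HasDerivAt (fun s => ∫ x, F s x ∂μ) (∫ x, F' r x ∂μ) r := by
  have hint : ∀ g : X → ℝ, Continuous g → Integrable g μ := fun g hg =>
    hg.integrable_of_hasCompactSupport (.of_compactSpace _)
  obtain ⟨C, hC⟩ := ((isCompact_closedBall r 1).prod isCompact_univ).exists_bound_of_continuousOn
    (f := Function.uncurry F') hF'.continuousOn
  refine (hasDerivAt_integral_of_dominated_loc_of_deriv_le (bound := fun _ => C)
    (Metric.closedBall_mem_nhds r one_pos) (.of_forall fun s => (hint _ (hF s)).aestronglyMeasurable)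
    (hint _ (hF r)) (hint _ (by fun_prop)).aestronglyMeasurable
    (.of_forall fun x s hs => hC (s, x) ⟨hs, trivial⟩) (integrable_const _)
    (.of_forall fun x s _ => hd s x)).2

end Polar

/-! ### Radial test functions -/

section Radial

theorem hasFDerivAt_norm_of_ne_zero {E : Type*} [NormedAddCommGroup E]
    [InnerProductSpace ℝ E] {x : E} (hx : x ≠ 0) :
    HasFDerivAt (fun x : E => ‖x‖) (‖x‖⁻¹ • innerSL ℝ x) x := by
  have h := (hasStrictFDerivAt_norm_sq x).hasFDerivAt.sqrt (by simpa using hx)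
  have h2 : (fun x : E => ‖x‖) = fun x : E => √(‖x‖ ^ 2) := by ext y; simp
  rw [h2]
  convert h using 1
  ext v
  simp
  ring

/-- For a test function `χ` supported in `(0, ∞)`, the radial function `χ ‖x‖` is smooth. -/
theorem contDiff_radial {E : Type*} [NormedAddCommGroup E]
    [InnerProductSpace ℝ E] {χ : ℝ → ℝ} {n : ℕ∞} (hχ : ContDiff ℝ n χ) (hs : tsupport χ ⊆ Set.Ioi 0) :
    ContDiff ℝ n fun x : E => χ ‖x‖ := by
  rw [contDiff_iff_contDiffAt]
  intro x
  by_cases hx : x = 0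
  · have h0 : (0 : ℝ) ∉ tsupport χ := fun h => lt_irrefl (0 : ℝ) (hs h)
    have h1 : ∀ᶠ r : ℝ in 𝓝 0, χ r = 0 := notMem_tsupport_iff_eventuallyEq.1 h0
    have h2 : Tendsto (fun x : E => ‖x‖) (𝓝 0) (𝓝 0) := by
      simpa using (continuous_norm (E := E)).tendsto 0
    subst hx
    exact (contDiffAt_const (c := (0 : ℝ))).congr_of_eventuallyEq (h2.eventually h1)
  · exact hχ.contDiffAt.comp x (contDiffAt_norm ℝ hx)

theorem hasCompactSupport_radial {E : Type*} [NormedAddCommGroup E]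
    [InnerProductSpace ℝ E] [FiniteDimensional ℝ E] {χ : ℝ → ℝ} (hχ : HasCompactSupport χ) :
    HasCompactSupport fun x : E => χ ‖x‖ := by
  obtain ⟨R, hR⟩ := hχ.isBounded.subset_closedBall (0 : ℝ)
  refine HasCompactSupport.intro (isCompact_closedBall (0 : E) R) fun x hx => ?_
  by_contra h
  have := hR (subset_tsupport χ h)
  simp at this hx
  linarith

end Radial

/-! ### The divergence theorem in radial form -/

section Flux

variable {E : Type*} [NormedAddCommGroup E] [InnerProductSpace ℝ E] [FiniteDimensional ℝ E]
  [MeasurableSpace E] [BorelSpace E]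

theorem integrable_sphere {f : Metric.sphere (0 : E) 1 → ℝ} (hf : Continuous f) :
    Integrable f (volume : Measure E).toSphere :=
  hf.integrable_of_hasCompactSupport (.of_compactSpace _)

theorem continuous_integral_sphere {X : Type*} [TopologicalSpace X] [FirstCountableTopology X]
    [LocallyCompactSpace X] {f : X → Metric.sphere (0 : E) 1 → ℝ}
    (hf : Continuous (Function.uncurry f)) :
    Continuous fun x => ∫ y, f x y ∂(volume : Measure E).toSphere := by
  simpa using continuous_parametric_integral_of_continuous
    (μ := (volume : Measure E).toSphere) hf isCompact_univ

/-- The radial form of the divergence theorem, for the vector field `g • v`. -/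
theorem hasDerivAt_sphere_flux [Nontrivial E] {g : E → ℝ} (hg : ContDiff ℝ 1 g) (v : E) {r : ℝ}
    (hr : 0 < r) :
    HasDerivAt (fun r : ℝ => r ^ (Module.finrank ℝ E - 1) *
        ∫ y : Metric.sphere (0 : E) 1, g (r • (y : E)) * inner ℝ (y : E) v
          ∂(volume : Measure E).toSphere)
      (r ^ (Module.finrank ℝ E - 1) * ∫ y : Metric.sphere (0 : E) 1, fderiv ℝ g (r • (y : E)) v
          ∂(volume : Measure E).toSphere) r := by
  set d := Module.finrank ℝ E - 1
  set σ := (volume : Measure E).toSphere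
  have hgc : Continuous g := hg.continuous
  have hgd : Continuous (fderiv ℝ g) := hg.continuous_fderiv one_ne_zero
  set b : ℝ → ℝ := fun r => ∫ y : Metric.sphere (0 : E) 1, g (r • (y : E)) * inner ℝ (y : E) v ∂σ
  set b' : ℝ → ℝ := fun r => ∫ y : Metric.sphere (0 : E) 1,
    fderiv ℝ g (r • (y : E)) y * inner ℝ (y : E) v ∂σ
  set a : ℝ → ℝ := fun r => ∫ y : Metric.sphere (0 : E) 1, fderiv ℝ g (r • (y : E)) v ∂σ
  have hb : ∀ r, HasDerivAt b (b' r) r := by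
    refine hasDerivAt_integral_of_compactSpace (fun r => by fun_prop) ?_ fun r y => ?_
    · simp only [Function.uncurry_def]; fun_prop
    · refine HasDerivAt.mul_const ?_ _
      have h1 : HasDerivAt (fun s : ℝ => s • (y : E)) (y : E) r := by
        simpa using (hasDerivAt_id r).smul_const (y : E)
      exact ((hg.differentiable one_ne_zero _).hasFDerivAt).comp_hasDerivAt r h1
  have hbc : Continuous b := continuous_iff_continuousAt.2 fun r => (hb r).continuousAt
  have hb'c : Continuous b' := continuous_integral_sphere (by
    simp only [Function.uncurry_def]; fun_prop)
  have hac : Continuous a := continuous_integral_sphere (by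
    simp only [Function.uncurry_def]; fun_prop)
  set B' : ℝ → ℝ := fun r => d * r ^ (d - 1) * b r + r ^ d * b' r
  have hB : ∀ r, HasDerivAt (fun r => r ^ d * b r) (B' r) r := fun r =>
    (hasDerivAt_pow d r).mul (hb r)
  have hB'c : Continuous B' := by fun_prop
  -- `B'` is the classical derivative of the flux. Integrating by parts in `E` against the radial
  -- function χ(‖x‖), and on the line against χ, identifies `B'` weakly with r^d a(r).
  have weak : ∀ χ : ℝ → ℝ, ContDiff ℝ (⊤ : ℕ∞) χ → HasCompactSupport χ → tsupport χ ⊆ Set.Ioi 0 →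
      ∫ r, χ r • (r ^ d * a r - B' r) = 0 := by
    intro χ hχ hχc hχs
    have hχ0 : ∀ r ∉ Set.Ioi (0 : ℝ), χ r = 0 := fun r hr =>
      image_eq_zero_of_notMem_tsupport fun h => hr (hχs h)
    have hχd0 : ∀ r ∉ Set.Ioi (0 : ℝ), deriv χ r = 0 := fun r hr =>
      image_eq_zero_of_notMem_tsupport fun h => hr (hχs (tsupport_deriv_subset h))
    have hχ' : Continuous (deriv χ) := hχ.continuous_deriv (by simp)
    have hχcont : Continuous χ := hχ.continuous
    have hχ'c : HasCompactSupport (deriv χ) := hχc.deriv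
    have hΨ : ContDiff ℝ (⊤ : ℕ∞) fun x : E => χ ‖x‖ := contDiff_radial hχ hχs
    have hΨc : HasCompactSupport fun x : E => χ ‖x‖ := hasCompactSupport_radial hχc
    have hΨ' : Continuous fun x : E => fderiv ℝ (fun x : E => χ ‖x‖) x v :=
      (hΨ.continuous_fderiv (by simp)).clm_apply continuous_const
    have hΨ'c : HasCompactSupport fun x : E => fderiv ℝ (fun x : E => χ ‖x‖) x v :=
      hΨc.fderiv_apply (𝕜 := ℝ) v
    have i1 : Integrable fun x : E => fderiv ℝ (fun x : E => χ ‖x‖) x v * g x :=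
      (hΨ'.mul hgc).integrable_of_hasCompactSupport hΨ'c.mul_right
    have i2 : Integrable fun x : E => χ ‖x‖ * fderiv ℝ g x v :=
      (hΨ.continuous.mul (hgd.clm_apply continuous_const)).integrable_of_hasCompactSupport
        hΨc.mul_right
    have i3 : Integrable fun x : E => χ ‖x‖ * g x :=
      (hΨ.continuous.mul hgc).integrable_of_hasCompactSupport hΨc.mul_right
    have e1 := integral_mul_fderiv_eq_neg_fderiv_mul_of_integrable i1 i2 i3
      (fun x _ => hΨ.differentiable (by simp) x) (fun x _ => hg.differentiable one_ne_zero x)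
    rw [integral_polar i1, integral_polar i2] at e1
    have nrm : ∀ r ∈ Set.Ioi (0 : ℝ), ∀ y : Metric.sphere (0 : E) 1, ‖r • (y : E)‖ = r := by
      intro r hr y
      simp [norm_smul, abs_of_pos (show 0 < r from hr)]
    have e2 : ∫ r in Set.Ioi (0 : ℝ), r ^ d *
        ∫ y : Metric.sphere (0 : E) 1, χ ‖r • (y : E)‖ * fderiv ℝ g (r • (y : E)) v ∂σ
        = ∫ r, χ r * (r ^ d * a r) := by
      refine Eq.trans ?_ (setIntegral_eq_integral_of_forall_compl_eq_zero (s := Set.Ioi (0 : ℝ))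
        (fun r hr => by rw [hχ0 r hr, zero_mul]))
      refine setIntegral_congr_fun measurableSet_Ioi fun r hr => ?_
      simp only [nrm r hr, integral_const_mul]
      ring
    have e3 : ∫ r in Set.Ioi (0 : ℝ), r ^ d *
        ∫ y : Metric.sphere (0 : E) 1,
          fderiv ℝ (fun x : E => χ ‖x‖) (r • (y : E)) v * g (r • (y : E)) ∂σ
        = ∫ r, deriv χ r * (r ^ d * b r) := by
      refine Eq.trans ?_ (setIntegral_eq_integral_of_forall_compl_eq_zero (s := Set.Ioi (0 : ℝ))
        (fun r hr => by rw [hχd0 r hr, zero_mul]))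
      refine setIntegral_congr_fun measurableSet_Ioi fun r hr => ?_
      have hr' : (0 : ℝ) < r := hr
      have : ∀ y : Metric.sphere (0 : E) 1,
          fderiv ℝ (fun x : E => χ ‖x‖) (r • (y : E)) v * g (r • (y : E))
            = deriv χ r * (g (r • (y : E)) * inner ℝ (y : E) v) := by
        intro y
        have hne : r • (y : E) ≠ 0 := by
          rw [← norm_ne_zero_iff, nrm r hr y]; exact hr'.ne'
        have hd1 : HasDerivAt χ (deriv χ r) ‖r • (y : E)‖ := by
          rw [nrm r hr y]; exact (hχ.differentiable (by simp) r).hasDerivAt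
        have := (hd1.comp_hasFDerivAt (r • (y : E)) (hasFDerivAt_norm_of_ne_zero hne)).fderiv
        rw [show (χ ∘ fun x : E => ‖x‖) = fun x : E => χ ‖x‖ from rfl] at this
        rw [this]
        simp only [nrm r hr y, smul_apply, innerSL_apply_apply, smul_eq_mul,
          inner_smul_left, RCLike.conj_to_real]
        field_simp
      simp only [this, integral_const_mul]
      ring
    rw [e2, e3] at e1
    have hBc : Continuous fun r => r ^ d * b r := by fun_prop
    have e4 := integral_mul_deriv_eq_deriv_mul_of_integrable (u := χ) (u' := deriv χ)
      (v := fun r => r ^ d * b r) (v' := B')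
      (fun r _ => (hχ.differentiable (by simp) r).hasDerivAt) (fun r _ => hB r)
      ((hχcont.mul hB'c).integrable_of_hasCompactSupport hχc.mul_right)
      ((hχ'.mul hBc).integrable_of_hasCompactSupport hχ'c.mul_right)
      ((hχcont.mul hBc).integrable_of_hasCompactSupport hχc.mul_right)
    simp only [smul_eq_mul, mul_sub]
    rw [integral_sub, e1, e4, sub_self]
    · exact (Continuous.mul hχcont (by fun_prop)).integrable_of_hasCompactSupport hχc.mul_right
    · exact (hχcont.mul hB'c).integrable_of_hasCompactSupport hχc.mul_right
  have hDc : Continuous fun r => r ^ d * a r - B' r := by fun_prop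
  -- Vanishing against all test functions gives equality almost everywhere, and continuity of both
  -- sides gives it at every positive radius.
  have hae := isOpen_Ioi.ae_eq_zero_of_integral_contDiff_smul_eq_zero (U := Set.Ioi (0 : ℝ))
    (μ := (volume : Measure ℝ)) (hDc.locallyIntegrable.locallyIntegrableOn _) weak
  have heq := Measure.eqOn_open_of_ae_eq (μ := (volume : Measure ℝ)) (g := fun _ => (0 : ℝ))
    ((ae_restrict_iff' measurableSet_Ioi).2 hae) isOpen_Ioi hDc.continuousOn continuousOn_const hr
  have : B' r = r ^ d * a r := by simp only at heq; linarith
  exact this ▸ hB r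

end Flux

/-! ### Calculus of partial derivatives and the Laplacian -/

section PartialDeriv

variable {N : ℕ}

/-- The Laplacian, as the sum of the second partial derivatives. -/
noncomputable def lap (f : EuclideanSpace ℝ (Fin N) → ℝ) (x : EuclideanSpace ℝ (Fin N)) : ℝ :=
  ∑ i, partialDeriv i (partialDeriv i f) x

theorem contDiff_partialDeriv {n m : ℕ∞} {f : EuclideanSpace ℝ (Fin N) → ℝ} (hf : ContDiff ℝ n f)
    (h : m + 1 ≤ n) (i : Fin N) : ContDiff ℝ m (partialDeriv i f) :=
  (hf.fderiv_right (m := m) (by exact_mod_cast h)).clm_apply contDiff_const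

theorem partialDeriv_mul {f g : EuclideanSpace ℝ (Fin N) → ℝ} (hf : Differentiable ℝ f)
    (hg : Differentiable ℝ g) (i : Fin N) :
    partialDeriv i (fun x => f x * g x) =
      fun x => f x * partialDeriv i g x + partialDeriv i f x * g x := by
  ext x
  simp only [partialDeriv]
  rw [fderiv_fun_mul (hf x) (hg x)]
  simp
  ring

theorem partialDeriv_add {f g : EuclideanSpace ℝ (Fin N) → ℝ} (hf : Differentiable ℝ f)
    (hg : Differentiable ℝ g) (i : Fin N) :
    partialDeriv i (fun x => f x + g x) = fun x => partialDeriv i f x + partialDeriv i g x := by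
  ext x
  simp only [partialDeriv]
  rw [fderiv_fun_add (hf x) (hg x)]
  simp

theorem partialDeriv_sub {f g : EuclideanSpace ℝ (Fin N) → ℝ} (hf : Differentiable ℝ f)
    (hg : Differentiable ℝ g) (i : Fin N) :
    partialDeriv i (fun x => f x - g x) = fun x => partialDeriv i f x - partialDeriv i g x := by
  ext x
  simp only [partialDeriv]
  rw [fderiv_fun_sub (hf x) (hg x)]
  simp

theorem partialDeriv_const_mul {f : EuclideanSpace ℝ (Fin N) → ℝ} (hf : Differentiable ℝ f)
    (c : ℝ) (i : Fin N) : partialDeriv i (fun x => c * f x) = fun x => c * partialDeriv i f x := by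
  ext x
  simp only [partialDeriv]
  rw [fderiv_const_mul (hf x)]
  simp

theorem partialDeriv_const (c : ℝ) (i : Fin N) :
    partialDeriv i (fun _ : EuclideanSpace ℝ (Fin N) => c) = fun _ => 0 := by
  ext x
  simp [partialDeriv]

theorem partialDeriv_coord (i k : Fin N) :
    partialDeriv i (fun x : EuclideanSpace ℝ (Fin N) => x k) = fun _ => if i = k then 1 else 0 := by
  ext x
  have : (fun x : EuclideanSpace ℝ (Fin N) => x k) = EuclideanSpace.proj (𝕜 := ℝ) k := rfl
  simp only [partialDeriv]
  rw [this, ContinuousLinearMap.fderiv]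
  simp [eq_comm]

theorem partialDeriv_norm_sq (i : Fin N) :
    partialDeriv i (fun x : EuclideanSpace ℝ (Fin N) => ‖x‖ ^ 2) = fun x => 2 * x i := by
  ext x
  simp only [partialDeriv]
  rw [fderiv_norm_sq_apply]
  simp [EuclideanSpace.inner_single_right]

theorem fderiv_eq_sum_partialDeriv (f : EuclideanSpace ℝ (Fin N) → ℝ)
    (x v : EuclideanSpace ℝ (Fin N)) : fderiv ℝ f x v = ∑ i, v i * partialDeriv i f x := by
  have hv : v = ∑ i, v i • EuclideanSpace.single i (1 : ℝ) := by
    simpa using ((EuclideanSpace.basisFun (Fin N) ℝ).sum_repr v).symm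
  conv_lhs => rw [hv]
  simp [map_sum, partialDeriv]

theorem lap_mul {f g : EuclideanSpace ℝ (Fin N) → ℝ} (hf : ContDiff ℝ 2 f) (hg : ContDiff ℝ 2 g)
    (x : EuclideanSpace ℝ (Fin N)) :
    lap (fun x => f x * g x) x =
      f x * lap g x + 2 * ∑ i, partialDeriv i f x * partialDeriv i g x + lap f x * g x := by
  have hf1 := hf.differentiable two_ne_zero
  have hg1 := hg.differentiable two_ne_zero
  have hf2 := fun i => (contDiff_partialDeriv (n := 2) (m := 1) hf (by norm_num) i).differentiable
    one_ne_zero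
  have hg2 := fun i => (contDiff_partialDeriv (n := 2) (m := 1) hg (by norm_num) i).differentiable
    one_ne_zero
  simp only [lap, Finset.mul_sum, Finset.sum_mul, ← Finset.sum_add_distrib]
  refine Finset.sum_congr rfl fun i _ => ?_
  have h1 : Differentiable ℝ fun x => f x * partialDeriv i g x := hf1.mul (hg2 i)
  have h2 : Differentiable ℝ fun x => partialDeriv i f x * g x := (hf2 i).mul hg1
  rw [partialDeriv_mul hf1 hg1, partialDeriv_add h1 h2, partialDeriv_mul hf1 (hg2 i), partialDeriv_mul (hf2 i) hg1]
  ring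

theorem lap_sub {f g : EuclideanSpace ℝ (Fin N) → ℝ} (hf : ContDiff ℝ 2 f) (hg : ContDiff ℝ 2 g)
    (x : EuclideanSpace ℝ (Fin N)) : lap (fun x => f x - g x) x = lap f x - lap g x := by
  have hf2 := fun i => (contDiff_partialDeriv (n := 2) (m := 1) hf (by norm_num) i).differentiable
    one_ne_zero
  have hg2 := fun i => (contDiff_partialDeriv (n := 2) (m := 1) hg (by norm_num) i).differentiable
    one_ne_zero
  simp only [lap, ← Finset.sum_sub_distrib]
  refine Finset.sum_congr rfl fun i _ => ?_
  rw [partialDeriv_sub (hf.differentiable two_ne_zero) (hg.differentiable two_ne_zero),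
    partialDeriv_sub (hf2 i) (hg2 i)]

theorem lap_const_mul {f : EuclideanSpace ℝ (Fin N) → ℝ} (hf : ContDiff ℝ 2 f) (c : ℝ)
    (x : EuclideanSpace ℝ (Fin N)) : lap (fun x => c * f x) x = c * lap f x := by
  have hf2 := fun i => (contDiff_partialDeriv (n := 2) (m := 1) hf (by norm_num) i).differentiable
    one_ne_zero
  simp only [lap, Finset.mul_sum]
  refine Finset.sum_congr rfl fun i _ => ?_
  rw [partialDeriv_const_mul (hf.differentiable two_ne_zero), partialDeriv_const_mul (hf2 i)]

theorem lap_const (c : ℝ) (x : EuclideanSpace ℝ (Fin N)) :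
    lap (fun _ : EuclideanSpace ℝ (Fin N) => c) x = 0 := by
  simp [lap, partialDeriv_const]

theorem lap_coord (k : Fin N) (x : EuclideanSpace ℝ (Fin N)) :
    lap (fun x : EuclideanSpace ℝ (Fin N) => x k) x = 0 := by
  simp [lap, partialDeriv_coord, partialDeriv_const]

theorem lap_norm_sq (x : EuclideanSpace ℝ (Fin N)) :
    lap (fun x : EuclideanSpace ℝ (Fin N) => ‖x‖ ^ 2) x = 2 * N := by
  have (i : Fin N) : Differentiable ℝ fun x : EuclideanSpace ℝ (Fin N) => x i := by fun_prop
  simp [lap, partialDeriv_norm_sq, partialDeriv_const_mul (this _), partialDeriv_coord, mul_comm]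

theorem partialDeriv_partialDeriv {f : EuclideanSpace ℝ (Fin N) → ℝ} (hf : ContDiff ℝ 2 f)
    (i j : Fin N) (x : EuclideanSpace ℝ (Fin N)) : partialDeriv i (partialDeriv j f) x =
      fderiv ℝ (fderiv ℝ f) x (EuclideanSpace.single i 1) (EuclideanSpace.single j 1) := by
  have h : DifferentiableAt ℝ (fderiv ℝ f) x :=
    (hf.fderiv_right (m := 1) (by norm_num)).differentiable one_ne_zero x
  change fderiv ℝ (fun y => fderiv ℝ f y (EuclideanSpace.single j 1)) x _ = _
  rw [fderiv_clm_apply h (differentiableAt_const _)]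
  simp

theorem partialDeriv_comm {f : EuclideanSpace ℝ (Fin N) → ℝ} (hf : ContDiff ℝ 2 f)
    (i j : Fin N) : partialDeriv i (partialDeriv j f) = partialDeriv j (partialDeriv i f) := by
  ext x
  rw [partialDeriv_partialDeriv hf, partialDeriv_partialDeriv hf]
  exact hf.contDiffAt.isSymmSndFDerivAt (by simp) _ _

theorem isHarmonicOnSpace_iff {h : EuclideanSpace ℝ (Fin N) → ℝ} :
    IsHarmonicOnSpace h ↔ ContDiff ℝ 2 h ∧ ∀ x, lap h x = 0 := by
  have key : ContDiff ℝ 2 h → ∀ x, Laplacian.laplacian h x = lap h x := by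
    intro hh x
    rw [InnerProductSpace.laplacian_eq_iteratedFDeriv_orthonormalBasis h
      (EuclideanSpace.basisFun (Fin N) ℝ)]
    simp only [lap, partialDeriv_partialDeriv hh, iteratedFDeriv_two_apply]
    simp
  constructor
  · intro H
    have hc : ContDiff ℝ 2 h := contDiff_iff_contDiffAt.2 fun x => (H x trivial).1
    exact ⟨hc, fun x => by rw [← key hc]; exact (H x trivial).2.eq_of_nhds⟩
  · rintro ⟨hc, H⟩ x _
    exact ⟨hc.contDiffAt, .of_forall fun y => by rw [key hc, H]; rfl⟩

theorem lap_partialDeriv {h : EuclideanSpace ℝ (Fin N) → ℝ} (hh : ContDiff ℝ 3 h) (k : Fin N)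
    (x : EuclideanSpace ℝ (Fin N)) : lap (partialDeriv k h) x = partialDeriv k (lap h) x := by
  have h2 : ContDiff ℝ 2 h := hh.of_le (by norm_num)
  have hp := fun i => contDiff_partialDeriv (n := 3) (m := 2) hh (by norm_num) i
  have hpp := fun i => (contDiff_partialDeriv (n := 2) (m := 1) (hp i) (by norm_num) i).differentiable
    one_ne_zero
  have : lap h = ∑ i, partialDeriv i (partialDeriv i h) := by ext y; simp [lap]
  rw [this, partialDeriv, fderiv_sum (fun i _ => hpp i x), sum_apply]
  refine Finset.sum_congr rfl fun i _ => ?_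
  change partialDeriv i (partialDeriv i (partialDeriv k h)) x =
    partialDeriv k (partialDeriv i (partialDeriv i h)) x
  rw [partialDeriv_comm h2 i k, partialDeriv_comm (hp i) i k]

end PartialDeriv

/-! ### Zonal harmonic polynomials -/

section Zonal

variable {N : ℕ}

/-- The zonal harmonic polynomials with axis `k`, normalised so that differentiation in the
direction of the axis lowers the degree by one. -/
noncomputable def zonal (k : Fin N) : ℕ → EuclideanSpace ℝ (Fin N) → ℝ
  | 0 => fun _ => 1
  | 1 => fun x => x k
  | j + 2 => fun x => (((j : ℝ) + 2) * (j + N - 1))⁻¹ *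
      ((2 * j + N) * (x k * zonal k (j + 1) x) - ‖x‖ ^ 2 * zonal k j x)

theorem contDiff_zonal (k : Fin N) (n : ℕ∞) : ∀ j, ContDiff ℝ n (zonal k j)
  | 0 => contDiff_const
  | 1 => by unfold zonal; fun_prop
  | j + 2 => by
    have h1 := contDiff_zonal k n (j + 1)
    have h0 := contDiff_zonal k n j
    have h2 : ContDiff ℝ n fun x : EuclideanSpace ℝ (Fin N) => ‖x‖ ^ 2 := contDiff_norm_sq ℝ
    unfold zonal; fun_prop

theorem zonal_smul (k : Fin N) (r : ℝ) (x : EuclideanSpace ℝ (Fin N)) :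
    ∀ j, zonal k j (r • x) = r ^ j * zonal k j x
  | 0 => by simp [zonal]
  | 1 => by simp [zonal]
  | j + 2 => by
    simp only [zonal, zonal_smul k r x (j + 1), zonal_smul k r x j, norm_smul, mul_pow,
      PiLp.smul_apply, smul_eq_mul, Real.norm_eq_abs, sq_abs]
    ring

/-- Euler's identity: differentiate the homogeneity relation `zonal_smul` at r = 1. -/
theorem fderiv_zonal_self (k : Fin N) (j : ℕ) (x : EuclideanSpace ℝ (Fin N)) :
    fderiv ℝ (zonal k j) x x = j * zonal k j x := by
  have h1 : HasDerivAt (fun r : ℝ => zonal k j (r • x)) (fderiv ℝ (zonal k j) x x) 1 := by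
    have h0 : HasDerivAt (fun s : ℝ => s • x) x 1 := by
      simpa using (hasDerivAt_id (1 : ℝ)).smul_const x
    have := ((contDiff_zonal k 1 j).differentiable one_ne_zero ((1 : ℝ) • x)).hasFDerivAt
    rw [one_smul] at this
    exact HasFDerivAt.comp_hasDerivAt (f := fun s : ℝ => s • x) 1 (by simpa using this) h0
  have h2 : HasDerivAt (fun r : ℝ => zonal k j (r • x)) (j * zonal k j x) 1 := by
    simp only [zonal_smul]
    simpa using (hasDerivAt_pow j (1 : ℝ)).mul_const (zonal k j x)
  exact h1.unique h2

theorem zonal_denominator_ne_zero (hN : 2 ≤ N) (j : ℕ) : ((j : ℝ) + 2) * (j + N - 1) ≠ 0 := by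
  have : (2 : ℝ) ≤ N := by exact_mod_cast hN
  have hj : (0 : ℝ) ≤ j := j.cast_nonneg
  exact (mul_pos (by linarith) (by linarith)).ne'

theorem zonal_recurrence (hN : 2 ≤ N) (k : Fin N) (j : ℕ) (x : EuclideanSpace ℝ (Fin N)) :
    ((j : ℝ) + 2) * (j + N - 1) * zonal k (j + 2) x =
      (2 * j + N) * (x k * zonal k (j + 1) x) - ‖x‖ ^ 2 * zonal k j x := by
  rw [zonal, mul_inv_cancel_left₀ (zonal_denominator_ne_zero hN j)]

theorem partialDeriv_zonal_zero (k : Fin N) : partialDeriv k (zonal k 0) = 0 :=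
  partialDeriv_const 1 k

theorem partialDeriv_zonal_add_two (k i : Fin N) (j : ℕ) :
    partialDeriv i (zonal k (j + 2)) = fun x => (((j : ℝ) + 2) * (j + N - 1))⁻¹ *
      ((2 * j + N) * (x k * partialDeriv i (zonal k (j + 1)) x +
        (if i = k then 1 else 0) * zonal k (j + 1) x) -
        (‖x‖ ^ 2 * partialDeriv i (zonal k j) x + 2 * x i * zonal k j x)) := by
  have hx : Differentiable ℝ fun x : EuclideanSpace ℝ (Fin N) => x k := by fun_prop
  have hq : Differentiable ℝ fun x : EuclideanSpace ℝ (Fin N) => ‖x‖ ^ 2 :=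
    (contDiff_norm_sq (n := 1) ℝ).differentiable one_ne_zero
  have hz := fun j => (contDiff_zonal k 1 j).differentiable one_ne_zero
  have hxz : Differentiable ℝ fun x : EuclideanSpace ℝ (Fin N) => x k * zonal k (j + 1) x :=
    hx.mul (hz _)
  have hqz : Differentiable ℝ fun x : EuclideanSpace ℝ (Fin N) => ‖x‖ ^ 2 * zonal k j x :=
    hq.mul (hz _)
  rw [show zonal k (j + 2) = _ from rfl, zonal, partialDeriv_const_mul,
    partialDeriv_sub (hxz.const_mul _) hqz, partialDeriv_const_mul hxz, partialDeriv_mul hx (hz _),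
    partialDeriv_mul hq (hz _), partialDeriv_coord, partialDeriv_norm_sq]
  exact (hxz.const_mul _).sub hqz

/-- This is what makes T a shift. Differentiating the recurrence and using induction leaves exactly
the recurrence one degree lower, because (j+3)(j+N) = (j+2)(j+N-1) + (2j+N+2). -/
theorem partialDeriv_zonal_succ (hN : 2 ≤ N) (k : Fin N) :
    ∀ j, partialDeriv k (zonal k (j + 1)) = zonal k j
  | 0 => by
    have := partialDeriv_coord k k
    simp only [if_true] at this
    exact this
  | 1 => by
    rw [partialDeriv_zonal_add_two, partialDeriv_zonal_succ hN k 0, partialDeriv_zonal_zero]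
    have := zonal_denominator_ne_zero hN 0
    ext x
    rw [inv_mul_eq_iff_eq_mul₀ this]
    simp [zonal]
    ring
  | j + 2 => by
    rw [partialDeriv_zonal_add_two, partialDeriv_zonal_succ hN k (j + 1),
      partialDeriv_zonal_succ hN k j]
    have h := zonal_denominator_ne_zero hN (j + 1)
    ext x
    rw [inv_mul_eq_iff_eq_mul₀ h]
    have := zonal_recurrence hN k j x
    simp only [if_true]
    push_cast
    linear_combination -this

/-- By the product rule, x_k Z_(j+1) has Laplacian 2 Z_j, and ‖x‖² Z_j has Laplacian (2N + 4j) Z_j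
by Euler's identity; the coefficients of the recurrence make the two cancel. -/
theorem lap_zonal (hN : 2 ≤ N) (k : Fin N) : ∀ j x, lap (zonal k j) x = 0
  | 0, x => lap_const 1 x
  | 1, x => lap_coord k x
  | j + 2, x => by
    have hx : ContDiff ℝ 2 fun x : EuclideanSpace ℝ (Fin N) => x k := by fun_prop
    have hq : ContDiff ℝ 2 fun x : EuclideanSpace ℝ (Fin N) => ‖x‖ ^ 2 := contDiff_norm_sq ℝ
    have hz := fun j => contDiff_zonal k 2 j
    have e1 : lap (fun x : EuclideanSpace ℝ (Fin N) => x k * zonal k (j + 1) x) x =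
        2 * zonal k j x := by
      rw [lap_mul hx (hz _), lap_zonal hN k (j + 1) x, lap_coord]
      simp [partialDeriv_coord, partialDeriv_zonal_succ hN]
    have e2 : lap (fun x : EuclideanSpace ℝ (Fin N) => ‖x‖ ^ 2 * zonal k j x) x =
        (2 * N + 4 * j) * zonal k j x := by
      rw [lap_mul hq (hz _), lap_zonal hN k j x, lap_norm_sq]
      have := fderiv_eq_sum_partialDeriv (zonal k j) x x
      rw [fderiv_zonal_self] at this
      simp only [partialDeriv_norm_sq, mul_assoc, ← Finset.mul_sum, ← this]
      ring
    rw [show zonal k (j + 2) = _ from rfl, zonal, lap_const_mul, lap_sub, lap_const_mul, e1, e2]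
    · ring
    · exact hx.mul (hz _)
    · exact contDiff_const.mul (hx.mul (hz _))
    · exact hq.mul (hz _)
    · exact (contDiff_const.mul (hx.mul (hz _))).sub (hq.mul (hz _))

theorem isHarmonicOnSpace_zonal (hN : 2 ≤ N) (k : Fin N) (j : ℕ) : IsHarmonicOnSpace (zonal k j) :=
  isHarmonicOnSpace_iff.2 ⟨contDiff_zonal k 2 j, lap_zonal hN k j⟩

/-- A crude bound suffices for convergence. The base 3 closes the induction: the recurrence then
asks for 3(2j+N) + (j+1) ≤ 9(j+N-1), true for N ≥ 2. -/
theorem abs_zonal_le (hN : 2 ≤ N) (k : Fin N) (x : EuclideanSpace ℝ (Fin N)) :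
    ∀ j : ℕ, |zonal k j x| ≤ (3 * ‖x‖) ^ j / j.factorial
  | 0 => by simp [zonal]
  | 1 => by
    simp only [zonal, pow_one, Nat.factorial_one, Nat.cast_one, div_one]
    rw [← Real.norm_eq_abs]
    have := PiLp.norm_apply_le x k
    linarith [norm_nonneg x]
  | j + 2 => by
    have hN' : (2 : ℝ) ≤ N := by exact_mod_cast hN
    have hj : (0 : ℝ) ≤ j := j.cast_nonneg
    have h1 := abs_zonal_le hN k x (j + 1)
    have h0 := abs_zonal_le hN k x j
    have hxk : |x k| ≤ ‖x‖ := PiLp.norm_apply_le x k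
    have hr := norm_nonneg x
    have hpos : 0 < ((j : ℝ) + 2) * (j + N - 1) := mul_pos (by linarith) (by linarith)
    have hf : (0 : ℝ) < j.factorial := by positivity
    rw [zonal, abs_mul, abs_inv, abs_of_pos hpos, inv_mul_le_iff₀ hpos]
    have hA : |x k * zonal k (j + 1) x| ≤ ‖x‖ * ((3 * ‖x‖) ^ (j + 1) / (j + 1).factorial) := by
      rw [abs_mul]; gcongr
    have hB : |‖x‖ ^ 2 * zonal k j x| ≤ ‖x‖ ^ 2 * ((3 * ‖x‖) ^ j / j.factorial) := by
      rw [abs_mul, abs_of_nonneg (by positivity)]; gcongr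
    calc |(2 * (j : ℝ) + N) * (x k * zonal k (j + 1) x) - ‖x‖ ^ 2 * zonal k j x|
        ≤ (2 * (j : ℝ) + N) * |x k * zonal k (j + 1) x| + |‖x‖ ^ 2 * zonal k j x| := by
          refine (abs_sub _ _).trans ?_
          rw [abs_mul (2 * (j : ℝ) + N), abs_of_nonneg (by linarith : (0 : ℝ) ≤ 2 * j + N)]
      _ ≤ (2 * (j : ℝ) + N) * (‖x‖ * ((3 * ‖x‖) ^ (j + 1) / (j + 1).factorial)) +
          ‖x‖ ^ 2 * ((3 * ‖x‖) ^ j / j.factorial) := by gcongr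
      _ = (3 * (2 * (j : ℝ) + N) + (j + 1)) *
          (‖x‖ ^ 2 * (3 * ‖x‖) ^ j / ((j + 1) * j.factorial)) := by
          rw [Nat.factorial_succ]; push_cast; field_simp; ring
      _ ≤ (9 * (j + N - 1)) * (‖x‖ ^ 2 * (3 * ‖x‖) ^ j / ((j + 1) * j.factorial)) := by
          gcongr ?_ * _
          nlinarith
      _ = _ := by
          rw [Nat.factorial_succ, Nat.factorial_succ]; push_cast; field_simp; ring

theorem zonal_axis (hN : 2 ≤ N) (k : Fin N) :
    ∀ j : ℕ, zonal k j (EuclideanSpace.single k 1) = 1 / j.factorial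
  | 0 => by simp [zonal]
  | 1 => by simp [zonal]
  | j + 2 => by
    have hN' : (2 : ℝ) ≤ N := by exact_mod_cast hN
    have hj : (0 : ℝ) ≤ j := j.cast_nonneg
    have h := zonal_recurrence hN k j (EuclideanSpace.single k 1)
    rw [zonal_axis hN k (j + 1), zonal_axis hN k j] at h
    refine mul_left_cancel₀ (zonal_denominator_ne_zero hN j) (h.trans ?_)
    simp only [Nat.factorial_succ]
    push_cast
    simp
    field_simp
    ring

end Zonal

/-! ### Zonal coefficients of harmonic functions -/

section Coefficients

variable {N : ℕ}

theorem nontrivial_euclideanSpace (hN : 2 ≤ N) : Nontrivial (EuclideanSpace ℝ (Fin N)) :=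
  Module.nontrivial_of_finrank_pos (R := ℝ) (by simp; omega)

/-- The pairing of `h` with the zonal harmonic of degree `j` on the unit sphere. -/
noncomputable def zonalCoeff (k : Fin N) (j : ℕ) (h : EuclideanSpace ℝ (Fin N) → ℝ) : ℝ :=
  ∫ y : Metric.sphere (0 : EuclideanSpace ℝ (Fin N)) 1,
    h y * zonal k j y ∂(volume : Measure (EuclideanSpace ℝ (Fin N))).toSphere

/-- Green's identity on spheres, for two harmonic functions. -/
theorem integral_sphere_green (hN : 2 ≤ N) {f g : EuclideanSpace ℝ (Fin N) → ℝ}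
    (hf : ContDiff ℝ 2 f) (hf0 : ∀ x, lap f x = 0) (hg : ContDiff ℝ 2 g) (hg0 : ∀ x, lap g x = 0)
    {r : ℝ} (hr : 0 < r) :
    ∫ y : Metric.sphere (0 : EuclideanSpace ℝ (Fin N)) 1,
      (g (r • (y : EuclideanSpace ℝ (Fin N))) * fderiv ℝ f (r • (y : EuclideanSpace ℝ (Fin N))) y -
        f (r • (y : EuclideanSpace ℝ (Fin N))) * fderiv ℝ g (r • (y : EuclideanSpace ℝ (Fin N))) y)
        ∂(volume : Measure (EuclideanSpace ℝ (Fin N))).toSphere = 0 := by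
  have := nontrivial_euclideanSpace hN
  set σ := (volume : Measure (EuclideanSpace ℝ (Fin N))).toSphere
  have hdim : Module.finrank ℝ (EuclideanSpace ℝ (Fin N)) - 1 ≠ 0 := by simp; omega
  set d := Module.finrank ℝ (EuclideanSpace ℝ (Fin N)) - 1
  have hf1 := hf.differentiable two_ne_zero
  have hg1 := hg.differentiable two_ne_zero
  have hfp := fun i => contDiff_partialDeriv (n := 2) (m := 1) hf (by norm_num) i
  have hgp := fun i => contDiff_partialDeriv (n := 2) (m := 1) hg (by norm_num) i
  -- The field g∇f - f∇g is divergence free, so its flux through the sphere of radius r does not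
  -- depend on r > 0.
  set G : Fin N → EuclideanSpace ℝ (Fin N) → ℝ := fun i x =>
    g x * partialDeriv i f x - f x * partialDeriv i g x
  have hG : ∀ i, ContDiff ℝ 1 (G i) := fun i =>
    ((hg.of_le (by norm_num)).mul (hfp i)).sub ((hf.of_le (by norm_num)).mul (hgp i))
  set Φ : ℝ → ℝ := fun r => ∫ y : Metric.sphere (0 : EuclideanSpace ℝ (Fin N)) 1,
      (g (r • (y : EuclideanSpace ℝ (Fin N))) * fderiv ℝ f (r • (y : EuclideanSpace ℝ (Fin N))) y -
        f (r • (y : EuclideanSpace ℝ (Fin N))) * fderiv ℝ g (r • (y : EuclideanSpace ℝ (Fin N))) y) ∂σ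
  have hfd : Continuous (fderiv ℝ f) := hf.continuous_fderiv two_ne_zero
  have hgd : Continuous (fderiv ℝ g) := hg.continuous_fderiv two_ne_zero
  have hfc := hf.continuous
  have hgc := hg.continuous
  have hΦc : Continuous Φ := continuous_integral_sphere (by
    simp only [Function.uncurry_def]; fun_prop)
  have hΦ : ∀ r, Φ r = ∑ i, ∫ y : Metric.sphere (0 : EuclideanSpace ℝ (Fin N)) 1,
      G i (r • (y : EuclideanSpace ℝ (Fin N))) *
        inner ℝ (y : EuclideanSpace ℝ (Fin N)) (EuclideanSpace.single i 1) ∂σ := by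
    intro r
    rw [← integral_finsetSum]
    · refine integral_congr_ae (.of_forall fun y => ?_)
      simp only [fderiv_eq_sum_partialDeriv f, fderiv_eq_sum_partialDeriv g, Finset.mul_sum,
        ← Finset.sum_sub_distrib, G]
      refine Finset.sum_congr rfl fun i _ => ?_
      simp [EuclideanSpace.inner_single_right]
      ring
    · intro i _
      have := (hG i).continuous
      exact integrable_sphere (by fun_prop)
  have hdiv : ∀ x, ∑ i, fderiv ℝ (G i) x (EuclideanSpace.single i 1) = 0 := by
    intro x
    have : ∀ i, fderiv ℝ (G i) x (EuclideanSpace.single i 1) =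
        g x * partialDeriv i (partialDeriv i f) x - f x * partialDeriv i (partialDeriv i g) x := by
      intro i
      change partialDeriv i (G i) x = _
      have h1 : Differentiable ℝ fun x => g x * partialDeriv i f x :=
        hg1.mul ((hfp i).differentiable one_ne_zero)
      have h2 : Differentiable ℝ fun x => f x * partialDeriv i g x :=
        hf1.mul ((hgp i).differentiable one_ne_zero)
      rw [partialDeriv_sub h1 h2, partialDeriv_mul hg1 ((hfp i).differentiable one_ne_zero),
        partialDeriv_mul hf1 ((hgp i).differentiable one_ne_zero)]
      ring
    simp only [this, Finset.sum_sub_distrib, ← Finset.mul_sum]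
    have h1 := hf0 x
    have h2 := hg0 x
    simp only [lap] at h1 h2
    rw [h1, h2]
    ring
  have hder : ∀ r ∈ Set.Ioi (0 : ℝ), HasDerivAt (fun r => r ^ d * Φ r) 0 r := by
    intro r hr
    have h1 := HasDerivAt.fun_sum (u := Finset.univ) fun i _ =>
      hasDerivAt_sphere_flux (hG i) (EuclideanSpace.single i 1) hr
    have h2 : (fun r : ℝ => r ^ d * Φ r) = fun r => ∑ i, r ^ d *
        ∫ y : Metric.sphere (0 : EuclideanSpace ℝ (Fin N)) 1,
          G i (r • (y : EuclideanSpace ℝ (Fin N))) *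
          inner ℝ (y : EuclideanSpace ℝ (Fin N)) (EuclideanSpace.single i 1) ∂σ := by
      ext r
      rw [hΦ, Finset.mul_sum]
    rw [h2]
    refine h1.congr_deriv ?_
    rw [← Finset.mul_sum, ← integral_finsetSum]
    · simp [hdiv]
    · intro i _
      have := (hG i).continuous_fderiv one_ne_zero
      exact integrable_sphere (by fun_prop)
  obtain ⟨c, hc⟩ := isOpen_Ioi.exists_is_const_of_deriv_eq_zero isPreconnected_Ioi
    (fun r hr => (hder r hr).differentiableAt.differentiableWithinAt) fun r hr => (hder r hr).deriv
  -- The constant flux is zero: Φ is continuous at 0 and the factor r^d vanishes there, since d = N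
  -- - 1 ≥ 1.
  have hlim : Tendsto (fun r : ℝ => r ^ d * Φ r) (𝓝[>] 0) (𝓝 (0 ^ d * Φ 0)) :=
    (Continuous.tendsto (by fun_prop) 0).mono_left nhdsWithin_le_nhds
  have hlim2 : Tendsto (fun r : ℝ => r ^ d * Φ r) (𝓝[>] 0) (𝓝 c) :=
    tendsto_const_nhds.congr' (by
      filter_upwards [self_mem_nhdsWithin] with r hr using (hc r hr).symm)
  have h0 : c = 0 := by
    have := tendsto_nhds_unique hlim2 hlim
    simpa [zero_pow hdim] using this
  have := hc r hr
  rw [h0] at this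
  exact (mul_eq_zero.1 this).resolve_left (pow_pos hr d).ne'

/-- The zonal coefficient of degree `j` of a harmonic function on the sphere of radius `r` is
proportional to `r ^ j`. -/
theorem integral_sphere_mul_zonal (hN : 2 ≤ N) (k : Fin N) (j : ℕ)
    {h : EuclideanSpace ℝ (Fin N) → ℝ} (hh : IsHarmonicOnSpace h) {r : ℝ} (hr : 0 < r) :
    ∫ y : Metric.sphere (0 : EuclideanSpace ℝ (Fin N)) 1,
      h (r • (y : EuclideanSpace ℝ (Fin N))) * zonal k j y
        ∂(volume : Measure (EuclideanSpace ℝ (Fin N))).toSphere = r ^ j * zonalCoeff k j h := by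
  obtain ⟨hc, hl⟩ := isHarmonicOnSpace_iff.1 hh
  set σ := (volume : Measure (EuclideanSpace ℝ (Fin N))).toSphere
  have hzc := (contDiff_zonal k 1 j).continuous
  have hhc := hc.continuous
  have hhd : Continuous (fderiv ℝ h) := hc.continuous_fderiv two_ne_zero
  set C : ℝ → ℝ := fun r => ∫ y : Metric.sphere (0 : EuclideanSpace ℝ (Fin N)) 1,
      h (r • (y : EuclideanSpace ℝ (Fin N))) * zonal k j y ∂σ
  set C' : ℝ → ℝ := fun r => ∫ y : Metric.sphere (0 : EuclideanSpace ℝ (Fin N)) 1,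
      fderiv ℝ h (r • (y : EuclideanSpace ℝ (Fin N))) y * zonal k j y ∂σ
  have hC : ∀ r, HasDerivAt C (C' r) r := by
    refine hasDerivAt_integral_of_compactSpace (fun r => by fun_prop) ?_ fun r y => ?_
    · simp only [Function.uncurry_def]; fun_prop
    · refine HasDerivAt.mul_const ?_ _
      have h1 : HasDerivAt (fun s : ℝ => s • (y : EuclideanSpace ℝ (Fin N)))
          (y : EuclideanSpace ℝ (Fin N)) r := by
        simpa using (hasDerivAt_id r).smul_const (y : EuclideanSpace ℝ (Fin N))
      exact ((hc.differentiable two_ne_zero _).hasFDerivAt).comp_hasDerivAt r h1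
  -- Green's identity against Z_j, with Euler's identity for the radial derivative of Z_j; the
  -- equation makes C(r) / r^j constant.
  have hode : ∀ r : ℝ, 0 < r → r * C' r = j * C r := by
    intro r hr
    have green := integral_sphere_green hN hc hl (contDiff_zonal k 2 j) (lap_zonal hN k j) hr
    have hint : ∀ y : Metric.sphere (0 : EuclideanSpace ℝ (Fin N)) 1,
        r * (zonal k j (r • (y : EuclideanSpace ℝ (Fin N))) *
          fderiv ℝ h (r • (y : EuclideanSpace ℝ (Fin N))) y -
        h (r • (y : EuclideanSpace ℝ (Fin N))) *
          fderiv ℝ (zonal k j) (r • (y : EuclideanSpace ℝ (Fin N))) y) =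
        r ^ j * (r * (fderiv ℝ h (r • (y : EuclideanSpace ℝ (Fin N))) y * zonal k j y) -
          j * (h (r • (y : EuclideanSpace ℝ (Fin N))) * zonal k j y)) := by
      intro y
      have e := fderiv_zonal_self k j (r • (y : EuclideanSpace ℝ (Fin N)))
      rw [map_smul, smul_eq_mul, zonal_smul] at e
      rw [mul_sub, mul_left_comm r (h _), e, zonal_smul]
      ring
    have green2 := congrArg (fun t => r * t) green
    simp only [← integral_const_mul, hint, mul_zero] at green2
    rw [integral_const_mul, integral_sub, integral_const_mul, integral_const_mul] at green2
    · have := (mul_eq_zero.1 green2).resolve_left (pow_pos hr j).ne'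
      linarith
    · exact integrable_sphere (by fun_prop)
    · exact integrable_sphere (by fun_prop)
  have hder : ∀ r ∈ Set.Ioi (0 : ℝ), HasDerivAt (fun r => C r / r ^ j) 0 r := by
    intro r hr
    have hr' : (0 : ℝ) < r := hr
    refine ((hC r).div (hasDerivAt_pow j r) (pow_pos hr' j).ne').congr_deriv ?_
    have h1 := hode r hr'
    have h2 : r * (j * r ^ (j - 1)) = j * r ^ j := by
      rcases j with _ | j
      · simp
      · simp [pow_succ]; ring
    rw [div_eq_zero_iff]
    left
    refine (mul_eq_zero.1 (?_ : r * _ = 0)).resolve_left hr'.ne'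
    linear_combination r ^ j * h1 - C r * h2
  obtain ⟨c, hcc⟩ := isOpen_Ioi.exists_is_const_of_deriv_eq_zero isPreconnected_Ioi
    (fun r hr => (hder r hr).differentiableAt.differentiableWithinAt) fun r hr => (hder r hr).deriv
  have h1 := hcc 1 (Set.mem_Ioi.2 one_pos)
  have h2 := hcc r hr
  rw [← h1] at h2
  rw [div_eq_iff (pow_pos hr j).ne'] at h2
  change C r = _
  rw [h2]
  simp [C, zonalCoeff, mul_comm, σ]

/-- At radius 2 the pairing scales by 2^i from homogeneity and by 2^j from
`integral_sphere_mul_zonal`, so it vanishes. -/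
theorem zonalCoeff_zonal_of_ne (hN : 2 ≤ N) (k : Fin N) {i j : ℕ} (hij : i ≠ j) :
    zonalCoeff k j (zonal k i) = 0 := by
  have h := integral_sphere_mul_zonal hN k j (isHarmonicOnSpace_zonal hN k i) two_pos
  simp only [zonal_smul, mul_assoc, integral_const_mul] at h
  change 2 ^ i * zonalCoeff k j (zonal k i) = _ at h
  by_contra h0
  have := mul_right_cancel₀ h0 h
  exact hij (Nat.pow_right_injective le_rfl (by exact_mod_cast this))

/-- The mean value property. -/
theorem integral_sphere_of_isHarmonicOnSpace (hN : 2 ≤ N) {h : EuclideanSpace ℝ (Fin N) → ℝ}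
    (hh : IsHarmonicOnSpace h) {r : ℝ} (hr : 0 < r) :
    ∫ y : Metric.sphere (0 : EuclideanSpace ℝ (Fin N)) 1, h (r • (y : EuclideanSpace ℝ (Fin N)))
        ∂(volume : Measure (EuclideanSpace ℝ (Fin N))).toSphere =
      (volume : Measure (EuclideanSpace ℝ (Fin N))).toSphere.real Set.univ * h 0 := by
  have hhc := (isHarmonicOnSpace_iff.1 hh).1.continuous
  have key : ∀ r : ℝ, 0 < r → ∫ y : Metric.sphere (0 : EuclideanSpace ℝ (Fin N)) 1,
      h (r • (y : EuclideanSpace ℝ (Fin N)))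
        ∂(volume : Measure (EuclideanSpace ℝ (Fin N))).toSphere =
      zonalCoeff ⟨0, by omega⟩ 0 h := by
    intro r hr
    have := integral_sphere_mul_zonal hN ⟨0, by omega⟩ 0 hh hr
    simpa [zonal] using this
  have hcont : Continuous fun r : ℝ => ∫ y : Metric.sphere (0 : EuclideanSpace ℝ (Fin N)) 1,
      h (r • (y : EuclideanSpace ℝ (Fin N)))
        ∂(volume : Measure (EuclideanSpace ℝ (Fin N))).toSphere :=
    continuous_integral_sphere (by simp only [Function.uncurry_def]; fun_prop)
  -- Since Z_0 = 1, the spherical integral is independent of the radius; letting the radius tend to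
  -- 0 produces the value at the centre.
  have h1 := (hcont.tendsto 0).mono_left (nhdsWithin_le_nhds (s := Set.Ioi 0))
  have h2 : Tendsto (fun r : ℝ => ∫ y : Metric.sphere (0 : EuclideanSpace ℝ (Fin N)) 1,
      h (r • (y : EuclideanSpace ℝ (Fin N)))
        ∂(volume : Measure (EuclideanSpace ℝ (Fin N))).toSphere) (𝓝[>] 0)
      (𝓝 (zonalCoeff ⟨0, by omega⟩ 0 h)) :=
    tendsto_const_nhds.congr' (by
      filter_upwards [self_mem_nhdsWithin] with r hr using (key r hr).symm)
  rw [key r hr, tendsto_nhds_unique h2 h1]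
  simp

/-- The radial divergence theorem at r = 1 for the field h e_k, whose flux is r^N times the first
coefficient. -/
theorem zonalCoeff_one (hN : 2 ≤ N) (k : Fin N) {h : EuclideanSpace ℝ (Fin N) → ℝ}
    (hh : IsHarmonicOnSpace h) :
    N * zonalCoeff k 1 h = zonalCoeff k 0 (partialDeriv k h) := by
  have := nontrivial_euclideanSpace hN
  have hc := (isHarmonicOnSpace_iff.1 hh).1
  have h1 := hasDerivAt_sphere_flux (hc.of_le (by norm_num) : ContDiff ℝ 1 h)
    (EuclideanSpace.single k 1) one_pos
  have h2 : HasDerivAt (fun r : ℝ => r ^ N * zonalCoeff k 1 h) (N * zonalCoeff k 1 h) 1 := by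
    simpa using (hasDerivAt_pow N (1 : ℝ)).mul_const (zonalCoeff k 1 h)
  have h3 := h1.unique (h2.congr_of_eventuallyEq ?_)
  · rw [← h3]
    simp [zonalCoeff, zonal, partialDeriv]
  · filter_upwards [lt_mem_nhds (one_pos (α := ℝ))] with r hr
    have := integral_sphere_mul_zonal hN k 1 hh hr
    simp only [zonal] at this
    simp only [finrank_euclideanSpace, Fintype.card_fin, EuclideanSpace.inner_single_right]
    simp only [one_mul, conj_trivial, this]
    rw [← mul_assoc, ← pow_add, Nat.sub_add_cancel (by omega)]

/-- The radial divergence theorem at r = 1 for h Z_(j+1) e_k. The recurrence splits y_k Z_(j+1) into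
Z_(j+2) and Z_j, so the flux is a combination of r^(N+2j+2) and r^(N+2j). The contribution of Z_j
cancels against the term h ∂_k Z_(j+1) = h Z_j of the divergence. -/
theorem zonalCoeff_add_two (hN : 2 ≤ N) (k : Fin N) (j : ℕ) {h : EuclideanSpace ℝ (Fin N) → ℝ}
    (hh : IsHarmonicOnSpace h) :
    (j + 2) * (j + N - 1) * (2 * j + N + 2) * zonalCoeff k (j + 2) h =
      (2 * j + N) * zonalCoeff k (j + 1) (partialDeriv k h) := by
  have := nontrivial_euclideanSpace hN
  have hc := (isHarmonicOnSpace_iff.1 hh).1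
  have hhc := hc.continuous
  have hzc := fun j => (contDiff_zonal k 1 j).continuous
  have hpc : Continuous (partialDeriv k h) :=
    (contDiff_partialDeriv (n := 2) (m := 1) hc (by norm_num) k).continuous
  have hN' : (2 : ℝ) ≤ N := by exact_mod_cast hN
  have hj : (0 : ℝ) ≤ j := j.cast_nonneg
  have hg : ContDiff ℝ 1 fun x => h x * zonal k (j + 1) x :=
    (hc.of_le (by norm_num)).mul (contDiff_zonal k 1 _)
  have h1 := hasDerivAt_sphere_flux hg (EuclideanSpace.single k 1) one_pos
  set a := (j + 2) * (j + N - 1) * zonalCoeff k (j + 2) h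
  set b := zonalCoeff k j h
  have h2 : HasDerivAt (fun r : ℝ => (2 * (j : ℝ) + N)⁻¹ *
      (r ^ (N + 2 * j + 2) * a + r ^ (N + 2 * j) * b))
      ((2 * (j : ℝ) + N)⁻¹ * ((N + 2 * j + 2) * a + (N + 2 * j) * b)) 1 := by
    simpa using (((hasDerivAt_pow (N + 2 * j + 2) (1 : ℝ)).mul_const a).add
      ((hasDerivAt_pow (N + 2 * j) (1 : ℝ)).mul_const b)).const_mul (2 * (j : ℝ) + N)⁻¹
  have h3 := h1.unique (h2.congr_of_eventuallyEq ?_)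
  · have h4 : ∫ y : Metric.sphere (0 : EuclideanSpace ℝ (Fin N)) 1,
        fderiv ℝ (fun x => h x * zonal k (j + 1) x) ((1 : ℝ) • (y : EuclideanSpace ℝ (Fin N)))
          (EuclideanSpace.single k 1) ∂(volume : Measure (EuclideanSpace ℝ (Fin N))).toSphere =
        b + zonalCoeff k (j + 1) (partialDeriv k h) := by
      have : ∀ x, fderiv ℝ (fun x => h x * zonal k (j + 1) x) x (EuclideanSpace.single k 1) =
          h x * zonal k j x + partialDeriv k h x * zonal k (j + 1) x := by
        intro x
        have := congrFun (partialDeriv_mul (hc.differentiable two_ne_zero)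
          ((contDiff_zonal k 1 (j + 1)).differentiable one_ne_zero) k) x
        rwa [partialDeriv_zonal_succ hN] at this
      simp only [this, one_smul]
      rw [integral_add]
      · rfl
      · exact integrable_sphere (by fun_prop)
      · exact integrable_sphere (by fun_prop)
    rw [h4, one_pow, one_mul, eq_inv_mul_iff_mul_eq₀ (by positivity)] at h3
    simp only [a] at h3
    linear_combination -h3
  · filter_upwards [lt_mem_nhds (one_pos (α := ℝ))] with r hr
    have e2 := integral_sphere_mul_zonal hN k (j + 2) hh hr
    have e0 := integral_sphere_mul_zonal hN k j hh hr
    have hrec : ∀ y : Metric.sphere (0 : EuclideanSpace ℝ (Fin N)) 1,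
        h (r • (y : EuclideanSpace ℝ (Fin N))) * zonal k (j + 1) (r • (y : EuclideanSpace ℝ (Fin N)))
          * inner ℝ (y : EuclideanSpace ℝ (Fin N)) (EuclideanSpace.single k 1) =
        r ^ (j + 1) * (2 * (j : ℝ) + N)⁻¹ * ((j + 2) * (j + N - 1) *
          (h (r • (y : EuclideanSpace ℝ (Fin N))) * zonal k (j + 2) y) +
          h (r • (y : EuclideanSpace ℝ (Fin N))) * zonal k j y) := by
      intro y
      have e := zonal_recurrence hN k j y
      have hy : ‖(y : EuclideanSpace ℝ (Fin N))‖ = 1 := by simp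
      rw [hy] at e
      rw [zonal_smul, EuclideanSpace.inner_single_right]
      simp only [conj_trivial, one_mul]
      have : (2 * (j : ℝ) + N) ≠ 0 := by positivity
      field_simp
      linear_combination -h (r • (y : EuclideanSpace ℝ (Fin N))) * e
    simp only [hrec, finrank_euclideanSpace, Fintype.card_fin]
    rw [integral_const_mul, integral_add, integral_const_mul, e2, e0]
    · have : r ^ N = r ^ (N - 1) * r := by rw [← pow_succ, Nat.sub_add_cancel (by omega)]
      simp only [a, b, pow_add, this, pow_mul]
      ring
    · exact integrable_sphere (by fun_prop)
    · exact integrable_sphere (by fun_prop)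

end Coefficients

/-! ### Reproduction by a mollifier -/

section Regularity

variable {N : ℕ}

theorem isHarmonicOnSpace_translate {h : EuclideanSpace ℝ (Fin N) → ℝ} (hh : IsHarmonicOnSpace h)
    (x : EuclideanSpace ℝ (Fin N)) : IsHarmonicOnSpace fun y => h (x + y) := by
  rw [isHarmonicOnSpace_iff] at hh ⊢
  have key : ∀ (f : EuclideanSpace ℝ (Fin N) → ℝ) (i : Fin N),
      partialDeriv i (fun y => f (x + y)) = fun y => partialDeriv i f (x + y) := by
    intro f i
    ext y
    simp only [partialDeriv]
    rw [fderiv_comp_add_left]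
  refine ⟨hh.1.comp (by fun_prop), fun y => ?_⟩
  simp only [lap, key]
  exact hh.2 (x + y)

/-- A smooth kernel of total mass one which is supported in the closed unit ball. -/
structure IsMollifier (φ : EuclideanSpace ℝ (Fin N) → ℝ) : Prop where
  contDiff : ContDiff ℝ (⊤ : ℕ∞) φ
  nonneg : ∀ x, 0 ≤ φ x
  eq_zero : ∀ x, 1 < ‖x‖ → φ x = 0
  integral_eq_one : ∫ x, φ x = 1

/-- The function `f` agrees with its convolution with `φ`. -/
def Reproduces (φ f : EuclideanSpace ℝ (Fin N) → ℝ) : Prop :=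
  ∀ x, ∫ t, f t * φ (x - t) = f x

/-- The mean value property, integrated over radii against a radial bump. One kernel serves all
harmonic functions, which makes the later smoothness, gradient and limit statements facts about
convolution. -/
theorem exists_reproducing_mollifier (hN : 2 ≤ N) :
    ∃ φ : EuclideanSpace ℝ (Fin N) → ℝ, IsMollifier φ ∧
      ∀ h, IsHarmonicOnSpace h → Reproduces φ h := by
  have := nontrivial_euclideanSpace hN
  let θ : ContDiffBump (0 : ℝ) := ⟨1 / 2, 1, by norm_num, by norm_num⟩
  set ψ : EuclideanSpace ℝ (Fin N) → ℝ := fun x => θ (‖x‖ ^ 2)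
  have hψ : ContDiff ℝ (⊤ : ℕ∞) ψ := θ.contDiff.comp (contDiff_norm_sq ℝ)
  have hψ0 : ∀ x, 0 ≤ ψ x := fun x => θ.nonneg
  have hψ1 : ∀ x, 1 < ‖x‖ → ψ x = 0 := by
    intro x hx
    refine θ.zero_of_le_dist ?_
    simp only [dist_zero_right, norm_pow, norm_norm, θ]
    nlinarith
  have hψc : HasCompactSupport ψ :=
    HasCompactSupport.intro (isCompact_closedBall 0 1) fun x hx => hψ1 x (by simpa using hx)
  have hψi : Integrable ψ := hψ.continuous.integrable_of_hasCompactSupport hψc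
  have hpos : 0 < ∫ x, ψ x := by
    refine hψ.continuous.integral_pos_of_hasCompactSupport_nonneg_nonzero hψc hψ0 (x := 0) ?_
    have : ψ 0 = 1 := θ.one_of_mem_closedBall (by simp [θ])
    rw [this]; exact one_ne_zero
  have hmv : ∀ h, IsHarmonicOnSpace h → ∫ y, h y * ψ y = h 0 * ∫ y, ψ y := by
    intro h hh
    have hhc := (isHarmonicOnSpace_iff.1 hh).1.continuous
    have hi : Integrable fun y => h y * ψ y :=
      (hhc.mul hψ.continuous).integrable_of_hasCompactSupport hψc.mul_left
    rw [integral_polar hi, integral_polar hψi, ← integral_const_mul]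
    refine setIntegral_congr_fun measurableSet_Ioi fun r hr => ?_
    have hr' : (0 : ℝ) < r := hr
    have nrm : ∀ y : Metric.sphere (0 : EuclideanSpace ℝ (Fin N)) 1,
        ψ (r • (y : EuclideanSpace ℝ (Fin N))) = θ (r ^ 2) := by
      intro y
      simp [ψ, norm_smul]
    simp only [nrm, integral_mul_const, integral_sphere_of_isHarmonicOnSpace hN hh hr',
      integral_const, smul_eq_mul]
    ring
  refine ⟨fun x => (∫ y, ψ y)⁻¹ * ψ x, ⟨contDiff_const.mul hψ,
    fun x => mul_nonneg (inv_nonneg.2 hpos.le) (hψ0 x), fun x hx => by rw [hψ1 x hx, mul_zero], ?_⟩,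
    fun h hh x => ?_⟩
  · rw [integral_const_mul, inv_mul_cancel₀ hpos.ne']
  · rw [← integral_add_left_eq_self (μ := volume)
      (fun t => h t * ((∫ y, ψ y)⁻¹ * ψ (x - t))) x]
    have e : ∀ y, h (x + y) * ((∫ y, ψ y)⁻¹ * ψ (x - (x + y))) =
        (∫ y, ψ y)⁻¹ * (h (x + y) * ψ y) := by
      intro y
      have : ψ (x - (x + y)) = ψ y := by simp [ψ]
      rw [this]; ring
    simp only [e, integral_const_mul]
    rw [hmv _ (isHarmonicOnSpace_translate hh x), add_zero]
    field_simp

variable {φ f : EuclideanSpace ℝ (Fin N) → ℝ}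

theorem IsMollifier.hasCompactSupport (hφ : IsMollifier φ) : HasCompactSupport φ :=
  HasCompactSupport.intro (isCompact_closedBall 0 1) fun x hx => hφ.eq_zero x (by simpa using hx)

theorem Reproduces.eq_convolution (hf : Reproduces φ f) :
    f = convolution f φ (ContinuousLinearMap.mul ℝ ℝ) volume := by
  ext x
  rw [convolution_def]
  exact (hf x).symm

theorem Reproduces.contDiff (hφ : IsMollifier φ) (hc : Continuous f) (hf : Reproduces φ f) :
    ContDiff ℝ (⊤ : ℕ∞) f := by
  rw [hf.eq_convolution]
  exact hφ.hasCompactSupport.contDiff_convolution_right _ hc.locallyIntegrable hφ.contDiff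

theorem Reproduces.partialDeriv (hφ : IsMollifier φ) (hc : Continuous f) (hf : Reproduces φ f)
    (i : Fin N) (x : EuclideanSpace ℝ (Fin N)) :
    partialDeriv i f x = ∫ t, f t * partialDeriv i φ (x - t) := by
  have h := hφ.hasCompactSupport.hasFDerivAt_convolution_right (ContinuousLinearMap.mul ℝ ℝ)
    hc.locallyIntegrable (hφ.contDiff.of_le (by simp)) x (μ := volume)
  rw [← hf.eq_convolution] at h
  rw [_root_.partialDeriv, h.fderiv, convolution_def, ContinuousLinearMap.integral_apply]
  · rfl
  · have := (hφ.hasCompactSupport.fderiv ℝ).convolutionExists_right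
      ((ContinuousLinearMap.mul ℝ ℝ).precompR (EuclideanSpace ℝ (Fin N))) hc.locallyIntegrable
      (hφ.contDiff.continuous_fderiv (by simp)) (μ := volume)
    exact this x

theorem IsMollifier.partialDeriv_eq_zero (hφ : IsMollifier φ) (i : Fin N)
    (x : EuclideanSpace ℝ (Fin N)) (hx : 1 < ‖x‖) : partialDeriv i φ x = 0 := by
  have : φ =ᶠ[𝓝 x] fun _ => 0 := by
    filter_upwards [(isOpen_lt continuous_const continuous_norm).mem_nhds hx] with y hy
      using hφ.eq_zero y hy
  rw [partialDeriv, this.fderiv_eq]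
  simp

/-- A gradient estimate. -/
theorem Reproduces.exists_abs_partialDeriv_le (hφ : IsMollifier φ) (i : Fin N) :
    ∃ C : ℝ, 0 < C ∧ ∀ f, Continuous f → Reproduces φ f → ∀ x M,
      (∀ t ∈ Metric.closedBall x 1, |f t| ≤ M) → |_root_.partialDeriv i f x| ≤ C * M := by
  set p := _root_.partialDeriv i φ
  have hp : Continuous p :=
    (contDiff_partialDeriv (n := ⊤) (m := 0) hφ.contDiff (by simp) i).continuous
  have hpc : HasCompactSupport p := HasCompactSupport.intro (isCompact_closedBall 0 1) fun x hx =>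
    hφ.partialDeriv_eq_zero i x (by simpa using hx)
  have hi : Integrable p := hp.integrable_of_hasCompactSupport hpc
  have hnn : 0 ≤ ∫ t, |p t| := integral_nonneg fun t => abs_nonneg _
  refine ⟨(∫ t, |p t|) + 1, by linarith, fun f hc hf x M hM => ?_⟩
  have hM0 : 0 ≤ M := (abs_nonneg _).trans (hM x (by simp))
  rw [hf.partialDeriv hφ hc]
  have hi2 : Integrable fun t => |p (x - t)| * M := (hi.abs.comp_sub_left x).mul_const M
  calc |∫ t, f t * p (x - t)| ≤ ∫ t, |f t * p (x - t)| := abs_integral_le_integral_abs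
    _ ≤ ∫ t, |p (x - t)| * M := by
        refine integral_mono_of_nonneg (.of_forall fun t => abs_nonneg _) hi2
          (.of_forall fun t => ?_)
        simp only [abs_mul]
        by_cases ht : t ∈ Metric.closedBall x 1
        · rw [mul_comm]
          exact mul_le_mul_of_nonneg_left (hM t ht) (abs_nonneg _)
        · have : p (x - t) = 0 := hφ.partialDeriv_eq_zero i _ (by
            rw [Metric.mem_closedBall, dist_comm, dist_eq_norm] at ht; linarith)
          simp [this]
    _ = (∫ t, |p t|) * M := by
        rw [integral_mul_const, integral_sub_left_eq_self (fun t => |p t|)]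
    _ ≤ _ := by nlinarith

theorem Reproduces.integrable (hφ : IsMollifier φ) {g : EuclideanSpace ℝ (Fin N) → ℝ}
    (hg : Continuous g) (x : EuclideanSpace ℝ (Fin N)) : Integrable fun t => g t * φ (x - t) := by
  have h1 : Continuous fun t => g t * φ (x - t) := hg.mul (hφ.contDiff.continuous.comp (by fun_prop))
  refine h1.integrable_of_hasCompactSupport
    (HasCompactSupport.intro (isCompact_closedBall x 1) fun t ht => ?_)
  rw [Metric.mem_closedBall, dist_comm, dist_eq_norm] at ht
  rw [hφ.eq_zero _ (by linarith), mul_zero]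

theorem IsMollifier.integral_sub (hφ : IsMollifier φ) (x : EuclideanSpace ℝ (Fin N)) :
    ∫ t, φ (x - t) = 1 := by
  rw [integral_sub_left_eq_self (fun t => φ t), hφ.integral_eq_one]

theorem Reproduces.sub (hφ : IsMollifier φ) {g : EuclideanSpace ℝ (Fin N) → ℝ} (hfc : Continuous f)
    (hgc : Continuous g) (hf : Reproduces φ f) (hg : Reproduces φ g) :
    Reproduces φ fun x => f x - g x := by
  intro x
  simp only [sub_mul]
  rw [MeasureTheory.integral_sub (integrable hφ hfc x) (integrable hφ hgc x), hf x, hg x]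

/-- Jensen's inequality for the probability density φ(x - ·), by expanding the integral of (f(t) -
f(x))² ≥ 0. -/
theorem Reproduces.sq_le (hφ : IsMollifier φ) (hc : Continuous f) (hf : Reproduces φ f)
    (x : EuclideanSpace ℝ (Fin N)) : f x ^ 2 ≤ ∫ t, f t ^ 2 * φ (x - t) := by
  have i1 := integrable hφ hc x
  have i2 : Integrable fun t => f t ^ 2 * φ (x - t) := integrable hφ (hc.pow 2) x
  have i3 : Integrable fun t => φ (x - t) := by simpa using integrable hφ continuous_const (g := 1) x
  have h0 : 0 ≤ ∫ t, (f t - f x) ^ 2 * φ (x - t) :=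
    integral_nonneg fun t => mul_nonneg (sq_nonneg _) (hφ.nonneg _)
  have e : ∀ t, (f t - f x) ^ 2 * φ (x - t) =
      f t ^ 2 * φ (x - t) - 2 * f x * (f t * φ (x - t)) + f x ^ 2 * φ (x - t) := fun t => by ring
  simp only [e] at h0
  have i12 : Integrable fun t => f t ^ 2 * φ (x - t) - 2 * f x * (f t * φ (x - t)) :=
    i2.sub (i1.const_mul _)
  rw [integral_add i12 (i3.const_mul _), MeasureTheory.integral_sub i2
    (i1.const_mul _), integral_const_mul, integral_const_mul, hf x, hφ.integral_sub] at h0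
  nlinarith

theorem Reproduces.of_tendsto (hφ : IsMollifier φ) {s : ℕ → EuclideanSpace ℝ (Fin N) → ℝ}
    (hsc : ∀ n, Continuous (s n)) (hfc : Continuous f) (hs : ∀ n, Reproduces φ (s n))
    (hlim : ∀ R : ℝ, TendstoUniformlyOn s f atTop (Metric.closedBall 0 R)) : Reproduces φ f := by
  intro x
  have hpt : ∀ y, Tendsto (fun n => s n y) atTop (𝓝 (f y)) := fun y =>
    (hlim ‖y‖).tendsto_at (by simp)
  refine tendsto_nhds_unique ?_ (hpt x)
  simp only [fun n => (hs n x).symm]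
  rw [tendsto_iff_norm_sub_tendsto_zero]
  have hu := Metric.tendstoUniformlyOn_iff.1 (hlim (‖x‖ + 1))
  rw [Metric.tendsto_atTop]
  intro ε hε
  obtain ⟨n0, hn0⟩ := eventually_atTop.1 (hu (ε / 2) (by linarith))
  refine ⟨n0, fun n hn => ?_⟩
  rw [← MeasureTheory.integral_sub (integrable hφ (hsc n) x) (integrable hφ hfc x)]
  simp only [← sub_mul, dist_zero_right, norm_norm]
  have i3 : Integrable fun t => φ (x - t) := by simpa using integrable hφ continuous_const (g := 1) x
  have : ‖∫ t, (s n t - f t) * φ (x - t)‖ ≤ ∫ t, ε / 2 * φ (x - t) := by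
    refine norm_integral_le_of_norm_le (i3.const_mul _) (.of_forall fun t => ?_)
    by_cases ht : 1 < ‖x - t‖
    · simp [hφ.eq_zero _ ht]
    · rw [norm_mul, Real.norm_of_nonneg (hφ.nonneg _)]
      refine mul_le_mul_of_nonneg_right ?_ (hφ.nonneg _)
      have := hn0 n hn t (by
        have : ‖t‖ ≤ ‖x‖ + ‖x - t‖ := by
          calc ‖t‖ = ‖x - (x - t)‖ := by congr 1; abel
            _ ≤ _ := norm_sub_le _ _
        simp; linarith)
      rw [dist_comm, dist_eq_norm] at this
      exact this.le
  rw [integral_const_mul, hφ.integral_sub, mul_one] at this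
  linarith

end Regularity

/-! ### Smoothness and locally uniform limits of harmonic functions -/

section HarmonicLimits

variable {N : ℕ}

theorem IsHarmonicOnSpace.contDiff_top (hN : 2 ≤ N) {h : EuclideanSpace ℝ (Fin N) → ℝ}
    (hh : IsHarmonicOnSpace h) : ContDiff ℝ (⊤ : ℕ∞) h := by
  obtain ⟨φ, hφ, hr⟩ := exists_reproducing_mollifier hN
  exact (hr h hh).contDiff hφ (isHarmonicOnSpace_iff.1 hh).1.continuous

theorem IsHarmonicOnSpace.partialDeriv (hN : 2 ≤ N) {h : EuclideanSpace ℝ (Fin N) → ℝ}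
    (hh : IsHarmonicOnSpace h) (k : Fin N) : IsHarmonicOnSpace (partialDeriv k h) := by
  have hs := hh.contDiff_top hN
  refine isHarmonicOnSpace_iff.2 ⟨contDiff_partialDeriv (n := ⊤) (m := 2) hs (by simp) k,
    fun x => ?_⟩
  rw [lap_partialDeriv (contDiff_infty.1 hs 3)]
  have : lap h = fun _ => 0 := funext (isHarmonicOnSpace_iff.1 hh).2
  rw [this, partialDeriv_const]

theorem IsHarmonicOnSpace.iterate_partialDeriv (hN : 2 ≤ N) {h : EuclideanSpace ℝ (Fin N) → ℝ}
    (hh : IsHarmonicOnSpace h) (k : Fin N) :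
    ∀ n, IsHarmonicOnSpace ((_root_.partialDeriv k)^[n] h)
  | 0 => hh
  | n + 1 => by
    rw [Function.iterate_succ_apply']
    exact (iterate_partialDeriv hN hh k n).partialDeriv hN k

/-- The gradient estimate for f - s_n, at the cost of enlarging the ball by the kernel radius 1. -/
theorem tendstoUniformlyOn_partialDeriv_of_reproduces {φ : EuclideanSpace ℝ (Fin N) → ℝ}
    (hφ : IsMollifier φ) {s : ℕ → EuclideanSpace ℝ (Fin N) → ℝ} {f : EuclideanSpace ℝ (Fin N) → ℝ}
    (hsc : ∀ n, Continuous (s n)) (hfc : Continuous f) (hs : ∀ n, Reproduces φ (s n))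
    (hf : Reproduces φ f) (hlim : ∀ R : ℝ, TendstoUniformlyOn s f atTop (Metric.closedBall 0 R))
    (i : Fin N) (R : ℝ) : TendstoUniformlyOn (fun n => partialDeriv i (s n)) (partialDeriv i f) atTop
      (Metric.closedBall 0 R) := by
  obtain ⟨C, hC, hb⟩ := Reproduces.exists_abs_partialDeriv_le hφ i
  rw [Metric.tendstoUniformlyOn_iff]
  intro ε hε
  filter_upwards [Metric.tendstoUniformlyOn_iff.1 (hlim (R + 1)) (ε / (2 * C)) (by positivity)]
    with n hn x hx
  have h1 := hb (fun x => f x - s n x) (hfc.sub (hsc n)) (hf.sub hφ hfc (hsc n) (hs n)) x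
    (ε / (2 * C)) fun t ht => by
      have := hn t (by
        simp only [Metric.mem_closedBall, dist_zero_right] at hx ht ⊢
        have := norm_le_norm_add_norm_sub' t x
        rw [dist_eq_norm] at ht
        linarith)
      rw [Real.dist_eq] at this
      exact this.le
  rw [partialDeriv_sub ((hf.contDiff hφ hfc).differentiable (by simp))
    (((hs n).contDiff hφ (hsc n)).differentiable (by simp))] at h1
  rw [Real.dist_eq]
  refine h1.trans_lt ?_
  rw [mul_div_assoc', div_lt_iff₀ (by positivity)]
  nlinarith [mul_pos hC hε]

/-- Locally uniform limits of harmonic functions are harmonic, and partial derivatives may be taken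
termwise. -/
theorem isHarmonicOnSpace_of_tendsto (hN : 2 ≤ N) {s : ℕ → EuclideanSpace ℝ (Fin N) → ℝ}
    {f : EuclideanSpace ℝ (Fin N) → ℝ} (hs : ∀ n, IsHarmonicOnSpace (s n)) (hfc : Continuous f)
    (hlim : ∀ R : ℝ, TendstoUniformlyOn s f atTop (Metric.closedBall 0 R)) :
    IsHarmonicOnSpace f ∧ ∀ i x, Tendsto (fun n => partialDeriv i (s n) x) atTop
      (𝓝 (partialDeriv i f x)) := by
  obtain ⟨φ, hφ, hr⟩ := exists_reproducing_mollifier hN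
  have hsc := fun n => (isHarmonicOnSpace_iff.1 (hs n)).1.continuous
  have hf : Reproduces φ f := Reproduces.of_tendsto hφ hsc hfc (fun n => hr _ (hs n)) hlim
  have hsm := hf.contDiff hφ hfc
  have hpf := fun i => (contDiff_partialDeriv (n := ⊤) (m := 0) hsm (by simp) i).continuous
  have hsp := fun n i => (hs n).partialDeriv hN i
  have hspc := fun n i => (isHarmonicOnSpace_iff.1 (hsp n i)).1.continuous
  have l1 := fun i => tendstoUniformlyOn_partialDeriv_of_reproduces hφ hsc hfc
    (fun n => hr _ (hs n)) hf hlim i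
  -- The partial derivatives are again reproduced by φ, so the derivative estimate applies a second
  -- time and the Laplacians converge.
  have hfp := fun i => Reproduces.of_tendsto hφ (fun n => hspc n i) (hpf i)
    (fun n => hr _ (hsp n i)) (l1 i)
  have l2 := fun i => tendstoUniformlyOn_partialDeriv_of_reproduces hφ (fun n => hspc n i) (hpf i)
    (fun n => hr _ (hsp n i)) (hfp i) (l1 i) i
  refine ⟨isHarmonicOnSpace_iff.2 ⟨contDiff_infty.1 hsm 2, fun x => ?_⟩,
    fun i x => (l1 i ‖x‖).tendsto_at (by simp)⟩
  have h1 : Tendsto (fun n => lap (s n) x) atTop (𝓝 (lap f x)) :=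
    tendsto_finsetSum _ fun i _ => (l2 i ‖x‖).tendsto_at (by simp)
  simp only [fun n => (isHarmonicOnSpace_iff.1 (hs n)).2 x] at h1
  exact (tendsto_nhds_unique h1 tendsto_const_nhds)

end HarmonicLimits

/-! ### Mean squares, orthogonality and Bessel's inequality -/

section Bessel

variable {N : ℕ}

/-- The mean square of the zonal harmonic of degree `j` on the unit sphere. -/
noncomputable def zonalNormSq (N : ℕ) : ℕ → ℝ
  | 0 => 1
  | 1 => (N : ℝ)⁻¹
  | j + 2 => (2 * j + N) / ((j + 2) * (j + N - 1) * (2 * j + N + 2)) * zonalNormSq N (j + 1)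

theorem zonalNormSq_pos (hN : 2 ≤ N) : ∀ j, 0 < zonalNormSq N j
  | 0 => one_pos
  | 1 => by
    simp only [zonalNormSq]
    have : (0 : ℝ) < N := by exact_mod_cast (by omega)
    positivity
  | j + 2 => by
    have h := zonalNormSq_pos hN (j + 1)
    have hN' : (2 : ℝ) ≤ N := by exact_mod_cast hN
    have hj : (0 : ℝ) ≤ j := j.cast_nonneg
    have : (0 : ℝ) < j + N - 1 := by linarith
    rw [zonalNormSq]
    positivity

theorem zonalNormSq_succ (M : ℕ) : ∀ j : ℕ, zonalNormSq (M + 2) (j + 1) =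
    M.factorial / ((2 * j + M + 2) * (j + 1).factorial * (j + M).factorial)
  | 0 => by
    have : (M.factorial : ℝ) ≠ 0 := by positivity
    simp [zonalNormSq]
    field_simp
  | j + 1 => by
    rw [zonalNormSq, zonalNormSq_succ M j, show j + 1 + M = j + M + 1 by ring,
      Nat.factorial_succ (j + 1), Nat.factorial_succ (j + M)]
    push_cast
    have h1 : (j : ℝ) + (M + 2) - 1 = j + M + 1 := by ring
    have h2 : (2 * (j : ℝ) + (M + 2)) = 2 * j + M + 2 := by ring
    rw [h1, h2]
    field_simp
    ring

/-- With N = M + 2, in the closed form `zonalNormSq_succ` the quotient (j+M)!/j! is a rising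
factorial lying between (j+1)^M and (j+M)^M. -/
theorem exists_zonalNormSq_bounds (hN : 2 ≤ N) : ∃ c C : ℝ, 0 < c ∧ 0 < C ∧ ∀ j : ℕ,
    c ≤ zonalNormSq N j * ((j.factorial : ℝ) ^ 2 * ((j : ℝ) + 1) ^ (N - 2)) ∧
    zonalNormSq N j * ((j.factorial : ℝ) ^ 2 * ((j : ℝ) + 1) ^ (N - 2)) ≤ C := by
  obtain ⟨M, rfl⟩ := Nat.exists_eq_add_of_le' hN
  have hM1 : (1 : ℝ) ≤ M.factorial := by exact_mod_cast Nat.factorial_pos M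
  refine ⟨1 / ((M + 2) * (M + 2) ^ M), M.factorial * 2 ^ M, by positivity, by positivity,
    fun j => ?_⟩
  rcases j with _ | j
  · have h2 : (1 : ℝ) ≤ 2 ^ M := one_le_pow₀ (by norm_num)
    have h3 : (1 : ℝ) ≤ (M + 2) ^ M := one_le_pow₀ (by linarith [(M.cast_nonneg : (0 : ℝ) ≤ M)])
    simp only [zonalNormSq, Nat.factorial_zero, Nat.cast_one, one_pow, CharP.cast_eq_zero, zero_add,
      mul_one]
    constructor
    · rw [div_le_one (by positivity)]
      nlinarith [(M.cast_nonneg : (0 : ℝ) ≤ M)]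
    · nlinarith
  · have hasc : ((j + M).factorial : ℝ) = j.factorial * (j + 1).ascFactorial M := by
      exact_mod_cast (Nat.factorial_mul_ascFactorial j M).symm
    have hlo : ((j : ℝ) + 1) ^ M ≤ ((j + 1).ascFactorial M : ℝ) := by
      exact_mod_cast Nat.pow_succ_le_ascFactorial (j + 1) M
    have hhi : ((j + 1).ascFactorial M : ℝ) ≤ ((j : ℝ) + M) ^ M := by
      exact_mod_cast Nat.ascFactorial_le_pow_add j M
    set A : ℝ := ((j + 1).ascFactorial M : ℝ)
    have hj : (0 : ℝ) ≤ j := j.cast_nonneg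
    have hM : (0 : ℝ) ≤ M := M.cast_nonneg
    have hA : 0 < A := lt_of_lt_of_le (by positivity) hlo
    have e : zonalNormSq (M + 2) (j + 1) * (((j + 1).factorial : ℝ) ^ 2 *
        (((j + 1 : ℕ) : ℝ) + 1) ^ (M + 2 - 2)) =
        M.factorial * ((j + 1) / (2 * j + M + 2)) * ((j + 2) ^ M / A) := by
      rw [zonalNormSq_succ, hasc, Nat.factorial_succ j]
      push_cast
      rw [show (j : ℝ) + 1 + 1 = j + 2 by ring]
      field_simp
    rw [e]
    have f1 : (1 : ℝ) / (M + 2) ≤ (j + 1) / (2 * j + M + 2) := by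
      rw [div_le_div_iff₀ (by positivity) (by positivity)]; nlinarith
    have f2 : ((j : ℝ) + 1) / (2 * j + M + 2) ≤ 1 := by
      rw [div_le_one (by positivity)]; linarith
    have f3 : ((j : ℝ) + 2) ^ M / A ≤ 2 ^ M := by
      rw [div_le_iff₀ hA]
      calc ((j : ℝ) + 2) ^ M ≤ (2 * (j + 1)) ^ M := by gcongr; linarith
        _ = 2 ^ M * (j + 1) ^ M := mul_pow _ _ _
        _ ≤ _ := by gcongr
    have f4 : 1 / ((M : ℝ) + 2) ^ M ≤ ((j : ℝ) + 2) ^ M / A := by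
      rw [div_le_div_iff₀ (by positivity) hA, one_mul, ← mul_pow]
      refine hhi.trans ?_
      gcongr
      nlinarith
    constructor
    · calc 1 / (((M : ℝ) + 2) * (M + 2) ^ M) = 1 * (1 / (M + 2)) * (1 / (M + 2) ^ M) := by
            field_simp
        _ ≤ _ := by gcongr
    · calc M.factorial * (((j : ℝ) + 1) / (2 * j + M + 2)) * ((j + 2) ^ M / A)
          ≤ M.factorial * 1 * 2 ^ M := by gcongr
        _ = _ := by ring

theorem zonalCoeff_zero (hN : 2 ≤ N) (k : Fin N) {h : EuclideanSpace ℝ (Fin N) → ℝ}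
    (hh : IsHarmonicOnSpace h) : zonalCoeff k 0 h =
      (volume : Measure (EuclideanSpace ℝ (Fin N))).toSphere.real Set.univ * h 0 := by
  rw [← integral_sphere_of_isHarmonicOnSpace hN hh one_pos]
  simp [zonalCoeff, zonal]

/-- Each relation between coefficients trades one degree for one derivative; iterating down to
degree zero leaves a mean value at the origin. The accumulated factor is the recursion defining
`zonalNormSq`, which for h = Z_j is seen to be the mean square. -/
theorem zonalCoeff_eq (hN : 2 ≤ N) (k : Fin N) : ∀ (j : ℕ) {h : EuclideanSpace ℝ (Fin N) → ℝ},
    IsHarmonicOnSpace h → zonalCoeff k j h = zonalNormSq N j *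
      (volume : Measure (EuclideanSpace ℝ (Fin N))).toSphere.real Set.univ *
        (partialDeriv k)^[j] h 0
  | 0, h, hh => by
    rw [zonalCoeff_zero hN k hh]
    simp [zonalNormSq]
  | 1, h, hh => by
    have hN0 : (N : ℝ) ≠ 0 := by exact_mod_cast (by omega)
    have := zonalCoeff_one hN k hh
    rw [zonalCoeff_zero hN k (hh.partialDeriv hN k)] at this
    simp only [zonalNormSq, Function.iterate_one]
    field_simp
    linarith
  | j + 2, h, hh => by
    have hN' : (2 : ℝ) ≤ N := by exact_mod_cast hN
    have hj : (0 : ℝ) ≤ j := j.cast_nonneg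
    have h1 : (0 : ℝ) < j + N - 1 := by linarith
    have := zonalCoeff_add_two hN k j hh
    rw [zonalCoeff_eq hN k (j + 1) (hh.partialDeriv hN k), ← Function.iterate_succ_apply] at this
    rw [zonalNormSq]
    field_simp
    linarith

theorem iterate_partialDeriv_zonal (hN : 2 ≤ N) (k : Fin N) (j : ℕ) :
    ∀ n, (partialDeriv k)^[n] (zonal k (n + j)) = zonal k j
  | 0 => by simp
  | n + 1 => by
    rw [Function.iterate_succ_apply, show n + 1 + j = n + j + 1 by ring,
      partialDeriv_zonal_succ hN, iterate_partialDeriv_zonal hN k j n]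

theorem zonalCoeff_zonal_self (hN : 2 ≤ N) (k : Fin N) (j : ℕ) : zonalCoeff k j (zonal k j) =
    zonalNormSq N j * (volume : Measure (EuclideanSpace ℝ (Fin N))).toSphere.real Set.univ := by
  rw [zonalCoeff_eq hN k j (isHarmonicOnSpace_zonal hN k j)]
  have := iterate_partialDeriv_zonal hN k 0 j
  rw [add_zero] at this
  rw [this]
  simp [zonal]

theorem integral_sphere_sum_zonal_sq (hN : 2 ≤ N) (k : Fin N) (c : ℕ → ℝ) (K : ℕ) :
    ∫ y : Metric.sphere (0 : EuclideanSpace ℝ (Fin N)) 1,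
      (∑ n ∈ Finset.range K, c n * zonal k n y) ^ 2
        ∂(volume : Measure (EuclideanSpace ℝ (Fin N))).toSphere =
      (volume : Measure (EuclideanSpace ℝ (Fin N))).toSphere.real Set.univ *
        ∑ n ∈ Finset.range K, zonalNormSq N n * c n ^ 2 := by
  have hzc := fun j => (contDiff_zonal k 1 j).continuous
  have e : ∀ y : EuclideanSpace ℝ (Fin N), (∑ n ∈ Finset.range K, c n * zonal k n y) ^ 2 =
      ∑ n ∈ Finset.range K, ∑ m ∈ Finset.range K, c n * c m * (zonal k n y * zonal k m y) := by
    intro y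
    rw [sq, Finset.sum_mul_sum]
    refine Finset.sum_congr rfl fun n _ => Finset.sum_congr rfl fun m _ => by ring
  simp only [e]
  rw [integral_finsetSum _ fun n _ => integrable_sphere (by fun_prop), Finset.mul_sum]
  refine Finset.sum_congr rfl fun n hn => ?_
  rw [integral_finsetSum _ fun m _ => integrable_sphere (by fun_prop)]
  simp only [integral_const_mul]
  rw [Finset.sum_eq_single_of_mem n hn]
  · have := zonalCoeff_zonal_self hN k n
    rw [zonalCoeff] at this
    rw [this]
    ring
  · intro m _ hm
    have := zonalCoeff_zonal_of_ne hN k (i := n) (j := m) (Ne.symm hm)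
    rw [zonalCoeff] at this
    rw [this, mul_zero]

theorem iterate_partialDeriv_translate (k : Fin N) (x : EuclideanSpace ℝ (Fin N)) :
    ∀ (n : ℕ) (h : EuclideanSpace ℝ (Fin N) → ℝ),
      (partialDeriv k)^[n] (fun y => h (x + y)) = fun y => (partialDeriv k)^[n] h (x + y)
  | 0, h => rfl
  | n + 1, h => by
    have : partialDeriv k (fun y => h (x + y)) = fun y => partialDeriv k h (x + y) := by
      ext y
      simp only [partialDeriv]
      rw [fderiv_comp_add_left]
    rw [Function.iterate_succ_apply, this, iterate_partialDeriv_translate k x n,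
      Function.iterate_succ_apply]

/-- Bessel's inequality for the zonal expansion about `x`. -/
theorem sum_zonalNormSq_mul_le (hN : 2 ≤ N) (k : Fin N) {h : EuclideanSpace ℝ (Fin N) → ℝ}
    (hh : IsHarmonicOnSpace h) (x : EuclideanSpace ℝ (Fin N)) {r : ℝ} (hr : 0 < r) (K : ℕ) :
    (volume : Measure (EuclideanSpace ℝ (Fin N))).toSphere.real Set.univ *
      ∑ n ∈ Finset.range K, zonalNormSq N n * (r ^ n * (partialDeriv k)^[n] h x) ^ 2 ≤
    ∫ y : Metric.sphere (0 : EuclideanSpace ℝ (Fin N)) 1,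
      h (x + r • (y : EuclideanSpace ℝ (Fin N))) ^ 2
        ∂(volume : Measure (EuclideanSpace ℝ (Fin N))).toSphere := by
  set σ := (volume : Measure (EuclideanSpace ℝ (Fin N))).toSphere
  set g : EuclideanSpace ℝ (Fin N) → ℝ := fun y => h (x + y)
  have hg : IsHarmonicOnSpace g := isHarmonicOnSpace_translate hh x
  have hgc := (isHarmonicOnSpace_iff.1 hg).1.continuous
  have hzc := fun j => (contDiff_zonal k 1 j).continuous
  set c : ℕ → ℝ := fun n => r ^ n * (partialDeriv k)^[n] h x
  have hco : ∀ n, ∫ y : Metric.sphere (0 : EuclideanSpace ℝ (Fin N)) 1,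
      g (r • (y : EuclideanSpace ℝ (Fin N))) * zonal k n y ∂σ =
        zonalNormSq N n * σ.real Set.univ * c n := by
    intro n
    rw [integral_sphere_mul_zonal hN k n hg hr, zonalCoeff_eq hN k n hg,
      iterate_partialDeriv_translate]
    simp only [c, add_zero, σ]
    ring
  -- `c` holds the Fourier coefficients of g(r ·) along the Z_n, so expanding the squared distance
  -- to this projection yields Bessel.
  have h0 : 0 ≤ ∫ y : Metric.sphere (0 : EuclideanSpace ℝ (Fin N)) 1,
      (g (r • (y : EuclideanSpace ℝ (Fin N))) -
        ∑ n ∈ Finset.range K, c n * zonal k n y) ^ 2 ∂σ := integral_nonneg fun y => sq_nonneg _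
  have e : ∀ y : Metric.sphere (0 : EuclideanSpace ℝ (Fin N)) 1,
      (g (r • (y : EuclideanSpace ℝ (Fin N))) - ∑ n ∈ Finset.range K, c n * zonal k n y) ^ 2 =
      (g (r • (y : EuclideanSpace ℝ (Fin N))) ^ 2 - 2 * ∑ n ∈ Finset.range K,
        c n * (g (r • (y : EuclideanSpace ℝ (Fin N))) * zonal k n y)) +
        (∑ n ∈ Finset.range K, c n * zonal k n y) ^ 2 := by
    intro y
    have : ∑ n ∈ Finset.range K, c n * (g (r • (y : EuclideanSpace ℝ (Fin N))) * zonal k n y) =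
        g (r • (y : EuclideanSpace ℝ (Fin N))) * ∑ n ∈ Finset.range K, c n * zonal k n y := by
      rw [Finset.mul_sum]
      exact Finset.sum_congr rfl fun n _ => by ring
    rw [this]
    ring
  simp only [e] at h0
  rw [integral_add (integrable_sphere (by fun_prop)) (integrable_sphere (by fun_prop)),
    integral_sub (integrable_sphere (by fun_prop)) (integrable_sphere (by fun_prop)),
    integral_const_mul, integral_finsetSum _ fun n _ => integrable_sphere (by fun_prop),
    integral_sphere_sum_zonal_sq hN] at h0
  have hσ : (volume : Measure (EuclideanSpace ℝ (Fin N))).toSphere = σ := rfl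
  simp only [integral_const_mul, hσ, hco] at h0
  have e2 : ∑ n ∈ Finset.range K, c n * (zonalNormSq N n * σ.real Set.univ * c n) =
      σ.real Set.univ * ∑ n ∈ Finset.range K, zonalNormSq N n * c n ^ 2 := by
    rw [Finset.mul_sum]
    exact Finset.sum_congr rfl fun n _ => by ring
  rw [e2] at h0
  linarith

end Bessel

/-! ### Stirling estimates and weighted sums -/

section Asymptotics

/-- With a = n - 1/2, the function r^a e^(-r) is largest at r = a, and Stirling compares a^a e^(-a)
with n!/n = (n-1)!. -/
theorem rpow_mul_exp_neg_le {n : ℕ} (hn : 1 ≤ n) {r : ℝ} (hr : 0 < r) :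
    r ^ ((n : ℝ) - 1 / 2) ≤ Real.exp 1 * (n - 1).factorial * Real.exp r := by
  have hn' : (1 : ℝ) ≤ n := by exact_mod_cast hn
  set a : ℝ := (n : ℝ) - 1 / 2
  have ha : 0 < a := by simp only [a]; linarith
  have h1 : r ^ a ≤ a ^ a * Real.exp (r - a) := by
    have h2 : (r / a) ^ a ≤ Real.exp (r / a - 1) ^ a := by
      gcongr
      linarith [Real.add_one_le_exp (r / a - 1)]
    have e : (r / a - 1) * a = r - a := by field_simp
    rw [← Real.exp_mul, e, Real.div_rpow hr.le ha.le, div_le_iff₀ (by positivity)] at h2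
    linarith
  have h2 : a ^ a ≤ n ^ n / √n := by
    calc a ^ a ≤ (n : ℝ) ^ a := by
          gcongr
          simp only [a]; linarith
      _ = n ^ n / √n := by
          rw [Real.rpow_sub (by linarith), Real.rpow_natCast, Real.sqrt_eq_rpow]
  have h3 : (n : ℝ) ^ n ≤ n.factorial / √n * Real.exp n := by
    have h := Stirling.le_factorial_stirling n
    have h4 : √n ≤ √(2 * Real.pi * n) := by
      apply Real.sqrt_le_sqrt
      nlinarith [Real.pi_gt_three]
    have h5 : √n * (n / Real.exp 1) ^ n ≤ n.factorial := le_trans (by gcongr) h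
    rw [div_pow, ← Real.exp_nat_mul, mul_one] at h5
    rw [div_mul_eq_mul_div, le_div_iff₀ (by positivity)]
    rw [mul_div_assoc', div_le_iff₀ (by positivity)] at h5
    linarith
  have h6 : ((n.factorial : ℕ) : ℝ) = n * (n - 1).factorial := by
    exact_mod_cast (Nat.mul_factorial_pred (by omega)).symm
  have hs : √(n : ℝ) * √n = n := Real.mul_self_sqrt (by linarith)
  have hs0 : 0 < √(n : ℝ) := by positivity
  calc r ^ a ≤ a ^ a * Real.exp (r - a) := h1
    _ ≤ n.factorial / √n * Real.exp n / √n * Real.exp (r - a) := by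
        gcongr
        exact h2.trans (by gcongr)
    _ = (n - 1).factorial * (Real.exp n * Real.exp (r - a)) := by
        rw [h6]
        field_simp
        rw [← sq] at hs
        rw [hs]
    _ = (n - 1).factorial * (Real.exp (1 / 2) * Real.exp r) := by
        rw [← Real.exp_add, ← Real.exp_add]
        congr 2
        simp only [a]; ring
    _ ≤ (n - 1).factorial * (Real.exp 1 * Real.exp r) := by
        gcongr
        norm_num
    _ = _ := by ring

/-- Split the j-th term, up to a constant, as (r^j / j!) · r^j / (j! (j+1)^(N-2)). The second factor
is at most a constant times e^r / r^(N-3/2), uniformly in j; the first sums to e^r. -/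
theorem exists_sum_zonalNormSq_le {N : ℕ} (hN : 2 ≤ N) : ∃ C : ℝ, 0 < C ∧ ∀ r : ℝ, 0 < r → ∀ K : ℕ,
    ∑ j ∈ Finset.range K, zonalNormSq N j * r ^ (2 * j) ≤
      C * (Real.exp r / r ^ ((N : ℝ) / 2 - 3 / 4)) ^ 2 := by
  obtain ⟨_, C, _, hC, hb⟩ := exists_zonalNormSq_bounds hN
  obtain ⟨M, rfl⟩ := Nat.exists_eq_add_of_le' hN
  set A : ℝ := Real.exp 1 * (M + 1) ^ M
  refine ⟨C * A, by positivity, fun r hr K => ?_⟩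
  have hE : (Real.exp r / r ^ (((M + 2 : ℕ) : ℝ) / 2 - 3 / 4)) ^ 2 =
      Real.exp r * Real.exp r / r ^ ((M : ℝ) + 1 / 2) := by
    rw [div_pow, sq, ← Real.rpow_natCast (r ^ _), ← Real.rpow_mul hr.le]
    congr 2
    push_cast
    ring
  rw [hE]
  have hterm : ∀ j : ℕ, zonalNormSq (M + 2) j * r ^ (2 * j) ≤
      (C * A * (Real.exp r / r ^ ((M : ℝ) + 1 / 2))) * (r ^ j / j.factorial) := by
    intro j
    have h1 := (hb j).2
    have h2 := rpow_mul_exp_neg_le (n := j + M + 1) (by omega) hr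
    have h3 : ((j + M).factorial : ℝ) ≤ j.factorial * ((M + 1) ^ M * (j + 1) ^ M) := by
      have hasc : ((j + M).factorial : ℝ) = j.factorial * (j + 1).ascFactorial M := by
        exact_mod_cast (Nat.factorial_mul_ascFactorial j M).symm
      have hhi : ((j + 1).ascFactorial M : ℝ) ≤ ((j : ℝ) + M) ^ M := by
        exact_mod_cast Nat.ascFactorial_le_pow_add j M
      rw [hasc, ← mul_pow]
      gcongr
      refine hhi.trans ?_
      gcongr
      nlinarith [(M.cast_nonneg : (0 : ℝ) ≤ M), (j.cast_nonneg : (0 : ℝ) ≤ j)]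
    have e : r ^ (((j + M + 1 : ℕ) : ℝ) - 1 / 2) = r ^ j * r ^ ((M : ℝ) + 1 / 2) := by
      rw [← Real.rpow_natCast r j, ← Real.rpow_add hr]
      congr 1
      push_cast
      ring
    rw [e, Nat.add_sub_cancel] at h2
    set S := r ^ ((M : ℝ) + 1 / 2)
    have hS : 0 < S := by positivity
    have hf : (0 : ℝ) < j.factorial := by positivity
    have hjM : (0 : ℝ) < ((j : ℝ) + 1) ^ M := by positivity
    have h4 : r ^ j / (j.factorial * ((j : ℝ) + 1) ^ M) ≤ A * (Real.exp r / S) := by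
      rw [div_le_iff₀ (by positivity), mul_div_assoc', div_mul_eq_mul_div, le_div_iff₀ hS]
      refine h2.trans ?_
      calc Real.exp 1 * (j + M).factorial * Real.exp r
          ≤ Real.exp 1 * (j.factorial * ((M + 1) ^ M * (j + 1) ^ M)) * Real.exp r := by gcongr
        _ = _ := by simp only [A]; ring
    have h5 : zonalNormSq (M + 2) j ≤ C / (j.factorial ^ 2 * ((j : ℝ) + 1) ^ M) := by
      rw [le_div_iff₀ (by positivity)]
      exact h1
    calc zonalNormSq (M + 2) j * r ^ (2 * j)
        ≤ C / (j.factorial ^ 2 * ((j : ℝ) + 1) ^ M) * r ^ (2 * j) := by gcongr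
      _ = C * (r ^ j / (j.factorial * ((j : ℝ) + 1) ^ M)) * (r ^ j / j.factorial) := by
          field_simp; ring
      _ ≤ C * (A * (Real.exp r / S)) * (r ^ j / j.factorial) := by gcongr
      _ = _ := by ring
  calc ∑ j ∈ Finset.range K, zonalNormSq (M + 2) j * r ^ (2 * j)
      ≤ ∑ j ∈ Finset.range K, (C * A * (Real.exp r / r ^ ((M : ℝ) + 1 / 2))) *
          (r ^ j / j.factorial) := Finset.sum_le_sum fun j _ => hterm j
    _ = (C * A * (Real.exp r / r ^ ((M : ℝ) + 1 / 2))) *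
        ∑ j ∈ Finset.range K, r ^ j / j.factorial := by rw [Finset.mul_sum]
    _ ≤ (C * A * (Real.exp r / r ^ ((M : ℝ) + 1 / 2))) * Real.exp r := by
        gcongr
        exact Real.sum_le_exp_of_nonneg hr.le K
    _ = _ := by ring

/-- The Stirling sequence decreases from its value e/√2 at n = 1. -/
theorem factorial_le_stirling {n : ℕ} (hn : 1 ≤ n) :
    (n.factorial : ℝ) ≤ Real.exp 1 * √n * (n / Real.exp 1) ^ n := by
  obtain ⟨m, rfl⟩ := Nat.exists_eq_add_of_le' hn
  have h := Stirling.stirlingSeq'_antitone (Nat.zero_le m)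
  simp only [Function.comp, Nat.succ_eq_add_one, zero_add, Stirling.stirlingSeq_one] at h
  rw [Stirling.stirlingSeq, div_le_iff₀ (by positivity),
    Real.sqrt_mul (by norm_num)] at h
  refine h.trans (le_of_eq ?_)
  field_simp

/-- On this window l^n e^(-l) stays within a factor e of its maximum at l = n: log(l/n) ≥ 1 - n/l
gives n log(l/n) ≥ (l-n) - (l-n)²/l, and (l-n)² ≤ n ≤ l. -/
theorem pow_mul_exp_neg_ge {n l : ℕ} (hn : 1 ≤ n) (h1 : n ≤ l) (h2 : l ≤ n + Nat.sqrt n) :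
    (n : ℝ) ^ n * Real.exp (-n) * Real.exp (-1) ≤ (l : ℝ) ^ n * Real.exp (-l) := by
  have hn' : (0 : ℝ) < n := by exact_mod_cast hn
  have hl' : (n : ℝ) ≤ l := by exact_mod_cast h1
  have hl0 : (0 : ℝ) < l := by linarith
  have hsq : ((l : ℝ) - n) ^ 2 ≤ n := by
    have h3 : (l : ℝ) - n ≤ Nat.sqrt n := by
      have : (l : ℝ) ≤ n + Nat.sqrt n := by exact_mod_cast h2
      linarith
    have h4 : ((Nat.sqrt n : ℕ) : ℝ) ^ 2 ≤ n := by exact_mod_cast Nat.sqrt_le' n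
    nlinarith
  have hlog : (l : ℝ) - n - 1 ≤ n * Real.log (l / n) := by
    have h3 := Real.one_sub_inv_le_log_of_pos (div_pos hl0 hn')
    have h4 : (l : ℝ) - n - 1 ≤ n * (1 - (l / n : ℝ)⁻¹) := by
      rw [inv_div, one_sub_div hl0.ne', mul_div_assoc', le_div_iff₀ hl0]
      nlinarith
    exact h4.trans (mul_le_mul_of_nonneg_left h3 hn'.le)
  have h5 : Real.exp ((l : ℝ) - n - 1) ≤ (l / n : ℝ) ^ n := by
    rw [← Real.exp_log (pow_pos (div_pos hl0 hn') n), Real.log_pow]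
    exact Real.exp_le_exp.2 hlog
  rw [div_pow, le_div_iff₀ (by positivity)] at h5
  calc (n : ℝ) ^ n * Real.exp (-n) * Real.exp (-1)
      = Real.exp ((l : ℝ) - n - 1) * n ^ n * Real.exp (-l) := by
        rw [show -(n : ℝ) = (l - n - 1) + (-l) + 1 by ring, Real.exp_add, Real.exp_add,
          mul_assoc, mul_assoc, ← Real.exp_add 1]
        simp
        ring
    _ ≤ _ := by gcongr

/-- The window has more than √n integers and each term is at least a constant over √n. -/
theorem exists_window_lower_bound {N : ℕ} (hN : 2 ≤ N) : ∃ c : ℝ, 0 < c ∧ ∀ n : ℕ, 1 ≤ n →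
    c ≤ ∑ l ∈ Finset.Icc n (n + Nat.sqrt n), zonalNormSq N n * (l : ℝ) ^ (2 * n) *
      ((l : ℝ) ^ ((N : ℝ) - 3 / 2) * Real.exp (-(2 * l))) := by
  obtain ⟨c, _, hc, _, hb⟩ := exists_zonalNormSq_bounds hN
  obtain ⟨M, rfl⟩ := Nat.exists_eq_add_of_le' hN
  refine ⟨c * Real.exp (-1) ^ 4 / 2 ^ M, by positivity, fun n hn => ?_⟩
  have hn' : (1 : ℝ) ≤ n := by exact_mod_cast hn
  set P : ℝ := (n : ℝ) ^ n * Real.exp (-n)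
  have hP : 0 < P := by positivity
  have hf : (0 : ℝ) < n.factorial := by positivity
  have hst : (n.factorial : ℝ) ≤ Real.exp 1 * √n * P := by
    refine (factorial_le_stirling hn).trans (le_of_eq ?_)
    rw [div_pow, ← Real.exp_nat_mul, mul_one]
    simp only [P, Real.exp_neg]
    rfl
  have hs0 : 0 < √(n : ℝ) := by positivity
  have hQ : c / (n.factorial ^ 2 * ((n : ℝ) + 1) ^ M) ≤ zonalNormSq (M + 2) n := by
    rw [div_le_iff₀ (by positivity)]
    exact (hb n).1
  have hterm : ∀ l ∈ Finset.Icc n (n + Nat.sqrt n), c * Real.exp (-1) ^ 4 / 2 ^ M / √n ≤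
      zonalNormSq (M + 2) n * (l : ℝ) ^ (2 * n) *
      ((l : ℝ) ^ (((M + 2 : ℕ) : ℝ) - 3 / 2) * Real.exp (-(2 * l))) := by
    intro l hl
    rw [Finset.mem_Icc] at hl
    have hl' : (n : ℝ) ≤ l := by exact_mod_cast hl.1
    have h1 := pow_mul_exp_neg_ge hn hl.1 hl.2
    have h2 : (n : ℝ) ^ M * √n ≤ (l : ℝ) ^ (((M + 2 : ℕ) : ℝ) - 3 / 2) := by
      have : (n : ℝ) ^ M * √n = (n : ℝ) ^ (((M + 2 : ℕ) : ℝ) - 3 / 2) := by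
        rw [Real.sqrt_eq_rpow, ← Real.rpow_natCast, ← Real.rpow_add (by linarith)]
        congr 1
        push_cast
        ring
      rw [this]
      refine Real.rpow_le_rpow (by linarith) hl' ?_
      push_cast
      linarith [(M.cast_nonneg : (0 : ℝ) ≤ M)]
    have h3 : ((n : ℝ) + 1) ^ M ≤ 2 ^ M * n ^ M := by
      rw [← mul_pow]
      gcongr
      linarith
    calc c * Real.exp (-1) ^ 4 / 2 ^ M / √n
        = c / ((Real.exp 1 * √n * P) ^ 2 * (2 ^ M * n ^ M)) * (P * Real.exp (-1)) ^ 2 *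
          (n ^ M * √n) := by
          rw [Real.exp_neg]
          field_simp
      _ ≤ c / (n.factorial ^ 2 * ((n : ℝ) + 1) ^ M) * ((l : ℝ) ^ n * Real.exp (-l)) ^ 2 *
          (l : ℝ) ^ (((M + 2 : ℕ) : ℝ) - 3 / 2) := by gcongr
      _ ≤ zonalNormSq (M + 2) n * ((l : ℝ) ^ n * Real.exp (-l)) ^ 2 *
          (l : ℝ) ^ (((M + 2 : ℕ) : ℝ) - 3 / 2) := by gcongr
      _ = _ := by
          rw [mul_pow, ← Real.exp_nat_mul, ← pow_mul, mul_comm n 2]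
          push_cast
          rw [show (2 : ℝ) * -l = -(2 * l) by ring]
          ring
  have hcard : √(n : ℝ) ≤ (Finset.Icc n (n + Nat.sqrt n)).card := by
    rw [Nat.card_Icc, show n + Nat.sqrt n + 1 - n = Nat.sqrt n + 1 by omega]
    rw [Real.sqrt_le_left (by positivity)]
    exact_mod_cast (Nat.lt_succ_sqrt' n).le
  have hsum := Finset.card_nsmul_le_sum _ _ _ hterm
  refine le_trans ?_ hsum
  rw [nsmul_eq_mul]
  calc c * Real.exp (-1) ^ 4 / 2 ^ M = √n * (c * Real.exp (-1) ^ 4 / 2 ^ M / √n) := by field_simp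
    _ ≤ _ := by gcongr

/-- A growth bound for the weighted sums at all large radii bounds the Cesàro means. -/
theorem exists_sum_le_of_growth {N : ℕ} (hN : 2 ≤ N) {u : ℕ → ℝ} (hu : ∀ n, 0 ≤ u n) {C : ℝ}
    {l₀ : ℕ} (h : ∀ l : ℕ, l₀ ≤ l → ∀ K : ℕ,
      ∑ n ∈ Finset.range K, zonalNormSq N n * (l : ℝ) ^ (2 * n) * u n ≤
        C * (Real.exp (2 * l) / (l : ℝ) ^ ((N : ℝ) - 3 / 2))) :
    ∃ C' : ℝ, 0 < C' ∧ ∀ K : ℕ, 1 ≤ K → ∑ n ∈ Finset.range K, u n ≤ C' * K := by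
  obtain ⟨c, hc, hw⟩ := exists_window_lower_bound hN
  set n₀ := max l₀ 1
  set W : ℕ → ℕ → ℝ := fun n l => zonalNormSq N n * (l : ℝ) ^ (2 * n) *
      ((l : ℝ) ^ ((N : ℝ) - 3 / 2) * Real.exp (-(2 * l)))
  have hW : ∀ n l, 0 ≤ W n l := fun n l => by
    have := (zonalNormSq_pos hN n).le
    positivity
  have hcol : ∀ l, n₀ ≤ l → ∀ K : ℕ, ∑ n ∈ Finset.range K, u n * W n l ≤ |C| := by
    intro l hl K
    have hl1 : (0 : ℝ) < l := by
      have : 1 ≤ l := (le_max_right _ _).trans hl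
      exact_mod_cast this
    have h1 := h l ((le_max_left _ _).trans hl) K
    have h2 : ∑ n ∈ Finset.range K, u n * W n l = ((l : ℝ) ^ ((N : ℝ) - 3 / 2) *
        Real.exp (-(2 * l))) * ∑ n ∈ Finset.range K, zonalNormSq N n * (l : ℝ) ^ (2 * n) * u n := by
      rw [Finset.mul_sum]
      exact Finset.sum_congr rfl fun n _ => by simp only [W]; ring
    have hp : (0 : ℝ) < (l : ℝ) ^ ((N : ℝ) - 3 / 2) := by positivity
    rw [h2]
    calc _ ≤ ((l : ℝ) ^ ((N : ℝ) - 3 / 2) * Real.exp (-(2 * l))) *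
          (C * (Real.exp (2 * l) / (l : ℝ) ^ ((N : ℝ) - 3 / 2))) := by gcongr
      _ = C := by rw [Real.exp_neg]; field_simp
      _ ≤ |C| := le_abs_self C
  have hA : 0 ≤ ∑ n ∈ Finset.range n₀, u n := Finset.sum_nonneg fun n _ => hu n
  refine ⟨∑ n ∈ Finset.range n₀, u n + 2 * |C| / c + 1, by positivity, fun K hK => ?_⟩
  have hK' : (1 : ℝ) ≤ K := by exact_mod_cast hK
  -- Double counting in (n, l). For n < K the window ends at n + √n ≤ 2n < 2K, so fewer than 2K
  -- radii are used, and each contributes at most |C|.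
  have hmain : c * ∑ n ∈ Finset.Ico n₀ K, u n ≤ 2 * |C| * K := by
    calc c * ∑ n ∈ Finset.Ico n₀ K, u n = ∑ n ∈ Finset.Ico n₀ K, u n * c := by
          rw [Finset.mul_sum]; exact Finset.sum_congr rfl fun n _ => mul_comm _ _
      _ ≤ ∑ n ∈ Finset.Ico n₀ K, u n * ∑ l ∈ Finset.Ico n₀ (2 * K), W n l := by
          refine Finset.sum_le_sum fun n hn => mul_le_mul_of_nonneg_left ?_ (hu n)
          rw [Finset.mem_Ico] at hn
          have hn1 : 1 ≤ n := (le_max_right _ _).trans hn.1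
          refine (hw n hn1).trans (Finset.sum_le_sum_of_subset_of_nonneg ?_ fun l _ _ => hW n l)
          intro l hl
          rw [Finset.mem_Icc] at hl
          have := Nat.sqrt_le_self n
          rw [Finset.mem_Ico]
          omega
      _ = ∑ l ∈ Finset.Ico n₀ (2 * K), ∑ n ∈ Finset.Ico n₀ K, u n * W n l := by
          simp only [Finset.mul_sum]
          exact Finset.sum_comm
      _ ≤ ∑ l ∈ Finset.Ico n₀ (2 * K), |C| := by
          refine Finset.sum_le_sum fun l hl => ?_
          refine le_trans ?_ (hcol l (Finset.mem_Ico.1 hl).1 K)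
          refine Finset.sum_le_sum_of_subset_of_nonneg ?_ fun n _ _ => mul_nonneg (hu n) (hW n l)
          intro n hn
          exact Finset.mem_range.2 (Finset.mem_Ico.1 hn).2
      _ ≤ (2 * K : ℕ) * |C| := by
          rw [Finset.sum_const, Nat.card_Ico, nsmul_eq_mul]
          gcongr
          omega
      _ = 2 * |C| * K := by push_cast; ring
  have hsplit : ∑ n ∈ Finset.range K, u n ≤
      ∑ n ∈ Finset.range n₀, u n + ∑ n ∈ Finset.Ico n₀ K, u n := by
    rw [← Finset.sum_union]
    · refine Finset.sum_le_sum_of_subset_of_nonneg ?_ fun n _ _ => hu n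
      intro n hn
      simp only [Finset.mem_union, Finset.mem_range, Finset.mem_Ico] at hn ⊢
      omega
    · rw [Finset.disjoint_left]
      intro n hn hn2
      simp only [Finset.mem_range, Finset.mem_Ico] at hn hn2
      omega
  have h3 : ∑ n ∈ Finset.Ico n₀ K, u n ≤ 2 * |C| / c * K := by
    rw [div_mul_eq_mul_div, le_div_iff₀ hc]
    linarith
  nlinarith

end Asymptotics

/-! ### Upper density and bounded Cesàro means -/

section Density

theorem density_quotient_le_one (A : Set ℕ) (n : ℕ) :
    ((A ∩ Set.Icc 1 n).ncard : ℝ) / (n : ℝ) ≤ 1 := by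
  refine div_le_one_of_le₀ ?_ n.cast_nonneg
  have h := Set.ncard_le_ncard (s := A ∩ Set.Icc 1 n) (t := Set.Icc 1 n) Set.inter_subset_right
    (Set.finite_Icc 1 n)
  rw [← Finset.coe_Icc, Set.ncard_coe_finset, Nat.card_Icc] at h
  exact_mod_cast h

/-- Chebyshev: f ≥ 4C on at most a quarter of the integers up to n, and all but finitely many
elements of B are such integers. Absorbing the exceptions leaves upper density at most 1/2. -/
theorem upperDensity_ne_one_of_cesaro_bounded {f : ℕ → ℝ} (hf : ∀ n, 0 ≤ f n) {C : ℝ} (hC : 0 < C)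
    (hs : ∀ K : ℕ, 1 ≤ K → ∑ n ∈ Finset.range K, f n ≤ C * K) {B : Set ℕ}
    (hB : Tendsto f (atTop ⊓ 𝓟 B) atTop) : upperDensity B ≠ 1 := by
  have h1 := hB.eventually (eventually_ge_atTop (4 * C))
  rw [eventually_inf_principal, eventually_atTop] at h1
  obtain ⟨m, hm⟩ := h1
  have hcount : ∀ n : ℕ, 1 ≤ n → ((B ∩ Set.Icc 1 n).ncard : ℝ) ≤ m + (n + 1) / 4 := by
    classical
    intro n hn
    set S := (Finset.range (n + 1)).filter fun l => 4 * C ≤ f l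
    have hsub : B ∩ Set.Icc 1 n ⊆ (Finset.range m ∪ S : Finset ℕ) := by
      rintro l ⟨hl, hl2⟩
      simp only [Finset.coe_union, Set.mem_union, Finset.coe_range, Set.mem_Iio, S,
        Finset.coe_filter, Finset.mem_range, Set.mem_ofPred]
      rcases lt_or_ge l m with h | h
      · exact Or.inl h
      · exact Or.inr ⟨by have := hl2.2; omega, hm l h hl⟩
    have h2 := Set.ncard_le_ncard hsub (Finset.finite_toSet _)
    rw [Set.ncard_coe_finset] at h2
    have h3 := h2.trans (Finset.card_union_le _ _)
    rw [Finset.card_range] at h3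
    have h4 : (4 * C) * S.card ≤ C * ((n + 1 : ℕ) : ℝ) := by
      calc (4 * C) * S.card = ∑ l ∈ S, 4 * C := by rw [Finset.sum_const, nsmul_eq_mul, mul_comm]
        _ ≤ ∑ l ∈ S, f l := Finset.sum_le_sum fun l hl => (Finset.mem_filter.1 hl).2
        _ ≤ ∑ l ∈ Finset.range (n + 1), f l :=
            Finset.sum_le_sum_of_subset_of_nonneg (Finset.filter_subset _ _) fun l _ _ => hf l
        _ ≤ _ := hs _ (by omega)
    have h5 : (S.card : ℝ) ≤ (n + 1) / 4 := by
      rw [le_div_iff₀ (by norm_num)]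
      refine le_of_mul_le_mul_left ?_ hC
      push_cast at h4
      linarith
    have h6 : ((B ∩ Set.Icc 1 n).ncard : ℝ) ≤ m + S.card := by exact_mod_cast h3
    linarith
  have hle : upperDensity B ≤ 1 / 2 := by
    refine limsup_le_of_le ⟨0, fun a ha => ?_⟩ ?_
    · obtain ⟨n, hn⟩ := (eventually_map.1 ha).exists
      exact le_trans (by positivity) hn
    · filter_upwards [eventually_ge_atTop (4 * m + 1)] with n hn
      have hn' : (4 * m + 1 : ℝ) ≤ n := by exact_mod_cast hn
      have hm0 : (0 : ℝ) ≤ m := m.cast_nonneg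
      rw [div_le_iff₀ (by linarith)]
      have := hcount n (by omega)
      linarith
  linarith

end Density

/-! ### Series of zonal harmonics -/

section ZonalSeries

variable {N : ℕ}

/-- The harmonic function with zonal expansion coefficients `a`. -/
noncomputable def zonalSeries (k : Fin N) (a : ℕ → ℝ) (x : EuclideanSpace ℝ (Fin N)) : ℝ :=
  ∑' j, a j * zonal k j x

theorem abs_mul_zonal_le (hN : 2 ≤ N) (k : Fin N) {a : ℕ → ℝ} {D : ℝ} (ha : ∀ j, |a j| ≤ D * 2 ^ j)
    {R : ℝ} {x : EuclideanSpace ℝ (Fin N)} (hx : ‖x‖ ≤ R) (j : ℕ) :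
    |a j * zonal k j x| ≤ D * ((6 * R) ^ j / j.factorial) := by
  have hD : 0 ≤ D := by simpa using (abs_nonneg _).trans (ha 0)
  rw [abs_mul]
  calc |a j| * |zonal k j x| ≤ (D * 2 ^ j) * ((3 * ‖x‖) ^ j / j.factorial) :=
        mul_le_mul (ha j) (abs_zonal_le hN k x j) (abs_nonneg _) (by positivity)
    _ ≤ (D * 2 ^ j) * ((3 * R) ^ j / j.factorial) := by gcongr
    _ = D * ((6 * R) ^ j / j.factorial) := by
        rw [show 6 * R = 2 * (3 * R) by ring, mul_pow 2 (3 * R)]; ring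

theorem summable_zonalSeries (hN : 2 ≤ N) (k : Fin N) {a : ℕ → ℝ} {D : ℝ}
    (ha : ∀ j, |a j| ≤ D * 2 ^ j) (x : EuclideanSpace ℝ (Fin N)) :
    Summable fun j => a j * zonal k j x :=
  .of_norm_bounded ((Real.summable_pow_div_factorial (6 * ‖x‖)).mul_left D)
    fun j => abs_mul_zonal_le hN k ha le_rfl j

theorem tendstoUniformlyOn_zonalSeries (hN : 2 ≤ N) (k : Fin N) {a : ℕ → ℝ} {D : ℝ}
    (ha : ∀ j, |a j| ≤ D * 2 ^ j) (R : ℝ) :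
    TendstoUniformlyOn (fun n x => ∑ j ∈ Finset.range n, a j * zonal k j x) (zonalSeries k a) atTop
      (Metric.closedBall 0 R) :=
  tendstoUniformlyOn_tsum_nat ((Real.summable_pow_div_factorial (6 * R)).mul_left D)
    fun j _ hx => abs_mul_zonal_le hN k ha (by simpa using hx) j

theorem continuous_zonalSeries (hN : 2 ≤ N) (k : Fin N) {a : ℕ → ℝ} {D : ℝ}
    (ha : ∀ j, |a j| ≤ D * 2 ^ j) : Continuous (zonalSeries k a) := by
  have hzc := fun j => (contDiff_zonal k 1 j).continuous
  rw [continuous_iff_continuousAt]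
  intro x
  have h := (tendstoUniformlyOn_zonalSeries hN k ha (‖x‖ + 1)).continuousOn
    (Frequently.of_forall fun n => (show Continuous _ by fun_prop).continuousOn)
  exact h.continuousAt (Metric.closedBall_mem_nhds_of_mem (by simp))

theorem contDiff_sum_zonal (k : Fin N) (a : ℕ → ℝ) (n : ℕ) :
    ContDiff ℝ 2 fun x => ∑ j ∈ Finset.range n, a j * zonal k j x :=
  ContDiff.sum fun j _ => contDiff_const.mul (contDiff_zonal k 2 j)

theorem partialDeriv_sum_zonal (i k : Fin N) (a : ℕ → ℝ) (n : ℕ) :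
    partialDeriv i (fun x => ∑ j ∈ Finset.range n, a j * zonal k j x) =
      fun x => ∑ j ∈ Finset.range n, a j * partialDeriv i (zonal k j) x := by
  have hd := fun j => (contDiff_zonal k 1 j).differentiable one_ne_zero
  induction n with
  | zero => simp only [Finset.range_zero, Finset.sum_empty, partialDeriv_const]
  | succ n ih =>
    simp only [Finset.sum_range_succ]
    rw [partialDeriv_add ((contDiff_sum_zonal k a n).differentiable two_ne_zero)
      ((hd n).const_mul _), ih, partialDeriv_const_mul (hd n)]

theorem isHarmonicOnSpace_sum_zonal (hN : 2 ≤ N) (k : Fin N) (a : ℕ → ℝ) (n : ℕ) :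
    IsHarmonicOnSpace fun x => ∑ j ∈ Finset.range n, a j * zonal k j x := by
  refine isHarmonicOnSpace_iff.2 ⟨contDiff_sum_zonal k a n, fun x => ?_⟩
  have hp := fun i j => (contDiff_partialDeriv (n := 2) (m := 1) (contDiff_zonal k 2 j)
    (by norm_num) i).differentiable one_ne_zero
  induction n with
  | zero => simp only [Finset.range_zero, Finset.sum_empty, lap_const]
  | succ n ih =>
    simp only [Finset.sum_range_succ]
    have := lap_sub (contDiff_sum_zonal k a n)
      (contDiff_const.mul (contDiff_zonal k 2 n) : ContDiff ℝ 2 fun x => -a n * zonal k n x) x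
    rw [ih, lap_const_mul (contDiff_zonal k 2 n), lap_zonal hN, mul_zero, sub_zero] at this
    rw [← this]
    congr 1
    ext y
    ring

theorem isHarmonicOnSpace_zonalSeries (hN : 2 ≤ N) (k : Fin N) {a : ℕ → ℝ} {D : ℝ}
    (ha : ∀ j, |a j| ≤ D * 2 ^ j) : IsHarmonicOnSpace (zonalSeries k a) :=
  (isHarmonicOnSpace_of_tendsto hN (isHarmonicOnSpace_sum_zonal hN k a)
    (continuous_zonalSeries hN k ha) (tendstoUniformlyOn_zonalSeries hN k ha)).1

/-- The class of sequences bounded by D 2^j is stable under shifts, hence the series class is stable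
under T. -/
theorem abs_shift_le {a : ℕ → ℝ} {D : ℝ} (ha : ∀ j, |a j| ≤ D * 2 ^ j) (n j : ℕ) :
    |a (j + n)| ≤ D * 2 ^ n * 2 ^ j :=
  (ha (j + n)).trans (le_of_eq (by ring))

theorem partialDeriv_zonalSeries (hN : 2 ≤ N) (k : Fin N) {a : ℕ → ℝ} {D : ℝ}
    (ha : ∀ j, |a j| ≤ D * 2 ^ j) :
    partialDeriv k (zonalSeries k a) = zonalSeries k fun j => a (j + 1) := by
  ext x
  have h1 := (isHarmonicOnSpace_of_tendsto hN (isHarmonicOnSpace_sum_zonal hN k a)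
    (continuous_zonalSeries hN k ha) (tendstoUniformlyOn_zonalSeries hN k ha)).2 k x
  have h2 := (summable_zonalSeries hN k (abs_shift_le ha 1) x).hasSum.tendsto_sum_nat
  refine tendsto_nhds_unique ((tendsto_add_atTop_iff_nat 1).2 h1) (h2.congr fun n => ?_)
  rw [partialDeriv_sum_zonal]
  beta_reduce
  rw [Finset.sum_range_succ', partialDeriv_zonal_zero]
  simp [partialDeriv_zonal_succ hN]

theorem iterate_partialDeriv_zonalSeries (hN : 2 ≤ N) (k : Fin N) {a : ℕ → ℝ} {D : ℝ}
    (ha : ∀ j, |a j| ≤ D * 2 ^ j) (n : ℕ) :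
    (partialDeriv k)^[n] (zonalSeries k a) = zonalSeries k fun j => a (j + n) := by
  induction n with
  | zero => rfl
  | succ n ih =>
    rw [Function.iterate_succ_apply', ih, partialDeriv_zonalSeries hN k (abs_shift_le ha n)]
    congr 1
    ext j
    rw [add_right_comm, add_assoc]

theorem toSphere_real_univ_pos (hN : 2 ≤ N) :
    0 < (volume : Measure (EuclideanSpace ℝ (Fin N))).toSphere.real Set.univ := by
  have := nontrivial_euclideanSpace hN
  rw [measureReal_def]
  refine ENNReal.toReal_pos ?_ (measure_ne_top _ _)
  exact Measure.measure_univ_ne_zero.2 (Measure.toSphere_ne_zero _)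

theorem M₂_eq (h : EuclideanSpace ℝ (Fin N) → ℝ) (r : ℝ) : M₂ h r =
    √(((volume : Measure (EuclideanSpace ℝ (Fin N))).toSphere.real Set.univ)⁻¹ *
      ∫ y : Metric.sphere (0 : EuclideanSpace ℝ (Fin N)) 1,
        h (r • (y : EuclideanSpace ℝ (Fin N))) ^ 2
          ∂(volume : Measure (EuclideanSpace ℝ (Fin N))).toSphere) := by
  rw [M₂, average_eq]
  simp only [sq_abs, smul_eq_mul]

/-- Orthogonality evaluates the partial sums exactly; dominated convergence on the sphere passes the
bound to the series. -/
theorem M₂_zonalSeries_le (hN : 2 ≤ N) (k : Fin N) {a : ℕ → ℝ} {D : ℝ}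
    (ha : ∀ j, |a j| ≤ D * 2 ^ j) {r B : ℝ} (hB : 0 ≤ B)
    (h : ∀ K, ∑ j ∈ Finset.range K, zonalNormSq N j * (r ^ j * a j) ^ 2 ≤ B ^ 2) :
    M₂ (zonalSeries k a) r ≤ B := by
  have hS := toSphere_real_univ_pos hN
  set σ := (volume : Measure (EuclideanSpace ℝ (Fin N))).toSphere
  have hzc := fun j => (contDiff_zonal k 1 j).continuous
  set u : ℕ → ℝ := fun j => D * ((6 * |r|) ^ j / j.factorial)
  have hu : Summable u := (Real.summable_pow_div_factorial (6 * |r|)).mul_left D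
  have hnorm : ∀ y : Metric.sphere (0 : EuclideanSpace ℝ (Fin N)) 1,
      ‖r • (y : EuclideanSpace ℝ (Fin N))‖ ≤ |r| := fun y => by simp [norm_smul]
  have hu0 : ∀ j, 0 ≤ u j := fun j => by
    have hD : 0 ≤ D := by simpa using (abs_nonneg _).trans (ha 0)
    positivity
  have hlim : Tendsto (fun K => ∫ y : Metric.sphere (0 : EuclideanSpace ℝ (Fin N)) 1,
      (∑ j ∈ Finset.range K, a j * zonal k j (r • (y : EuclideanSpace ℝ (Fin N)))) ^ 2 ∂σ) atTop
      (𝓝 (∫ y : Metric.sphere (0 : EuclideanSpace ℝ (Fin N)) 1,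
        zonalSeries k a (r • (y : EuclideanSpace ℝ (Fin N))) ^ 2 ∂σ)) := by
    refine tendsto_integral_of_dominated_convergence (fun _ => (∑' j, u j) ^ 2) (fun K => ?_)
      (integrable_const _) (fun K => .of_forall fun y => ?_) (.of_forall fun y => ?_)
    · exact (show Continuous _ by fun_prop).aestronglyMeasurable
    · rw [norm_pow]
      gcongr
      refine (norm_sum_le _ _).trans ((Finset.sum_le_sum fun j _ => ?_).trans
        (hu.sum_le_tsum (Finset.range K) fun j _ => hu0 j))
      exact abs_mul_zonal_le hN k ha (hnorm y) j
    · exact ((summable_zonalSeries hN k ha _).hasSum.tendsto_sum_nat).pow 2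
  have hle : ∫ y : Metric.sphere (0 : EuclideanSpace ℝ (Fin N)) 1,
        zonalSeries k a (r • (y : EuclideanSpace ℝ (Fin N))) ^ 2 ∂σ ≤ σ.real Set.univ * B ^ 2 := by
    refine le_of_tendsto' hlim fun K => ?_
    have e : ∀ y : Metric.sphere (0 : EuclideanSpace ℝ (Fin N)) 1,
        ∑ j ∈ Finset.range K, a j * zonal k j (r • (y : EuclideanSpace ℝ (Fin N))) =
        ∑ j ∈ Finset.range K, (r ^ j * a j) * zonal k j y := fun y =>
      Finset.sum_congr rfl fun j _ => by rw [zonal_smul]; ring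
    simp only [e]
    rw [integral_sphere_sum_zonal_sq hN]
    exact mul_le_mul_of_nonneg_left (h K) hS.le
  rw [M₂_eq]
  refine Real.sqrt_le_iff.2 ⟨hB, ?_⟩
  rw [inv_mul_le_iff₀ hS]
  exact hle

end ZonalSeries

/-! ### The seminorms -/

section SphereSup

variable {N : ℕ}

theorem le_sphereSup {f : EuclideanSpace ℝ (Fin N) → ℝ} (hf : Continuous f) (m : ℕ)
    {x : EuclideanSpace ℝ (Fin N)} (hx : ‖x‖ = m + 1) : |f x| ≤ sphereSup m f := by
  have hb : BddAbove (Set.range fun x : Metric.sphere (0 : EuclideanSpace ℝ (Fin N)) ((m : ℝ) + 1) =>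
      |f (x : EuclideanSpace ℝ (Fin N))|) :=
    (isCompact_range (by fun_prop)).bddAbove
  exact le_ciSup hb ⟨x, by simpa using hx⟩

theorem sphereSup_nonneg (f : EuclideanSpace ℝ (Fin N) → ℝ) (m : ℕ) : 0 ≤ sphereSup m f :=
  Real.iSup_nonneg fun _ => abs_nonneg _

theorem sphereSup_le {f : EuclideanSpace ℝ (Fin N) → ℝ} {m : ℕ} {B : ℝ} (hB : 0 ≤ B)
    (h : ∀ x, ‖x‖ = m + 1 → |f x| ≤ B) : sphereSup m f ≤ B :=
  Real.iSup_le (fun x => h x (by simp)) hB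

end SphereSup

/-! ### Blocks of rapidly growing length -/

section Blocks

/-- Consecutive blocks `[L i, L (i + 1))` of rapidly growing lengths, and the index of the block of
each natural number. -/
structure BlockDecomposition (L ι : ℕ → ℕ) : Prop where
  growth : ∀ i, (i + 1) * (L i + i + 1) ≤ L (i + 1)
  le_self : ∀ n, L (ι n) ≤ n
  lt_succ : ∀ n, n < L (ι n + 1)

variable {L ι : ℕ → ℕ}

theorem exists_blockDecomposition (t : ℕ → ℕ) :
    ∃ L ι : ℕ → ℕ, BlockDecomposition L ι ∧ ∀ i, t (i + 1) ≤ L (i + 1) := by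
  obtain ⟨L, hL0, hL⟩ : ∃ L : ℕ → ℕ, L 0 = 0 ∧
      ∀ i, L (i + 1) = max (t (i + 1)) ((i + 1) * (L i + i + 1)) :=
    -- The second entry of the maximum forces the growth; the first delays each new block as long as
    -- prescribed by t.
    ⟨fun i => Nat.rec (motive := fun _ => ℕ) 0
      (fun i l => max (t (i + 1)) ((i + 1) * (l + i + 1))) i, rfl, fun _ => rfl⟩
  have hg : ∀ i, (i + 1) * (L i + i + 1) ≤ L (i + 1) := fun i => (hL i).symm ▸ le_max_right _ _
  have hm : StrictMono L := strictMono_nat_of_lt_succ fun i => by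
    have := hg i
    nlinarith
  refine ⟨L, fun n : ℕ => Nat.findGreatest (fun i => L i ≤ n) n, ⟨hg, fun n => ?_, fun n => ?_⟩,
    fun i => (hL i).symm ▸ le_max_left _ _⟩
  · exact Nat.findGreatest_spec (P := fun i => L i ≤ n) (n := n) (m := 0) (Nat.zero_le _)
      (by rw [hL0]; exact Nat.zero_le _)
  · by_contra! h
    have := Nat.le_findGreatest (P := fun i => L i ≤ n) (n := n)
      (m := Nat.findGreatest (fun i => L i ≤ n) n + 1) ((hm.le_apply).trans h) h
    omega

namespace BlockDecomposition

theorem strictMono (h : BlockDecomposition L ι) : StrictMono L :=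
  strictMono_nat_of_lt_succ fun i => by
    have := h.growth i
    nlinarith

theorem index_lt_iff (h : BlockDecomposition L ι) {n i : ℕ} : ι n < i ↔ n < L i := by
  constructor
  · intro hi
    exact (h.lt_succ n).trans_le (h.strictMono.monotone hi)
  · intro hi
    exact h.strictMono.lt_iff_lt.1 ((h.le_self n).trans_lt hi)

theorem le_index_iff (h : BlockDecomposition L ι) {n i : ℕ} : i ≤ ι n ↔ L i ≤ n := by
  rw [← not_lt, h.index_lt_iff, not_lt]

theorem index_le (h : BlockDecomposition L ι) (n : ℕ) : ι n ≤ n :=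
  h.strictMono.le_apply.trans (h.le_self n)

/-- Each block is nonempty, so one step raises the index by at most one. -/
theorem index_add_le (h : BlockDecomposition L ι) (n j : ℕ) : ι (n + j) ≤ ι n + j := by
  rw [← Nat.lt_succ_iff, h.index_lt_iff]
  have : ∀ j, L (ι n + 1) + j ≤ L (ι n + 1 + j) := by
    intro j
    induction j with
    | zero => rfl
    | succ j ih => exact Nat.succ_le_of_lt (ih.trans_lt (h.strictMono (Nat.lt_succ_self _)))
  have h2 := this j
  have h1 := h.lt_succ n
  rw [show (ι n + j).succ = ι n + 1 + j by omega]
  omega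

theorem index_eq (h : BlockDecomposition L ι) {n i : ℕ} (h1 : L i ≤ n) (h2 : n < L (i + 1)) :
    ι n = i :=
  le_antisymm (Nat.lt_succ_iff.1 (h.index_lt_iff.2 h2)) (h.le_index_iff.2 h1)

theorem tendsto_index (h : BlockDecomposition L ι) : Tendsto ι atTop atTop :=
  tendsto_atTop_atTop.2 fun i => ⟨L i, fun _ hn => h.le_index_iff.2 hn⟩

end BlockDecomposition

theorem upperDensity_eq_one {A : Set ℕ} (h : ∀ ε : ℝ, 0 < ε → ∃ᶠ n : ℕ in atTop,
    1 - ε ≤ ((A ∩ Set.Icc 1 n).ncard : ℝ) / (n : ℝ)) : upperDensity A = 1 := by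
  have hbdd : IsBoundedUnder (· ≤ ·) atTop
      fun n : ℕ => ((A ∩ Set.Icc 1 n).ncard : ℝ) / (n : ℝ) :=
    isBoundedUnder_of ⟨1, density_quotient_le_one A⟩
  refine le_antisymm (limsup_le_of_le ⟨0, fun a ha => ?_⟩ (.of_forall (density_quotient_le_one A)))
    (le_of_forall_sub_le fun ε hε => le_limsup_of_frequently_le (h ε hε) hbdd)
  obtain ⟨n, hn⟩ := (eventually_map.1 ha).exists
  exact le_trans (by positivity) hn

/-- A set which contains nearly all of infinitely many blocks has upper density one. -/
theorem BlockDecomposition.upperDensity_eq_one (h : BlockDecomposition L ι) {A : Set ℕ}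
    (hA : ∃ᶠ i in atTop, ∀ n, L i ≤ n → n + i < L (i + 1) → n ∈ A) : upperDensity A = 1 := by
  refine _root_.upperDensity_eq_one fun ε hε => ?_
  rw [frequently_atTop] at hA ⊢
  intro m
  obtain ⟨q, hq⟩ := exists_nat_gt (1 / ε)
  obtain ⟨i, hi, hiA⟩ := hA (max m q)
  have hgrow := h.growth i
  have hLi : i ≤ L i := h.strictMono.le_apply
  have hle : L i + i + 1 ≤ L (i + 1) := by nlinarith
  -- Measure density at the end of block i: at most L i + i + 1 integers are missed (the earlier
  -- ones and the last i of the block), a proportion of at most 1/(i+1) by `growth`.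
  refine ⟨L (i + 1), by have := le_max_left m q; omega, ?_⟩
  have hsub : ((Finset.Ico (L i + 1) (L (i + 1) - i) : Finset ℕ) : Set ℕ) ⊆
      A ∩ Set.Icc 1 (L (i + 1)) := by
    intro n hn
    rw [Finset.coe_Ico, Set.mem_Ico] at hn
    exact ⟨hiA n (by omega) (by omega), by omega, by omega⟩
  have hcard := Set.ncard_le_ncard hsub ((Set.finite_Icc 1 (L (i + 1))).subset
    Set.inter_subset_right)
  rw [Set.ncard_coe_finset, Nat.card_Ico] at hcard
  have hcard2 : (L (i + 1) : ℝ) - (L i + i + 1) ≤ ((A ∩ Set.Icc 1 (L (i + 1))).ncard : ℝ) := by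
    have : L (i + 1) ≤ (A ∩ Set.Icc 1 (L (i + 1))).ncard + (L i + i + 1) := by omega
    have : (L (i + 1) : ℝ) ≤ ((A ∩ Set.Icc 1 (L (i + 1))).ncard : ℝ) + (L i + i + 1) := by
      exact_mod_cast this
    linarith
  have hpos : (0 : ℝ) < L (i + 1) := by
    have : 0 < L (i + 1) := by omega
    exact_mod_cast this
  rw [le_div_iff₀ hpos]
  have hg' : ((i : ℝ) + 1) * (L i + i + 1) ≤ L (i + 1) := by exact_mod_cast hgrow
  have hqi : (q : ℝ) ≤ i := by exact_mod_cast (le_max_right m q).trans hi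
  have hε1 : 1 ≤ ε * (i + 1) := by
    rw [div_lt_iff₀ hε] at hq
    nlinarith
  have hc0 : (0 : ℝ) ≤ (L i : ℝ) + i + 1 := by positivity
  have : (L i : ℝ) + i + 1 ≤ ε * L (i + 1) := by
    calc (L i : ℝ) + i + 1 ≤ (ε * (i + 1)) * (L i + i + 1) := by nlinarith
      _ = ε * ((i + 1) * (L i + i + 1)) := by ring
      _ ≤ _ := by gcongr
  linarith

end Blocks

/-! ### The irregular function of slow growth -/

section Existence

variable {N : ℕ} {L ι : ℕ → ℕ}

/-- The coefficients which are equal to the index of the block on odd blocks, and vanish on even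
blocks. -/
noncomputable def blockCoeff (ι : ℕ → ℕ) (j : ℕ) : ℝ :=
  open Classical in if Odd (ι j) then (ι j : ℝ) else 0

theorem blockCoeff_nonneg (ι : ℕ → ℕ) (j : ℕ) : 0 ≤ blockCoeff ι j := by
  unfold blockCoeff; split_ifs <;> positivity

theorem blockCoeff_le (ι : ℕ → ℕ) (j : ℕ) : blockCoeff ι j ≤ ι j := by
  unfold blockCoeff; split_ifs
  · exact le_rfl
  · positivity

theorem abs_blockCoeff_le (h : BlockDecomposition L ι) (j : ℕ) : |blockCoeff ι j| ≤ 1 * 2 ^ j := by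
  rw [abs_of_nonneg (blockCoeff_nonneg ι j), one_mul]
  refine (blockCoeff_le ι j).trans ?_
  exact_mod_cast (h.index_le j).trans Nat.lt_two_pow_self.le

/-- At the unit axis point all terms of the shifted series are nonnegative, and its constant term is
the n-th coefficient. -/
theorem le_sphereSup_iterate (hN : 2 ≤ N) (k : Fin N) (h : BlockDecomposition L ι) (n : ℕ) :
    blockCoeff ι n ≤ sphereSup 0 ((partialDeriv k)^[n] (zonalSeries k (blockCoeff ι))) := by
  have ha := abs_blockCoeff_le h
  rw [iterate_partialDeriv_zonalSeries hN k ha]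
  refine le_trans ?_ (le_sphereSup (continuous_zonalSeries hN k (abs_shift_le ha n)) 0
    (x := EuclideanSpace.single k 1) (by simp))
  refine le_trans ?_ (le_abs_self _)
  have hs := summable_zonalSeries hN k (abs_shift_le ha n) (EuclideanSpace.single k 1)
  have := hs.le_tsum 0 fun j _ => by
    rw [zonal_axis hN]
    exact mul_nonneg (blockCoeff_nonneg _ _) (by positivity)
  simpa [zonal, zonalSeries] using this

theorem distributionallyUnbounded_zonalSeries (hN : 2 ≤ N) (k : Fin N)
    (h : BlockDecomposition L ι) :
    OrbitDistributionallyUnbounded sphereSup (partialDeriv k) (zonalSeries k (blockCoeff ι)) := by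
  refine ⟨0, {n | Odd (ι n)}, h.upperDensity_eq_one ?_, ?_⟩
  · refine frequently_atTop.2 fun m => ⟨2 * m + 1, by omega, fun n h1 h2 => ?_⟩
    rw [Set.mem_ofPred_eq, h.index_eq h1 (by omega)]
    exact odd_two_mul_add_one m
  · have h1 : Tendsto (fun n => (ι n : ℝ)) (atTop ⊓ 𝓟 {n | Odd (ι n)}) atTop :=
      (tendsto_natCast_atTop_atTop.comp h.tendsto_index).mono_left inf_le_left
    refine tendsto_atTop_mono' _ ?_ h1
    filter_upwards [mem_inf_of_right (mem_principal_self _)] with n hn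
    have := le_sphereSup_iterate hN k h n
    rwa [blockCoeff, if_pos hn] at this

theorem summable_nat_mul_pow_div_factorial (x : ℝ) :
    Summable fun j : ℕ => (2 * j : ℝ) * (x ^ j / j.factorial) := by
  refine .of_norm_bounded ((Real.summable_pow_div_factorial (2 * |x|)).mul_left 2) fun j => ?_
  rw [norm_mul, norm_div, norm_pow, Real.norm_eq_abs, Real.norm_eq_abs, Real.norm_eq_abs,
    abs_of_nonneg (by positivity), abs_of_nonneg (by positivity : (0 : ℝ) ≤ (j.factorial : ℝ)),
    mul_pow]
  have : (j : ℝ) ≤ 2 ^ j := by exact_mod_cast Nat.lt_two_pow_self.le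
  calc 2 * (j : ℝ) * (|x| ^ j / j.factorial) ≤ 2 * 2 ^ j * (|x| ^ j / j.factorial) := by gcongr
    _ = _ := by ring

/-- The first ι n shifted coefficients still lie in the even block of n, hence vanish. For j ≥ ι n
the coefficient is at most ι(n+j) ≤ ι n + j ≤ 2j, leaving the tail from ι n of a fixed convergent
series. -/
theorem sphereSup_iterate_le (hN : 2 ≤ N) (k : Fin N) (h : BlockDecomposition L ι) (m n : ℕ)
    (he : Even (ι n)) (hn : n + ι n < L (ι n + 1)) :
    sphereSup m ((partialDeriv k)^[n] (zonalSeries k (blockCoeff ι))) ≤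
      ∑' j : ℕ, (2 * ((j + ι n : ℕ) : ℝ)) *
        ((3 * ((m : ℝ) + 1)) ^ (j + ι n) / (j + ι n).factorial) := by
  have ha := abs_blockCoeff_le h
  rw [iterate_partialDeriv_zonalSeries hN k ha]
  refine sphereSup_le (tsum_nonneg fun j => by positivity) fun x hx => ?_
  have hs := summable_zonalSeries hN k (abs_shift_le ha n) x
  rw [zonalSeries, ← hs.sum_add_tsum_nat_add (ι n), Finset.sum_eq_zero, zero_add]
  · have hv := (summable_nat_add_iff (ι n)).2 (summable_nat_mul_pow_div_factorial (3 * ((m : ℝ) + 1)))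
    rw [← Real.norm_eq_abs]
    refine tsum_of_norm_bounded hv.hasSum fun j => ?_
    rw [norm_mul, Real.norm_eq_abs, Real.norm_eq_abs, abs_of_nonneg (blockCoeff_nonneg _ _)]
    have h1 := abs_zonal_le hN k x (j + ι n)
    rw [hx] at h1
    refine mul_le_mul ?_ h1 (abs_nonneg _) (by positivity)
    refine (blockCoeff_le _ _).trans ?_
    have := h.index_add_le n (j + ι n)
    rw [add_comm n] at this
    have h2 : ι (j + ι n + n) ≤ 2 * (j + ι n) := by omega
    exact_mod_cast h2
  · intro j hj
    rw [Finset.mem_range] at hj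
    have h1 : ι (j + n) = ι n :=
      h.index_eq ((h.le_self n).trans (by omega)) (by omega)
    rw [blockCoeff, h1, if_neg (Nat.not_odd_iff_even.2 he), zero_mul]

theorem distributionallyNearZero_zonalSeries (hN : 2 ≤ N) (k : Fin N)
    (h : BlockDecomposition L ι) :
    OrbitDistributionallyNearZero sphereSup (partialDeriv k) (zonalSeries k (blockCoeff ι)) := by
  refine ⟨{n | Even (ι n) ∧ n + ι n < L (ι n + 1)}, h.upperDensity_eq_one ?_, fun m => ?_⟩
  · refine frequently_atTop.2 fun m => ⟨2 * m, by omega, fun n h1 h2 => ?_⟩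
    rw [Set.mem_ofPred_eq, h.index_eq h1 (by omega)]
    exact ⟨even_two_mul m, h2⟩
  · have h1 := (tendsto_sum_nat_add
      (fun j : ℕ => (2 * (j : ℝ)) * ((3 * ((m : ℝ) + 1)) ^ j / j.factorial))).comp h.tendsto_index
    refine squeeze_zero' (.of_forall fun n => sphereSup_nonneg _ m) ?_ (h1.mono_left inf_le_left)
    filter_upwards [mem_inf_of_right (mem_principal_self _)] with n hn
    exact sphereSup_iterate_le hN k h m n hn.1 hn.2

/-- The t found here decides how late a block must start. The weight j² covers any coefficient,
since a block index never exceeds j. -/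
theorem exists_tail_le (hN : 2 ≤ N) (R : ℝ) : ∃ t : ℕ, ∀ K : ℕ,
    ∑ j ∈ Finset.Ico t K, zonalNormSq N j * ((j : ℝ) ^ 2 * R ^ (2 * j)) ≤ 1 := by
  obtain ⟨_, C, _, hC, hb⟩ := exists_zonalNormSq_bounds hN
  have hnn : ∀ j : ℕ, 0 ≤ zonalNormSq N j * ((j : ℝ) ^ 2 * R ^ (2 * j)) := fun j => by
    have := (zonalNormSq_pos hN j).le
    rw [pow_mul]
    positivity
  have hs : Summable fun j : ℕ => zonalNormSq N j * ((j : ℝ) ^ 2 * R ^ (2 * j)) := by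
    refine .of_nonneg_of_le hnn (fun j => ?_)
      ((Real.summable_pow_div_factorial (4 * R ^ 2)).mul_left C)
    have h1 : (j : ℝ) ≤ 2 ^ j := by exact_mod_cast Nat.lt_two_pow_self.le
    have h2 : zonalNormSq N j ≤ C / j.factorial := by
      rw [le_div_iff₀ (by positivity)]
      refine le_trans ?_ (hb j).2
      have hq := (zonalNormSq_pos hN j).le
      have hf : (1 : ℝ) ≤ j.factorial := by exact_mod_cast Nat.factorial_pos j
      have hj : (1 : ℝ) ≤ ((j : ℝ) + 1) ^ (N - 2) :=
        one_le_pow₀ (by linarith [(j.cast_nonneg : (0 : ℝ) ≤ j)])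
      refine mul_le_mul_of_nonneg_left ?_ hq
      nlinarith
    have hRp : 0 ≤ R ^ (2 * j) := by rw [pow_mul]; positivity
    calc zonalNormSq N j * ((j : ℝ) ^ 2 * R ^ (2 * j))
        ≤ C / j.factorial * ((2 ^ j) ^ 2 * R ^ (2 * j)) := by
          gcongr
      _ = C * ((4 * R ^ 2) ^ j / j.factorial) := by
          rw [mul_pow, ← pow_mul, mul_comm j 2, pow_mul 2 2 j, ← pow_mul R]
          norm_num
          ring
  have hev := (tendsto_order.1 hs.hasSum.tendsto_sum_nat).1
    (∑' j : ℕ, zonalNormSq N j * ((j : ℝ) ^ 2 * R ^ (2 * j)) - 1) (by linarith)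
  obtain ⟨t, ht⟩ := hev.exists
  refine ⟨t, fun K => ?_⟩
  rcases le_total t K with htK | htK
  · rw [Finset.sum_Ico_eq_sub _ htK]
    have := hs.sum_le_tsum (Finset.range K) fun j _ => hnn j
    linarith
  · rw [Finset.Ico_eq_empty_of_le htK, Finset.sum_empty]
    exact zero_le_one

theorem exists_distributionallyIrregular (hN : 2 ≤ N) (k : Fin N) {φ : ℝ → ℝ}
    (hφ : Tendsto φ atTop atTop) :
    ∃ h : EuclideanSpace ℝ (Fin N) → ℝ, IsHarmonicOnSpace h ∧
      DistributionallyIrregular sphereSup (partialDeriv k) h ∧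
      ∀ᶠ r : ℝ in atTop, M₂ h r ≤ φ r * (Real.exp r / r ^ ((N : ℝ) / 2 - 3 / 4)) := by
  obtain ⟨C, hC, hsum⟩ := exists_sum_zonalNormSq_le hN
  set G : ℝ → ℝ := fun r => Real.exp r / r ^ ((N : ℝ) / 2 - 3 / 4)
  have hG : Tendsto G atTop atTop := tendsto_exp_div_rpow_atTop _
  -- From R_i on, φ pays for coefficients up to i; the extra 1 under the root pays for the tail,
  -- thanks to G ≥ 1.
  have hR : ∀ i : ℕ, ∃ R : ℝ, (i : ℝ) ≤ R ∧ ∀ r, R ≤ r →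
      0 < r ∧ 1 ≤ G r ∧ √(C * (i : ℝ) ^ 2 + 1) ≤ φ r := by
    intro i
    have hev := (eventually_gt_atTop (0 : ℝ)).and ((hG.eventually (eventually_ge_atTop 1)).and
      (hφ.eventually (eventually_ge_atTop (√(C * (i : ℝ) ^ 2 + 1)))))
    obtain ⟨R, hR⟩ := eventually_atTop.1 hev
    exact ⟨max i R, le_max_left _ _, fun r hr => hR r ((le_max_right _ _).trans hr)⟩
  choose R hiR hRr using hR
  choose t ht using fun i => exists_tail_le hN (R i)
  obtain ⟨L, ι, hB, hL⟩ := exists_blockDecomposition t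
  have ha := abs_blockCoeff_le hB
  refine ⟨zonalSeries k (blockCoeff ι), isHarmonicOnSpace_zonalSeries hN k ha,
    ⟨distributionallyUnbounded_zonalSeries hN k hB, distributionallyNearZero_zonalSeries hN k hB⟩, ?_⟩
  filter_upwards [eventually_ge_atTop (R 0)] with r hr
  classical
  -- Taking the least such i gives R_i ≤ r < R_(i+1) without R being monotone.
  have hex : ∃ i : ℕ, r < R (i + 1) := by
    obtain ⟨i, hi⟩ := exists_nat_gt r
    exact ⟨i, hi.trans_le ((by exact_mod_cast Nat.le_succ i : (i : ℝ) ≤ (i + 1 : ℕ)).trans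
      (hiR (i + 1)))⟩
  set i := Nat.find hex
  have hi1 : r < R (i + 1) := Nat.find_spec hex
  have hi0 : R i ≤ r := by
    rcases Nat.eq_zero_or_pos i with h0 | h0
    · rw [h0]; exact hr
    · have := Nat.find_min hex (m := i - 1) (by omega)
      rw [Nat.sub_add_cancel h0] at this
      exact not_lt.1 this
  obtain ⟨hr0, hG1, hφr⟩ := hRr i r hi0
  have hφ0 : 0 ≤ φ r := (Real.sqrt_nonneg _).trans hφr
  refine M₂_zonalSeries_le hN k ha (mul_nonneg hφ0 (zero_le_one.trans hG1)) fun K => ?_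
  -- Below L (i+1) the coefficients are at most i. From L (i+1) ≥ t (i+1) on, they are at most j and
  -- r is replaced by the larger R_(i+1), where the tail is controlled.
  have hterm : ∀ j : ℕ, zonalNormSq N j * (r ^ j * blockCoeff ι j) ^ 2 ≤
      (i : ℝ) ^ 2 * (zonalNormSq N j * r ^ (2 * j)) +
        if t (i + 1) ≤ j then zonalNormSq N j * ((j : ℝ) ^ 2 * R (i + 1) ^ (2 * j)) else 0 := by
    intro j
    have hq := (zonalNormSq_pos hN j).le
    have ha0 := blockCoeff_nonneg ι j
    have ha1 := blockCoeff_le ι j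
    have e : (r ^ j * blockCoeff ι j) ^ 2 = blockCoeff ι j ^ 2 * r ^ (2 * j) := by
      rw [mul_pow, ← pow_mul, mul_comm j 2, mul_comm]
    rw [e]
    rcases lt_or_ge j (L (i + 1)) with hj | hj
    · have h1 : (ι j : ℝ) ≤ i := by
        exact_mod_cast Nat.lt_succ_iff.1 (hB.index_lt_iff.2 hj)
      have h2 : zonalNormSq N j * (blockCoeff ι j ^ 2 * r ^ (2 * j)) ≤
          (i : ℝ) ^ 2 * (zonalNormSq N j * r ^ (2 * j)) := by
        calc zonalNormSq N j * (blockCoeff ι j ^ 2 * r ^ (2 * j))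
            ≤ zonalNormSq N j * ((i : ℝ) ^ 2 * r ^ (2 * j)) := by
              gcongr
              exact ha1.trans h1
          _ = _ := by ring
      have h3 : (0 : ℝ) ≤ if t (i + 1) ≤ j then
          zonalNormSq N j * ((j : ℝ) ^ 2 * R (i + 1) ^ (2 * j)) else 0 := by
        have := hr0.trans hi1
        split_ifs <;> positivity
      linarith
    · rw [if_pos ((hL i).trans hj)]
      have h1 : (ι j : ℝ) ≤ j := by exact_mod_cast hB.index_le j
      have h2 : zonalNormSq N j * (blockCoeff ι j ^ 2 * r ^ (2 * j)) ≤
          zonalNormSq N j * ((j : ℝ) ^ 2 * R (i + 1) ^ (2 * j)) := by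
        gcongr
        exact ha1.trans h1
      have h3 : 0 ≤ (i : ℝ) ^ 2 * (zonalNormSq N j * r ^ (2 * j)) := by positivity
      linarith
  have htail : ∑ j ∈ Finset.range K, (if t (i + 1) ≤ j then
      zonalNormSq N j * ((j : ℝ) ^ 2 * R (i + 1) ^ (2 * j)) else 0) ≤ 1 := by
    rw [← Finset.sum_filter]
    have : (Finset.range K).filter (fun j => t (i + 1) ≤ j) = Finset.Ico (t (i + 1)) K := by
      ext j
      simp only [Finset.mem_filter, Finset.mem_range, Finset.mem_Ico]
      tauto
    rw [this]
    exact ht (i + 1) K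
  calc ∑ j ∈ Finset.range K, zonalNormSq N j * (r ^ j * blockCoeff ι j) ^ 2
      ≤ (i : ℝ) ^ 2 * ∑ j ∈ Finset.range K, zonalNormSq N j * r ^ (2 * j) + 1 := by
        refine (Finset.sum_le_sum fun j _ => hterm j).trans ?_
        rw [Finset.sum_add_distrib, ← Finset.mul_sum]
        linarith
    _ ≤ (i : ℝ) ^ 2 * (C * G r ^ 2) + 1 := by
        gcongr
        exact hsum r hr0 K
    _ ≤ (C * (i : ℝ) ^ 2 + 1) * G r ^ 2 := by nlinarith
    _ ≤ φ r ^ 2 * G r ^ 2 := by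
        gcongr
        exact (Real.sqrt_le_left hφ0).1 hφr
    _ = (φ r * G r) ^ 2 := (mul_pow _ _ _).symm

end Existence

/-! ### Averaging shifted spheres by rotation invariance -/

section Rotation

variable {E : Type*} [NormedAddCommGroup E] [InnerProductSpace ℝ E]
  [MeasurableSpace E] [BorelSpace E]

theorem measurableSet_cap (ρ R : ℝ) (z : E) :
    MeasurableSet {y : Metric.sphere (0 : E) 1 | ‖z - ρ • (y : E)‖ ≤ R} :=
  (isClosed_le (by fun_prop) continuous_const).measurableSet

variable [FiniteDimensional ℝ E]

theorem measurableSet_prod_cap (ρ R : ℝ) : MeasurableSet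
    {p : E × Metric.sphere (0 : E) 1 | ‖p.1 - ρ • (p.2 : E)‖ ≤ R} :=
  (isClosed_le (by fun_prop) continuous_const).measurableSet

/-- The surface measure of the part of the sphere of radius `ρ` about `0` at distance at most `R`
from `z`, scaled to the unit sphere. -/
noncomputable def capMeasure (ρ R : ℝ) (z : E) : ENNReal :=
  (volume : Measure E).toSphere {y : Metric.sphere (0 : E) 1 | ‖z - ρ • (y : E)‖ ≤ R}

open scoped Pointwise in
theorem capMeasure_map (ρ R : ℝ) (U : E ≃ₗᵢ[ℝ] E) (z : E) :
    capMeasure ρ R (U z) = capMeasure ρ R z := by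
  -- Surface measure is a multiple of the volume of the cone over the set; a linear isometry carries
  -- one cone onto the other.
  rw [capMeasure, capMeasure, Measure.toSphere_apply' _ (measurableSet_cap ρ R _),
    Measure.toSphere_apply' _ (measurableSet_cap ρ R _)]
  congr 1
  rw [← U.measurePreserving.measure_preimage_emb U.toHomeomorph.measurableEmbedding]
  congr 1
  ext x
  simp only [Set.mem_preimage, Set.mem_smul, Set.mem_image, Set.mem_ofPred_eq]
  constructor
  · rintro ⟨t, ht, _, ⟨y, hy, rfl⟩, hx⟩
    refine ⟨t, ht, U.symm y, ⟨⟨U.symm y, by simp⟩, ?_, rfl⟩, ?_⟩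
    · have e : U (z - ρ • U.symm (y : E)) = U z - ρ • (y : E) := by simp
      change ‖z - ρ • U.symm (y : E)‖ ≤ R
      rw [← U.norm_map, e]
      exact hy
    · apply U.injective
      simp [← hx]
  · rintro ⟨t, ht, _, ⟨y, hy, rfl⟩, rfl⟩
    refine ⟨t, ht, U y, ⟨⟨U y, by simp⟩, ?_, rfl⟩, by simp⟩
    change ‖U z - ρ • U (y : E)‖ ≤ R
    rw [← map_smul, ← map_sub, U.norm_map]
    exact hy

/-- The reflection in the hyperplane orthogonal to z - z' exchanges two vectors of equal norm. -/
theorem capMeasure_eq_of_norm_eq (ρ R : ℝ) {z z' : E} (h : ‖z‖ = ‖z'‖) :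
    capMeasure ρ R z = capMeasure ρ R z' := by
  rw [← capMeasure_map ρ R (Submodule.reflection (ℝ ∙ (z - z'))ᗮ) z, Submodule.reflection_sub h]

theorem capMeasure_eq_zero {ρ R : ℝ} (hρ : 0 ≤ ρ) {z : E} (h : R < |‖z‖ - ρ|) :
    capMeasure ρ R z = 0 := by
  rw [capMeasure, show {y : Metric.sphere (0 : E) 1 | ‖z - ρ • (y : E)‖ ≤ R} = ∅ from ?_,
    measure_empty]
  ext y
  simp only [Set.mem_ofPred_eq, Set.mem_empty_iff_false, iff_false, not_le]
  refine h.trans_le ?_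
  have h1 := abs_norm_sub_norm_le z (ρ • (y : E))
  rwa [norm_smul, Real.norm_of_nonneg hρ, norm_eq_of_mem_sphere, mul_one] at h1

/-- Tonelli and the substitution z = x + ρy: the weight at z measures those y for which z - ρy lies
in the ball. -/
theorem lintegral_ball_sphere_eq (ρ R : ℝ) {f : E → ENNReal} (hf : Measurable f) :
    ∫⁻ x in Metric.closedBall (0 : E) R,
      ∫⁻ y : Metric.sphere (0 : E) 1, f (x + ρ • (y : E)) ∂(volume : Measure E).toSphere =
    ∫⁻ z, f z * capMeasure ρ R z := by
  set σ := (volume : Measure E).toSphere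
  have hm1 : Measurable fun p : E × Metric.sphere (0 : E) 1 => f (p.1 + ρ • (p.2 : E)) :=
    hf.comp (by fun_prop)
  have hm2 : Measurable fun p : E × Metric.sphere (0 : E) 1 =>
      {p : E × Metric.sphere (0 : E) 1 | ‖p.1 - ρ • (p.2 : E)‖ ≤ R}.indicator
        (fun p => f p.1) p :=
    (hf.comp measurable_fst).indicator (measurableSet_prod_cap ρ R)
  rw [lintegral_lintegral_swap hm1.aemeasurable]
  calc ∫⁻ y : Metric.sphere (0 : E) 1, (∫⁻ x in Metric.closedBall (0 : E) R, f (x + ρ • (y : E))) ∂σ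
      = ∫⁻ y : Metric.sphere (0 : E) 1, (∫⁻ z,
        {p : E × Metric.sphere (0 : E) 1 | ‖p.1 - ρ • (p.2 : E)‖ ≤ R}.indicator
          (fun p => f p.1) (z, y)) ∂σ := by
        refine lintegral_congr fun y => ?_
        rw [← lintegral_indicator Metric.isClosed_closedBall.measurableSet]
        refine Eq.trans (lintegral_congr fun x => ?_) (lintegral_add_right_eq_self (μ := volume)
          (fun z => {p : E × Metric.sphere (0 : E) 1 | ‖p.1 - ρ • (p.2 : E)‖ ≤ R}.indicator
            (fun p => f p.1) (z, y)) (ρ • (y : E)))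
        by_cases hx : ‖x‖ ≤ R <;> simp [Set.indicator, hx]
    _ = ∫⁻ z, ∫⁻ y : Metric.sphere (0 : E) 1,
        {p : E × Metric.sphere (0 : E) 1 | ‖p.1 - ρ • (p.2 : E)‖ ≤ R}.indicator
          (fun p => f p.1) (z, y) ∂σ := (lintegral_lintegral_swap hm2.aemeasurable).symm
    _ = _ := by
        refine lintegral_congr fun z => ?_
        have : ∀ y : Metric.sphere (0 : E) 1,
            {p : E × Metric.sphere (0 : E) 1 | ‖p.1 - ρ • (p.2 : E)‖ ≤ R}.indicator
              (fun p => f p.1) (z, y) =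
            {y : Metric.sphere (0 : E) 1 | ‖z - ρ • (y : E)‖ ≤ R}.indicator (fun _ => f z) y := by
          intro y
          simp [Set.indicator]
        simp only [this]
        rw [lintegral_indicator_const (measurableSet_cap ρ R z)]
        rfl

theorem measurable_capMeasure (ρ R : ℝ) : Measurable (capMeasure (E := E) ρ R) :=
  measurable_measure_prodMk_left (measurableSet_prod_cap ρ R)

theorem lintegral_ball_sphere_polar [Nontrivial E] (ρ R : ℝ) (e : Metric.sphere (0 : E) 1)
    {f : E → ENNReal} (hf : Measurable f) :
    ∫⁻ x in Metric.closedBall (0 : E) R,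
      ∫⁻ y : Metric.sphere (0 : E) 1, f (x + ρ • (y : E)) ∂(volume : Measure E).toSphere =
    ∫⁻ r in Set.Ioi (0 : ℝ), ENNReal.ofReal (r ^ (Module.finrank ℝ E - 1)) *
      capMeasure ρ R (r • (e : E)) *
      ∫⁻ y : Metric.sphere (0 : E) 1, f (r • (y : E)) ∂(volume : Measure E).toSphere := by
  rw [lintegral_ball_sphere_eq ρ R hf, lintegral_polar
    (show Measurable fun z => f z * capMeasure ρ R z from hf.mul (measurable_capMeasure ρ R))]
  refine lintegral_congr fun r => ?_
  have : ∀ y : Metric.sphere (0 : E) 1,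
      capMeasure ρ R (r • (y : E)) = capMeasure ρ R (r • (e : E)) := fun y =>
    capMeasure_eq_of_norm_eq ρ R (by simp [norm_smul])
  simp only [this]
  have hr : Measurable fun y : Metric.sphere (0 : E) 1 => f (r • (y : E)) := hf.comp (by fun_prop)
  rw [lintegral_mul_const _ hr, mul_assoc, mul_comm (lintegral _ _)]

/-- Averaging over all translations by vectors of norm at most `R` reduces integrals over shifted
spheres to integrals over spheres about the origin. -/
theorem lintegral_ball_sphere_le [Nontrivial E] {ρ R : ℝ} (hρ : 0 ≤ ρ) {f : E → ENNReal}
    (hf : Measurable f) {m : ENNReal}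
    (h : ∀ r : ℝ, 0 < r → |r - ρ| ≤ R →
      ∫⁻ y : Metric.sphere (0 : E) 1, f (r • (y : E)) ∂(volume : Measure E).toSphere ≤
        m * (volume : Measure E).toSphere Set.univ) :
    ∫⁻ x in Metric.closedBall (0 : E) R,
      ∫⁻ y : Metric.sphere (0 : E) 1, f (x + ρ • (y : E)) ∂(volume : Measure E).toSphere ≤
    m * (volume (Metric.closedBall (0 : E) R) * (volume : Measure E).toSphere Set.univ) := by
  obtain ⟨e⟩ : Nonempty (Metric.sphere (0 : E) 1) :=
    (NormedSpace.sphere_nonempty.2 zero_le_one).to_subtype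
  -- The same identity for a constant function evaluates the total weight, so the caps need not be
  -- computed.
  have h1 := lintegral_ball_sphere_polar ρ R e (f := fun _ => m) measurable_const
  simp only [lintegral_const, Measure.restrict_apply MeasurableSet.univ, Set.univ_inter] at h1
  rw [lintegral_ball_sphere_polar ρ R e hf]
  calc _ ≤ ∫⁻ r in Set.Ioi (0 : ℝ), ENNReal.ofReal (r ^ (Module.finrank ℝ E - 1)) *
        capMeasure ρ R (r • (e : E)) * (m * (volume : Measure E).toSphere Set.univ) := by
        refine setLIntegral_mono_ae' measurableSet_Ioi (.of_forall fun r hr => ?_)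
        have hr' : (0 : ℝ) < r := hr
        by_cases hR : |r - ρ| ≤ R
        · gcongr
          exact h r hr' hR
        · rw [capMeasure_eq_zero hρ]
          · simp
          · rw [norm_smul, norm_eq_of_mem_sphere, mul_one, Real.norm_of_nonneg hr'.le]
            exact not_le.1 hR
    _ = _ := by rw [← h1]; ring

theorem integral_ball_sphere_le [Nontrivial E] {ρ R : ℝ} (hρ : 0 ≤ ρ) {g : E → ℝ}
    (hg : Continuous g) (hg0 : ∀ x, 0 ≤ g x) {m : ℝ} (hm : 0 ≤ m)
    (h : ∀ r : ℝ, 0 < r → |r - ρ| ≤ R →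
      ∫ y : Metric.sphere (0 : E) 1, g (r • (y : E)) ∂(volume : Measure E).toSphere ≤
        m * (volume : Measure E).toSphere.real Set.univ) :
    ∫ x in Metric.closedBall (0 : E) R,
      ∫ y : Metric.sphere (0 : E) 1, g (x + ρ • (y : E)) ∂(volume : Measure E).toSphere ≤
    m * (volume.real (Metric.closedBall (0 : E) R) *
      (volume : Measure E).toSphere.real Set.univ) := by
  set σ := (volume : Measure E).toSphere
  have hc : Continuous fun x => ∫ y : Metric.sphere (0 : E) 1, g (x + ρ • (y : E)) ∂σ :=
    continuous_integral_sphere (hg.comp (by fun_prop))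
  have hR0 : 0 ≤ m * (volume.real (Metric.closedBall (0 : E) R) * σ.real Set.univ) := by positivity
  have hfin : volume (Metric.closedBall (0 : E) R) ≠ ⊤ := measure_closedBall_lt_top.ne
  have key := lintegral_ball_sphere_le (R := R) hρ (f := fun x => ENNReal.ofReal (g x))
    hg.measurable.ennreal_ofReal (m := ENNReal.ofReal m) fun r hr hrR => by
      rw [← ofReal_integral_eq_lintegral_ofReal
        (integrable_sphere (f := fun y : Metric.sphere (0 : E) 1 => g (r • (y : E))) (hg.comp (by fun_prop)))
        (.of_forall fun y => hg0 _), ← ofReal_measureReal (measure_ne_top _ _),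
        ← ENNReal.ofReal_mul hm]
      exact ENNReal.ofReal_le_ofReal (h r hr hrR)
  rw [← ENNReal.ofReal_le_ofReal_iff hR0, ofReal_integral_eq_lintegral_ofReal
    (hc.continuousOn.integrableOn_compact (isCompact_closedBall 0 R))
    (.of_forall fun x => integral_nonneg fun y => hg0 _), ENNReal.ofReal_mul hm,
    ENNReal.ofReal_mul measureReal_nonneg, ofReal_measureReal hfin,
    ofReal_measureReal (measure_ne_top _ _)]
  refine le_trans (le_of_eq (lintegral_congr fun x => ?_)) key
  exact ofReal_integral_eq_lintegral_ofReal
    (integrable_sphere (f := fun y : Metric.sphere (0 : E) 1 => g (x + ρ • (y : E))) (hg.comp (by fun_prop)))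
    (.of_forall fun y => hg0 _)

end Rotation

/-! ### Cesàro bound from the growth condition -/

section Upper

variable {N : ℕ}

theorem integral_sphere_sq_le_of_M₂_le (hN : 2 ≤ N) {h : EuclideanSpace ℝ (Fin N) → ℝ} {r b : ℝ}
    (hb : M₂ h r ≤ b) : ∫ y : Metric.sphere (0 : EuclideanSpace ℝ (Fin N)) 1,
      h (r • (y : EuclideanSpace ℝ (Fin N))) ^ 2
        ∂(volume : Measure (EuclideanSpace ℝ (Fin N))).toSphere ≤
      b ^ 2 * (volume : Measure (EuclideanSpace ℝ (Fin N))).toSphere.real Set.univ := by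
  have hσ := toSphere_real_univ_pos hN
  rw [M₂_eq] at hb
  have h1 := (Real.sqrt_le_left ((Real.sqrt_nonneg _).trans hb)).1 hb
  rwa [inv_mul_le_iff₀ hσ, mul_comm] at h1

/-- Jensen for the mollifier, whose values are bounded. The radius m + 2 is that of the sphere, m +
1, plus the kernel radius 1. -/
theorem sphereSup_sq_le (hN : 2 ≤ N) (m : ℕ) : ∃ C : ℝ, 0 < C ∧
    ∀ f : EuclideanSpace ℝ (Fin N) → ℝ, IsHarmonicOnSpace f →
      sphereSup m f ^ 2 ≤ C * ∫ x in Metric.closedBall 0 ((m : ℝ) + 2), f x ^ 2 := by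
  obtain ⟨φ, hφ, hr⟩ := exists_reproducing_mollifier hN
  have hφc := hφ.contDiff.continuous
  obtain ⟨C, hC⟩ := hφ.hasCompactSupport.exists_bound_of_continuous hφc
  refine ⟨|C| + 1, by positivity, fun f hf => ?_⟩
  have hc : Continuous f := (isHarmonicOnSpace_iff.1 hf).1.continuous
  set I := ∫ x in Metric.closedBall 0 ((m : ℝ) + 2), f x ^ 2
  have hI : 0 ≤ I := integral_nonneg fun x => sq_nonneg _
  rw [← Real.le_sqrt (sphereSup_nonneg f m) (by positivity)]
  refine sphereSup_le (Real.sqrt_nonneg _) fun x hx => Real.abs_le_sqrt ?_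
  refine ((hr f hf).sq_le hφ hc x).trans ?_
  rw [← integral_const_mul, ← setIntegral_eq_integral_of_forall_compl_eq_zero
    (s := Metric.closedBall 0 ((m : ℝ) + 2))]
  · refine setIntegral_mono (Reproduces.integrable hφ (hc.pow 2) x).integrableOn
      ((continuous_const.mul (hc.pow 2)).continuousOn.integrableOn_compact
        (isCompact_closedBall _ _)) fun t => ?_
    change f t ^ 2 * φ (x - t) ≤ (|C| + 1) * f t ^ 2
    rw [mul_comm]
    gcongr
    have h1 := hC (x - t)
    rw [Real.norm_eq_abs] at h1
    linarith [le_abs_self (φ (x - t)), le_abs_self C]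
  · intro t ht
    rw [mem_closedBall_zero_iff, not_le] at ht
    rw [hφ.eq_zero _ _, mul_zero]
    have := norm_sub_norm_le t x
    rw [norm_sub_rev] at this
    linarith

/-- Bessel's inequality about each x, integrated over the ball. Averaging is essential: h² is
controlled only on spheres about the origin, not on those about x. -/
theorem sum_integral_ball_le (hN : 2 ≤ N) (k : Fin N) {h : EuclideanSpace ℝ (Fin N) → ℝ}
    (hh : IsHarmonicOnSpace h) {ρ R b : ℝ} (hρ : 0 < ρ)
    (hb : ∀ r : ℝ, 0 < r → |r - ρ| ≤ R → M₂ h r ≤ b) (K : ℕ) :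
    ∑ n ∈ Finset.range K, zonalNormSq N n * ρ ^ (2 * n) *
      (∫ x in Metric.closedBall 0 R, (partialDeriv k)^[n] h x ^ 2) ≤
    b ^ 2 * volume.real (Metric.closedBall (0 : EuclideanSpace ℝ (Fin N)) R) := by
  have := nontrivial_euclideanSpace hN
  have hσ := toSphere_real_univ_pos hN
  have hc : Continuous h := (isHarmonicOnSpace_iff.1 hh).1.continuous
  have hcn : ∀ n, Continuous ((partialDeriv k)^[n] h) := fun n =>
    (isHarmonicOnSpace_iff.1 (hh.iterate_partialDeriv hN k n)).1.continuous
  have hi : ∀ n, IntegrableOn (fun x => zonalNormSq N n * ρ ^ (2 * n) *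
      (partialDeriv k)^[n] h x ^ 2) (Metric.closedBall 0 R) := fun n =>
    (continuous_const.mul ((hcn n).pow 2)).continuousOn.integrableOn_compact
      (isCompact_closedBall _ _)
  have hcs : Continuous fun x : EuclideanSpace ℝ (Fin N) =>
      ∫ y : Metric.sphere (0 : EuclideanSpace ℝ (Fin N)) 1,
        h (x + ρ • (y : EuclideanSpace ℝ (Fin N))) ^ 2
          ∂(volume : Measure (EuclideanSpace ℝ (Fin N))).toSphere :=
    continuous_integral_sphere ((hc.comp (by fun_prop)).pow 2)
  have key := integral_ball_sphere_le hρ.le (hc.pow 2) (fun x => sq_nonneg (h x)) (sq_nonneg b)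
    fun r hr hrR => integral_sphere_sq_le_of_M₂_le hN (hb r hr hrR)
  simp only [← integral_const_mul]
  rw [← integral_finsetSum _ fun n _ => hi n, ← mul_le_mul_iff_right₀ hσ, ← integral_const_mul]
  refine (setIntegral_mono_on ?_ ?_ Metric.isClosed_closedBall.measurableSet
    fun x _ => ?_).trans (key.trans_eq (by ring))
  · exact (integrable_finsetSum _ fun n _ => hi n).const_mul _
  · exact hcs.continuousOn.integrableOn_compact (isCompact_closedBall _ _)
  · refine le_trans (le_of_eq ?_) (sum_zonalNormSq_mul_le hN k hh x hρ K)
    congr 1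
    refine Finset.sum_congr rfl fun n _ => ?_
    rw [mul_pow, ← pow_mul, mul_comm n 2, mul_assoc]

theorem not_distributionallyUnbounded_of_growth (hN : 2 ≤ N) (k : Fin N)
    {h : EuclideanSpace ℝ (Fin N) → ℝ} (hh : IsHarmonicOnSpace h) {c : ℝ} (hc : 0 < c)
    (hg : ∀ᶠ r : ℝ in atTop, M₂ h r ≤ c * (Real.exp r / r ^ ((N : ℝ) / 2 - 3 / 4))) :
    ¬ OrbitDistributionallyUnbounded sphereSup (partialDeriv k) h := by
  rintro ⟨m, B, hB, hT⟩
  set R : ℝ := (m : ℝ) + 2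
  set a : ℝ := (N : ℝ) / 2 - 3 / 4
  have hR : 0 < R := by positivity
  have ha : 0 ≤ a := by
    have : (2 : ℝ) ≤ N := by exact_mod_cast hN
    simp only [a]
    linarith
  obtain ⟨r₀, hr₀⟩ := eventually_atTop.1 hg
  -- For l ≥ l₀ every r within R of l satisfies r ≥ r₀ and r ≥ l/2. Hence G(r) ≤ e^R 2^a G(l), which
  -- explains `D`.
  obtain ⟨l₀, hl₀⟩ := exists_nat_ge (max (2 * R + 1) (r₀ + R))
  set D : ℝ := c * Real.exp R * 2 ^ a
  set u : ℕ → ℝ := fun n => ∫ x in Metric.closedBall 0 R, (partialDeriv k)^[n] h x ^ 2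
  have hu : ∀ n, 0 ≤ u n := fun n => integral_nonneg fun x => sq_nonneg _
  obtain ⟨C₁, hC₁, hS⟩ := sphereSup_sq_le hN m
  obtain ⟨C₂, hC₂, hK⟩ := exists_sum_le_of_growth hN hu (l₀ := l₀)
    (C := D ^ 2 * volume.real (Metric.closedBall (0 : EuclideanSpace ℝ (Fin N)) R))
    fun l hl K => by
      have hl' : (l₀ : ℝ) ≤ l := by exact_mod_cast hl
      have hl1 : 2 * R + 1 ≤ l := (le_max_left _ _).trans (hl₀.trans hl')
      have hl2 : r₀ + R ≤ l := (le_max_right _ _).trans (hl₀.trans hl')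
      have hlp : (0 : ℝ) < l := by linarith
      refine (sum_integral_ball_le hN k hh hlp (b := D * (Real.exp l / (l : ℝ) ^ a))
        (fun r hr hrR => ?_) K).trans_eq ?_
      · obtain ⟨h1, h2⟩ := abs_le.1 hrR
        refine (hr₀ r (by linarith)).trans ?_
        have e1 : Real.exp r ≤ Real.exp R * Real.exp l := by
          rw [← Real.exp_add]
          exact Real.exp_le_exp.2 (by linarith)
        have e2 : (l : ℝ) ^ a ≤ 2 ^ a * r ^ a := by
          rw [← Real.mul_rpow (by norm_num) hr.le]
          exact Real.rpow_le_rpow hlp.le (by linarith) ha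
        have hra : 0 < r ^ a := Real.rpow_pos_of_pos hr a
        have hla : 0 < (l : ℝ) ^ a := Real.rpow_pos_of_pos hlp a
        have e3 : Real.exp r / r ^ a ≤ (Real.exp R * Real.exp l) * (2 ^ a / (l : ℝ) ^ a) := by
          rw [div_eq_mul_inv]
          gcongr
          rw [inv_eq_one_div, div_le_div_iff₀ hra hla]
          linarith
        calc c * (Real.exp r / r ^ a)
            ≤ c * ((Real.exp R * Real.exp l) * (2 ^ a / (l : ℝ) ^ a)) := by gcongr
          _ = _ := by simp only [D]; ring
      · have e4 : (l : ℝ) ^ ((N : ℝ) - 3 / 2) = ((l : ℝ) ^ a) ^ 2 := by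
          rw [← Real.rpow_natCast, ← Real.rpow_mul hlp.le]
          congr 1
          simp only [a]
          push_cast
          ring
        have e5 : Real.exp (2 * l) = Real.exp l ^ 2 := by
          rw [← Real.exp_nat_mul]
          norm_num
        rw [e4, e5, mul_pow, div_pow]
        ring
  refine upperDensity_ne_one_of_cesaro_bounded (f := fun n => sphereSup m ((partialDeriv k)^[n] h) ^ 2)
    (fun n => sq_nonneg _) (mul_pos hC₁ hC₂) (fun K hK1 => ?_)
    ((tendsto_pow_atTop two_ne_zero).comp hT) hB
  calc ∑ n ∈ Finset.range K, sphereSup m ((partialDeriv k)^[n] h) ^ 2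
      ≤ ∑ n ∈ Finset.range K, C₁ * u n :=
        Finset.sum_le_sum fun n _ => hS _ (hh.iterate_partialDeriv hN k n)
    _ ≤ C₁ * C₂ * K := by
        rw [← Finset.mul_sum, mul_assoc]
        gcongr
        exact hK K hK1

end Upper

theorem mainTheorem2 (N : ℕ) (hN : 2 ≤ N) (k : Fin N) :
    (∀ φ : ℝ → ℝ, (∀ r : ℝ, 0 < r → 0 ≤ φ r) → Tendsto φ atTop atTop →
      ∃ h : EuclideanSpace ℝ (Fin N) → ℝ,
        IsHarmonicOnSpace h ∧
        DistributionallyIrregular sphereSup (partialDeriv k) h ∧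
        ∀ᶠ r : ℝ in atTop,
          M₂ h r ≤ φ r * (Real.exp r / r ^ ((N : ℝ) / 2 - 3 / 4))) ∧
    ¬ ∃ h : EuclideanSpace ℝ (Fin N) → ℝ,
        IsHarmonicOnSpace h ∧
        DistributionallyIrregular sphereSup (partialDeriv k) h ∧
        ∃ c : ℝ, 0 < c ∧ ∀ᶠ r : ℝ in atTop,
          M₂ h r ≤ c * (Real.exp r / r ^ ((N : ℝ) / 2 - 3 / 4)) := by
  refine ⟨fun φ _ hφ => exists_distributionallyIrregular hN k hφ, ?_⟩
  rintro ⟨h, hh, hi, c, hc, hg⟩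
  exact not_distributionallyUnbounded_of_growth hN k hh hc hg hi.1
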